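/- Let $\hat{\mathcal A}_n$ be the degree completion of the $\mathbb Q$-algebra of horizontal chord diagrams on $n$ strands: generators $t^{ij}=t^{ji}$ ($1\le i\neq j\le n$), relations $[t^{ij},t^{ik}+t^{jk}]=0$ for distinct $i,j,k$ and $[t^{ij},t^{kl}]=0$ for distinct $i,j,k,l$. "Modulo 2FF" means modulo the closed two-sided ideal generated by all $u[x,y]$ with $u$ of degree at least $2$. For $n=3$ write $a=t^{12}$, $b=t^{23}$, $c=t^{13}$, $[ab]=ab-ba$. For a diagram $D$, $D^{xy\dots z}$ is $D$ with its strands $1,2,\dots$ placed on the strands $x,y,\dots,z$, and $\Delta$ in the $i$-th place denotes doubling of the $i$-th strand. For $\lambda\in\mathbb Q[[x,y]]$ put, in commuting variables $a,b,c$, $$\mathrm{Hex}^l=\frac{e^{b+c}}{ab}+\frac{e^c}{bc}+\frac1{ac},\qquad \mathrm{Hex}^r=\lambda(a,b)e^{b+c}+\lambda(c,b)e^c+\lambda(c,a).$$ The 1FF hexagon equation for $\lambda$ is $\mathrm{Hex}^l=\mathrm{Hex}^r$ on the plane $a+b+c=0$ (multiplied by $e^a$ it reads, for symmetric $\lambda$,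 $\lambda(a,b)+e^{-b}\lambda(b,c)+e^a\lambda(a,c)=\frac1{ab}+\frac{e^{-b}}{bc}+\frac{e^a}{ac}$). Let $\lambda\in\mathbb Q[[x,y]]$ be symmetric, let $R=\exp(t^{12})\in\hat{\mathcal A}_2$, and let $$\Phi=1+[ab]\lambda(a,b)-a[ab]\,\partial_a\lambda(a,b)-b[ab]\,\partial_b\lambda(a,b)\in\hat{\mathcal A}_3 .$$ Then $R$ and $\Phi$ are invertible, and the following hold. (i) If $\lambda$ solves the 1FF hexagon equation, then modulo 2FF $\Phi$ satisfies the positive hexagon $$(\Delta 1)R=\Phi\cdot R^{23}\cdot(\Phi^{-1})^{132}\cdot R^{13}\cdot\Phi^{312},$$ the negative hexagon (the same equation with $R^{-1}$ in place of $R$), and the pentagon $$\Phi^{123}\cdot(1\Delta1)\Phi\cdot\Phi^{234}=(\Delta11)\Phi\cdot(11\Delta)\Phi .$$ (ii) Whether or not $\lambda$ solves the 1FF hexagon equation, the two sides of the positive hexagon, after subtraction of $e^be^c$, are modulo 2FF $$e^{b+c}-e^be^c=[ab]\,\mathrm{Hex}^l+b[ab]\,(1+\partial_a-\partial_b)\mathrm{Hex}^l+c[ab]\,(1+\partial_a-\partial_c)\mathrm{Hex}^l,$$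 $$\Phi R^{23}(\Phi^{-1})^{132}R^{13}\Phi^{312}-e^be^c=[ab]\,\mathrm{Hex}^r+b[ab]\,(1+\partial_a-\partial_b)\mathrm{Hex}^r+c[ab]\,(1+\partial_a-\partial_c)\mathrm{Hex}^r .$$ Here the partial derivatives are taken with $a,b,c$ as independent variables, and $a=-b-c$ is substituted afterwards; all six components are then power series in $b,c$. These components are uniquely determined: if $P,Q,S\in\mathbb Q[[b,c]]$ and $[ab]P+b[ab]Q+c[ab]S=0$ modulo 2FF, then $P=Q=S=0$. -/

import Mathlib

open Finset

/-! ## Horizontal chord diagrams on `n` vertical strands -/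

/-- Defining relations of the algebra of horizontal chord diagrams on `n` strands.  The generator
`(i, j)` is the single chord between the strands `i` and `j`; there is no chord from a strand to
itself, and chords have no direction.  The remaining relations are the four-term relations and
locality in space. -/
inductive ChordRel (n : ℕ) :
    FreeAlgebra ℚ (Fin n × Fin n) → FreeAlgebra ℚ (Fin n × Fin n) → Prop
  | diag (i : Fin n) : ChordRel n (FreeAlgebra.ι ℚ (i, i)) 0
  | symm (i j : Fin n) : ChordRel n (FreeAlgebra.ι ℚ (i, j)) (FreeAlgebra.ι ℚ (j, i))
  | fourT (i j k : Fin n) (hij : i ≠ j) (hik : i ≠ k) (hjk : j ≠ k) :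
      ChordRel n
        (FreeAlgebra.ι ℚ (i, j) * (FreeAlgebra.ι ℚ (i, k) + FreeAlgebra.ι ℚ (j, k)))
        ((FreeAlgebra.ι ℚ (i, k) + FreeAlgebra.ι ℚ (j, k)) * FreeAlgebra.ι ℚ (i, j))
  | local_space (i j k l : Fin n) (hij : i ≠ j) (hik : i ≠ k) (hil : i ≠ l) (hjk : j ≠ k)
      (hjl : j ≠ l) (hkl : k ≠ l) :
      ChordRel n (FreeAlgebra.ι ℚ (i, j) * FreeAlgebra.ι ℚ (k, l))
        (FreeAlgebra.ι ℚ (k, l) * FreeAlgebra.ι ℚ (i, j))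

/-- The algebra over `ℚ` of horizontal chord diagrams on `n` strands. -/
abbrev ChordAlg (n : ℕ) : Type := RingQuot (ChordRel n)

/-- The diagram with the single chord between the strands `i` and `j`. -/
noncomputable def chordElt {n : ℕ} (i j : Fin n) : ChordAlg n :=
  RingQuot.mkAlgHom ℚ (ChordRel n) (FreeAlgebra.ι ℚ (i, j))

theorem chordElt_self {n : ℕ} (i : Fin n) : chordElt i i = 0 := by
  unfold chordElt
  rw [RingQuot.mkAlgHom_rel ℚ (ChordRel.diag i), map_zero]

theorem chordElt_comm {n : ℕ} (i j : Fin n) : chordElt i j = chordElt j i := by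
  unfold chordElt
  rw [RingQuot.mkAlgHom_rel ℚ (ChordRel.symm i j)]

theorem chordElt_fourT {n : ℕ} {i j k : Fin n} (hij : i ≠ j) (hik : i ≠ k) (hjk : j ≠ k) :
    Commute (chordElt i j) (chordElt i k + chordElt j k) := by
  have h := RingQuot.mkAlgHom_rel ℚ (ChordRel.fourT i j k hij hik hjk)
  simpa only [map_mul, map_add] using! h

theorem chordElt_local {n : ℕ} {i j k l : Fin n} (hij : i ≠ j) (hik : i ≠ k) (hil : i ≠ l)
    (hjk : j ≠ k) (hjl : j ≠ l) (hkl : k ≠ l) :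
    Commute (chordElt i j) (chordElt k l) := by
  have h := RingQuot.mkAlgHom_rel ℚ (ChordRel.local_space i j k l hij hik hil hjk hjl hkl)
  simpa only [map_mul] using! h

/-- The counit, which kills every chord. -/
noncomputable def chordCounit (n : ℕ) : ChordAlg n →ₐ[ℚ] ℚ :=
  RingQuot.liftAlgHom ℚ ⟨FreeAlgebra.lift ℚ (fun _ => (0 : ℚ)), by
    intro x y h
    cases h <;> simp⟩

theorem chordCounit_chordElt {n : ℕ} (i j : Fin n) : chordCounit n (chordElt i j) = 0 := by
  simp [chordCounit, chordElt]

/-- The two-sided ideal of elements of degree at least one.  Since the algebra is generated in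
degree one, `chordAug n ^ N` is the ideal of elements of degree at least `N`. -/
noncomputable abbrev chordAug (n : ℕ) : Ideal (ChordAlg n) := RingHom.ker (chordCounit n)

/-- The single chord between `i` and `j`, as an element of positive degree. -/
noncomputable def chord {n : ℕ} (i j : Fin n) : chordAug n :=
  ⟨chordElt i j, chordCounit_chordElt i j⟩

/-! ## The formal completion -/

/-- The completed algebra: the inverse limit of the quotients by the elements of degree at
least `N`. -/
noncomputable def ChordHat (n : ℕ) : Subring (∀ N : ℕ, ChordAlg n ⧸ chordAug n ^ N) where
  carrier := {x | ∀ (M N : ℕ) (h : M ≤ N),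
    Ideal.Quotient.factor (Ideal.pow_le_pow_right h) (x N) = x M}
  mul_mem' hx hy M N h := (RingHom.map_mul _ _ _).trans (congrArg₂ _ (hx M N h) (hy M N h))
  one_mem' _ _ _ := RingHom.map_one _
  add_mem' hx hy M N h := (RingHom.map_add _ _ _).trans (congrArg₂ _ (hx M N h) (hy M N h))
  zero_mem' _ _ _ := RingHom.map_zero _
  neg_mem' hx M N h := (RingHom.map_neg _ _).trans (congrArg _ (hx M N h))

/-- The inclusion of the chord algebra in its completion. -/
noncomputable def toHat (n : ℕ) : ChordAlg n →+* ChordHat n where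
  toFun x := ⟨fun N => Ideal.Quotient.mk (chordAug n ^ N) x, fun M N h => by simp⟩
  map_one' := rfl
  map_mul' _ _ := rfl
  map_zero' := rfl
  map_add' _ _ := rfl

/-- The infinite sum `∑ d, p d` of terms `p d` of degree at least `d`. -/
noncomputable def hatSum {n : ℕ} (p : ℕ → ChordAlg n) (hp : ∀ d, p d ∈ chordAug n ^ d) :
    ChordHat n :=
  ⟨fun N => Ideal.Quotient.mk (chordAug n ^ N) (∑ d ∈ range N, p d), fun M N h => by
    rw [Ideal.Quotient.factor_mk, Ideal.Quotient.eq, ← Finset.sum_range_add_sum_Ico p h,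
      add_sub_cancel_left]
    exact Ideal.sum_mem _ fun d hd =>
      Ideal.pow_le_pow_right (Finset.mem_Ico.1 hd).1 (hp d)⟩

/-- The exponential series of an element of positive degree. -/
noncomputable def hatExp {n : ℕ} (x : chordAug n) : ChordHat n :=
  hatSum (fun d => ((d.factorial : ℚ)⁻¹) • (x : ChordAlg n) ^ d) fun d =>
    Submodule.smul_of_tower_mem _ _ (Ideal.pow_mem_pow x.2 d)

/-- The value `∑ f i j * x ^ i * y ^ j` of a power series in two commuting variables at two
elements of positive degree (which need not commute, so that the order of the factors matters
where it is not forgotten by the quotient under consideration). -/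
noncomputable def hatEval {n : ℕ} (f : MvPowerSeries (Fin 2) ℚ) (x y : chordAug n) :
    ChordHat n :=
  hatSum (fun d => ∑ ij ∈ antidiagonal d,
      MvPowerSeries.coeff (Finsupp.single 0 ij.1 + Finsupp.single 1 ij.2) f •
        ((x : ChordAlg n) ^ ij.1 * (y : ChordAlg n) ^ ij.2)) fun d =>
    Ideal.sum_mem _ fun ij hij => Submodule.smul_of_tower_mem _ _ (by
      rw [← mem_antidiagonal.1 hij, Ideal.IsTwoSided.pow_add]
      exact Ideal.mul_mem_mul (Ideal.pow_mem_pow x.2 _) (Ideal.pow_mem_pow y.2 _))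

/-! ## Two frozen feet -/

/-- The two-sided ideal spanned by the products `u * [x, y] * v` with `u` of degree at least two:
in the quotient all chords after the first two commute. -/
noncomputable def twoFFIdeal (n : ℕ) : Ideal (ChordAlg n) :=
  Ideal.span {z | ∃ u ∈ chordAug n ^ 2, ∃ x y v : ChordAlg n, z = u * (x * y - y * x) * v}

instance twoFFIdeal_isTwoSided (n : ℕ) : (twoFFIdeal n).IsTwoSided where
  mul_mem_of_left {a} b ha := by
    refine Submodule.span_induction (p := fun z _ => z * b ∈ twoFFIdeal n) ?_ ?_ ?_ ?_ ha
    · rintro z ⟨u, hu, x, y, v, rfl⟩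
      exact Ideal.subset_span ⟨u, hu, x, y, v * b, by rw [mul_assoc]⟩
    · simp
    · intro z w _ _ hz hw
      rw [add_mul]
      exact add_mem hz hw
    · intro r z _ hz
      rw [smul_eq_mul, mul_assoc]
      exact Ideal.mul_mem_left _ _ hz

/-- The (closed) two-sided ideal 2FF of the completed algebra: the elements which, in every
degree, agree with an element of the ideal spanned by the `u * [x, y] * v`. -/
noncomputable def twoFF (n : ℕ) : Ideal (ChordHat n) where
  carrier := {z | ∀ N : ℕ, ∃ w ∈ twoFFIdeal n, Ideal.Quotient.mk (chordAug n ^ N) w = z.1 N}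
  add_mem' {x y} hx hy N := by
    obtain ⟨w, hw, h⟩ := hx N
    obtain ⟨w₁, hw₁, h₁⟩ := hy N
    exact ⟨w + w₁, add_mem hw hw₁, by rw [map_add, h, h₁]; rfl⟩
  zero_mem' N := ⟨0, zero_mem _, rfl⟩
  smul_mem' c x hx N := by
    obtain ⟨w, hw, h⟩ := hx N
    obtain ⟨r, hr⟩ := Ideal.Quotient.mk_surjective (c.1 N)
    exact ⟨r * w, Ideal.mul_mem_left _ _ hw, by rw [map_mul, h, hr]; rfl⟩

instance twoFF_isTwoSided (n : ℕ) : (twoFF n).IsTwoSided where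
  mul_mem_of_left {a} b ha N := by
    obtain ⟨w, hw, h⟩ := ha N
    obtain ⟨r, hr⟩ := Ideal.Quotient.mk_surjective (b.1 N)
    exact ⟨w * r, Ideal.mul_mem_right _ _ hw, by rw [map_mul, h, hr]; rfl⟩

/-- Equality in the quotient of the completed algebra by 2FF. -/
def EqMod2FF {n : ℕ} (x y : ChordHat n) : Prop :=
  Ideal.Quotient.mk (twoFF n) x = Ideal.Quotient.mk (twoFF n) y

/-! ## Operations on strands -/

section Cabling

variable {n m : ℕ}

/-- The image of a chord when the strand `i` is replaced by the strands in `S i`: the sum over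
all ways of lifting its two ends. -/
noncomputable def cableElt (S : Fin n → Finset (Fin m)) (ij : Fin n × Fin n) : ChordAlg m :=
  if ij.1 = ij.2 then 0 else ∑ p ∈ S ij.1, ∑ q ∈ S ij.2, chordElt p q

theorem cableElt_comm (S : Fin n → Finset (Fin m)) (i j : Fin n) :
    cableElt S (i, j) = cableElt S (j, i) := by
  unfold cableElt
  by_cases h : i = j
  · subst h; rfl
  · rw [if_neg h, if_neg (Ne.symm h), Finset.sum_comm]
    exact Finset.sum_congr rfl fun p _ => Finset.sum_congr rfl fun q _ => chordElt_comm q p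

theorem cableElt_local (S : Fin n → Finset (Fin m)) (hS : ∀ i j, i ≠ j → Disjoint (S i) (S j))
    {i j k l : Fin n} (hij : i ≠ j) (hik : i ≠ k) (hil : i ≠ l) (hjk : j ≠ k) (hjl : j ≠ l)
    (hkl : k ≠ l) : Commute (cableElt S (i, j)) (cableElt S (k, l)) := by
  have hne : ∀ {x y : Fin n}, x ≠ y → ∀ {p q : Fin m}, p ∈ S x → q ∈ S y → p ≠ q :=
    fun {_ _} hxy {p q} hp hq => Finset.disjoint_iff_ne.1 (hS _ _ hxy) p hp q hq
  simp only [cableElt, if_neg hij, if_neg hkl]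
  refine Commute.sum_left _ _ _ fun p hp => Commute.sum_left _ _ _ fun q hq =>
    Commute.sum_right _ _ _ fun r hr => Commute.sum_right _ _ _ fun s hs => ?_
  exact chordElt_local (hne hij hp hq) (hne hik hp hr) (hne hil hp hs) (hne hjk hq hr)
    (hne hjl hq hs) (hne hkl hr hs)

theorem cableElt_fourT (S : Fin n → Finset (Fin m)) (hS : ∀ i j, i ≠ j → Disjoint (S i) (S j))
    {i j k : Fin n} (hij : i ≠ j) (hik : i ≠ k) (hjk : j ≠ k) :
    Commute (cableElt S (i, j)) (cableElt S (i, k) + cableElt S (j, k)) := by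
  have hne : ∀ {x y : Fin n}, x ≠ y → ∀ {p q : Fin m}, p ∈ S x → q ∈ S y → p ≠ q :=
    fun {_ _} hxy {p q} hp hq => Finset.disjoint_iff_ne.1 (hS _ _ hxy) p hp q hq
  simp only [cableElt, if_neg hij, if_neg hik, if_neg hjk]
  refine Commute.sum_left _ _ _ fun p hp => Commute.sum_left _ _ _ fun q hq => ?_
  rw [← Finset.add_sum_erase _ _ hp, ← Finset.add_sum_erase _ _ hq, add_add_add_comm,
    ← Finset.sum_add_distrib]
  refine Commute.add_right (Commute.sum_right _ _ _ fun r hr =>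
    chordElt_fourT (hne hij hp hq) (hne hik hp hr) (hne hjk hq hr))
    (Commute.add_right ?_ ?_)
  · refine Commute.sum_right _ _ _ fun p₁ hp₁ => Commute.sum_right _ _ _ fun r hr => ?_
    obtain ⟨h1, h2⟩ := Finset.mem_erase.1 hp₁
    exact chordElt_local (hne hij hp hq) (Ne.symm h1) (hne hik hp hr)
      (hne hij h2 hq).symm (hne hjk hq hr) (hne hik h2 hr)
  · refine Commute.sum_right _ _ _ fun q₁ hq₁ => Commute.sum_right _ _ _ fun r hr => ?_
    obtain ⟨h1, h2⟩ := Finset.mem_erase.1 hq₁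
    exact chordElt_local (hne hij hp hq) (hne hij hp h2) (hne hik hp hr) (Ne.symm h1)
      (hne hjk hq hr) (hne hjk h2 hr)

/-- Replacing the strand `i` by the parallel strands in `S i` (and adding the strands of `Fin m`
that lie in no `S i`), on chord diagrams.  This covers strand doubling, the permutation of
strands, and the placing of a diagram on some of the strands. -/
noncomputable def cableAlg (S : Fin n → Finset (Fin m))
    (hS : ∀ i j, i ≠ j → Disjoint (S i) (S j)) : ChordAlg n →ₐ[ℚ] ChordAlg m :=
  RingQuot.liftAlgHom ℚ ⟨FreeAlgebra.lift ℚ (cableElt S), by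
    intro x y h
    cases h with
    | diag i => simp [cableElt]
    | symm i j => simpa using cableElt_comm S i j
    | fourT i j k hij hik hjk => simpa using (cableElt_fourT S hS hij hik hjk).eq
    | local_space i j k l hij hik hil hjk hjl hkl =>
      simpa using (cableElt_local S hS hij hik hil hjk hjl hkl).eq⟩

theorem chordAug_le_comap (S : Fin n → Finset (Fin m))
    (hS : ∀ i j, i ≠ j → Disjoint (S i) (S j)) :
    chordAug n ≤ (chordAug m).comap (cableAlg S hS) := by
  have h : (chordCounit m).comp (cableAlg S hS) = chordCounit n := by
    apply RingQuot.ringQuot_ext'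
    apply FreeAlgebra.hom_ext
    funext ij
    simp only [Function.comp_apply, AlgHom.coe_comp, cableAlg, RingQuot.liftAlgHom_mkAlgHom_apply,
      FreeAlgebra.lift_ι_apply, chordCounit]
    unfold cableElt
    split_ifs
    · simp
    · simp only [map_sum]
      exact Finset.sum_eq_zero fun p _ => Finset.sum_eq_zero fun q _ => chordCounit_chordElt p q
  intro x hx
  rw [Ideal.mem_comap, RingHom.mem_ker]
  rw [RingHom.mem_ker, ← h] at hx
  exact hx

theorem chordAug_pow_le_comap (S : Fin n → Finset (Fin m))
    (hS : ∀ i j, i ≠ j → Disjoint (S i) (S j)) (N : ℕ) :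
    chordAug n ^ N ≤ (chordAug m ^ N).comap (cableAlg S hS) := by
  induction N with
  | zero =>
    intro x _
    rw [Ideal.mem_comap, Submodule.pow_zero, Ideal.one_eq_top]
    exact Submodule.mem_top
  | succ k ih =>
    rw [Submodule.pow_succ, Submodule.pow_succ, Ideal.mul_le]
    intro x hx y hy
    rw [Ideal.mem_comap, map_mul]
    exact Ideal.mul_mem_mul (ih hx) (chordAug_le_comap S hS hy)

/-- The operation `cableAlg` on the completed algebras. -/
noncomputable def cable (S : Fin n → Finset (Fin m))
    (hS : ∀ i j, i ≠ j → Disjoint (S i) (S j)) : ChordHat n →+* ChordHat m where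
  toFun x := ⟨fun N => Ideal.quotientMap (chordAug m ^ N) (cableAlg S hS : ChordAlg n →+* ChordAlg m)
      (chordAug_pow_le_comap S hS N) (x.1 N), fun M N h => by
    obtain ⟨r, hr⟩ := Ideal.Quotient.mk_surjective (x.1 N)
    have hM : x.1 M = Ideal.Quotient.mk (chordAug n ^ M) r := by
      rw [← x.2 M N h, ← hr, Ideal.Quotient.factor_mk]
    beta_reduce
    rw [← hr, hM]
    rfl⟩
  map_one' := Subtype.ext (funext fun N => map_one _)
  map_mul' x y := Subtype.ext (funext fun N => map_mul _ (x.1 N) (y.1 N))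
  map_zero' := Subtype.ext (funext fun N => map_zero _)
  map_add' x y := Subtype.ext (funext fun N => map_add _ (x.1 N) (y.1 N))

end Cabling

/-! ## The hexagons and the pentagon modulo 2FF

Strands are numbered from `0`, so that the strand set `{0}` below is the first strand. -/

/-- The positive hexagon `(Δ1)R = Φ · R²³ · (Φ⁻¹)¹³² · R¹³ · Φ³¹²` modulo 2FF. -/
def PosHexagon (R : (ChordHat 2)ˣ) (Φ : (ChordHat 3)ˣ) : Prop :=
  EqMod2FF
    (cable ![{0, 1}, {2}] (by decide) (R : ChordHat 2))
    ((Φ : ChordHat 3)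
      * cable ![{1}, {2}] (by decide) (R : ChordHat 2)
      * cable ![{0}, {2}, {1}] (by decide) ((Φ⁻¹ : (ChordHat 3)ˣ) : ChordHat 3)
      * cable ![{0}, {2}] (by decide) (R : ChordHat 2)
      * cable ![{2}, {0}, {1}] (by decide) (Φ : ChordHat 3))

/-- The negative hexagon `(Δ1)(R⁻¹) = Φ · (R⁻¹)²³ · (Φ⁻¹)¹³² · (R⁻¹)¹³ · Φ³¹²` modulo 2FF. -/
def NegHexagon (R : (ChordHat 2)ˣ) (Φ : (ChordHat 3)ˣ) : Prop :=
  PosHexagon R⁻¹ Φ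

/-- The pentagon `Φ¹²³ · (1Δ1)Φ · Φ²³⁴ = (Δ11)Φ · (11Δ)Φ` modulo 2FF. -/
def Pentagon (Φ : (ChordHat 3)ˣ) : Prop :=
  EqMod2FF
    (cable (m := 4) ![{0}, {1}, {2}] (by decide) (Φ : ChordHat 3)
      * cable (m := 4) ![{0}, {1, 2}, {3}] (by decide) (Φ : ChordHat 3)
      * cable (m := 4) ![{1}, {2}, {3}] (by decide) (Φ : ChordHat 3))
    (cable (m := 4) ![{0, 1}, {2}, {3}] (by decide) (Φ : ChordHat 3)
      * cable (m := 4) ![{0}, {1}, {2, 3}] (by decide) (Φ : ChordHat 3))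

namespace Three

/-- The chord `a` between the first and the second of three strands. -/
noncomputable def a : chordAug 3 := chord 0 1

/-- The chord `b` between the second and the third of three strands. -/
noncomputable def b : chordAug 3 := chord 1 2

/-- The chord `c` between the first and the third of three strands. -/
noncomputable def c : chordAug 3 := chord 0 2

/-- The commutator `[ab]`. -/
noncomputable def ab : ChordAlg 3 := (a : ChordAlg 3) * b - (b : ChordAlg 3) * a

/-- `1 + [ab]l(a,b) - a[ab]∂₁l(a,b) - b[ab]∂₂l(a,b)`. -/
noncomputable def phi (l : MvPowerSeries (Fin 2) ℚ) : ChordHat 3 :=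
  1 + toHat 3 ab * hatEval l a b
    - toHat 3 (a * ab) * hatEval (MvPowerSeries.pderiv ℚ 0 l) a b
    - toHat 3 (b * ab) * hatEval (MvPowerSeries.pderiv ℚ 1 l) a b

/-- `[ab]P(b,c) + b[ab]Q(b,c) + c[ab]S(b,c)`: the element with components `P`, `Q`, `S`. -/
noncomputable def ofComponents (P Q S : MvPowerSeries (Fin 2) ℚ) : ChordHat 3 :=
  toHat 3 ab * hatEval P b c + toHat 3 (b * ab) * hatEval Q b c
    + toHat 3 (c * ab) * hatEval S b c

end Three

/-! ## The 1FF hexagon equation, in commuting variables -/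

/-- Power series in three commuting variables `a`, `b`, `c`. -/
abbrev Ser3 : Type := MvPowerSeries (Fin 3) ℚ

/-- Quotients of power series in three commuting variables. -/
abbrev Frac3 : Type := FractionRing Ser3

/-- The partial derivative of a quotient `N / D`, by the quotient rule. -/
noncomputable def fracPartial (i : Fin 3) (F : Frac3) : Frac3 :=
  let N : Ser3 := (IsLocalization.sec (nonZeroDivisors Ser3) F).1
  let D : Ser3 := (IsLocalization.sec (nonZeroDivisors Ser3) F).2
  (algebraMap Ser3 Frac3 (MvPowerSeries.pderiv ℚ i N) * algebraMap Ser3 Frac3 D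
    - algebraMap Ser3 Frac3 N * algebraMap Ser3 Frac3 (MvPowerSeries.pderiv ℚ i D))
    / algebraMap Ser3 Frac3 D ^ 2

/-- The partial derivative of a quotient does not depend on how it is written. -/
theorem fracPartial_div (i : Fin 3) (N D : Ser3) (hD : D ≠ 0) :
    fracPartial i (algebraMap Ser3 Frac3 N / algebraMap Ser3 Frac3 D) =
      (algebraMap Ser3 Frac3 (MvPowerSeries.pderiv ℚ i N) * algebraMap Ser3 Frac3 D
        - algebraMap Ser3 Frac3 N * algebraMap Ser3 Frac3 (MvPowerSeries.pderiv ℚ i D))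
        / algebraMap Ser3 Frac3 D ^ 2 := by
  set F := algebraMap Ser3 Frac3 N / algebraMap Ser3 Frac3 D with hF
  unfold fracPartial
  have hsec := IsLocalization.sec_spec (nonZeroDivisors Ser3) F
  have hne : ((IsLocalization.sec (nonZeroDivisors Ser3) F).2 : Ser3) ≠ 0 :=
    nonZeroDivisors.coe_ne_zero _
  generalize (IsLocalization.sec (nonZeroDivisors Ser3) F).1 = N' at hsec
  generalize ((IsLocalization.sec (nonZeroDivisors Ser3) F).2 : Ser3) = D' at hsec hne
  have hinj := IsFractionRing.injective Ser3 Frac3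
  have h0 : algebraMap Ser3 Frac3 D ≠ 0 := by simpa using hD
  have h1 : algebraMap Ser3 Frac3 D' ≠ 0 := by simpa using hne
  have key : N * D' = N' * D := by
    apply hinj
    rw [map_mul, map_mul, ← hsec, hF]
    field_simp
  have hd : MvPowerSeries.pderiv ℚ i N * D' + N * MvPowerSeries.pderiv ℚ i D'
      = MvPowerSeries.pderiv ℚ i N' * D + N' * MvPowerSeries.pderiv ℚ i D := by
    have := congrArg (MvPowerSeries.pderiv ℚ i) key
    simp only [Derivation.leibniz, smul_eq_mul] at this
    linear_combination this
  have key1 := congrArg (algebraMap Ser3 Frac3) key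
  have hd1 := congrArg (algebraMap Ser3 Frac3) hd
  simp only [map_mul, map_add] at key1 hd1
  simp only
  rw [div_eq_div_iff (pow_ne_zero 2 h1) (pow_ne_zero 2 h0)]
  generalize algebraMap Ser3 Frac3 (MvPowerSeries.pderiv ℚ i N) = dN at *
  generalize algebraMap Ser3 Frac3 (MvPowerSeries.pderiv ℚ i D) = dD at *
  generalize algebraMap Ser3 Frac3 (MvPowerSeries.pderiv ℚ i N') = dN' at *
  generalize algebraMap Ser3 Frac3 (MvPowerSeries.pderiv ℚ i D') = dD' at *
  generalize algebraMap Ser3 Frac3 N = n at *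
  generalize algebraMap Ser3 Frac3 N' = n' at *
  generalize algebraMap Ser3 Frac3 D = d at *
  generalize algebraMap Ser3 Frac3 D' = d' at *
  linear_combination (-d * d') * hd1 + (d * dD' + d' * dD) * key1

/-- Setting `a = -b-c` in a power series in `a`, `b`, `c`; the result is a power series in the
two variables `b`, `c`. -/
noncomputable def planeSubst (F : Ser3) : MvPowerSeries (Fin 2) ℚ :=
  MvPowerSeries.subst
    (![-MvPowerSeries.X 0 - MvPowerSeries.X 1, MvPowerSeries.X 0, MvPowerSeries.X 1] :
      Fin 3 → MvPowerSeries (Fin 2) ℚ) F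

/-- On the plane `a + b + c = 0` the quotient `F` is the power series `P` in `b` and `c`: it can
be written `N / D` with `D` not identically zero on that plane, and there `N = P * D`. -/
def RestrictsTo (F : Frac3) (P : MvPowerSeries (Fin 2) ℚ) : Prop :=
  ∃ N D : Ser3, planeSubst D ≠ 0 ∧ F = algebraMap Ser3 Frac3 N / algebraMap Ser3 Frac3 D ∧
    planeSubst N = P * planeSubst D

namespace HexEq

/-- The variable `a`. -/
noncomputable def a : Ser3 := MvPowerSeries.X 0

/-- The variable `b`. -/
noncomputable def b : Ser3 := MvPowerSeries.X 1

/-- The variable `c`. -/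
noncomputable def c : Ser3 := MvPowerSeries.X 2

/-- The exponential series of a power series without constant term. -/
noncomputable def exp (x : Ser3) : Ser3 := (PowerSeries.exp ℚ).subst x

/-- The power series `l(x, y)`. -/
noncomputable def at2 (l : MvPowerSeries (Fin 2) ℚ) (x y : Ser3) : Ser3 :=
  MvPowerSeries.subst (![x, y] : Fin 2 → Ser3) l

/-- `e^{b+c}/(ab) + e^c/(bc) + 1/(ac)`. -/
noncomputable def lhs : Frac3 :=
  algebraMap Ser3 Frac3 (exp (b + c)) / algebraMap Ser3 Frac3 (a * b)
    + algebraMap Ser3 Frac3 (exp c) / algebraMap Ser3 Frac3 (b * c)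
    + 1 / algebraMap Ser3 Frac3 (a * c)

/-- `l(a,b)e^{b+c} + l(c,b)e^c + l(c,a)`. -/
noncomputable def rhs (l : MvPowerSeries (Fin 2) ℚ) : Frac3 :=
  algebraMap Ser3 Frac3 (at2 l a b * exp (b + c) + at2 l c b * exp c + at2 l c a)

/-- The 1FF hexagon equation for `l`: both sides agree on the plane `a + b + c = 0`.  (Multiplied
by `e^a` it reads `l(a,b) + e^{-b}l(b,c) + e^a l(a,c) = 1/(ab) + e^{-b}/(bc) + e^a/(ac)` for
symmetric `l`.) -/
def Holds (l : MvPowerSeries (Fin 2) ℚ) : Prop :=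
  ∃ P : MvPowerSeries (Fin 2) ℚ, RestrictsTo lhs P ∧ RestrictsTo (rhs l) P

/-- The operator `1 + ∂_a - ∂_b`. -/
noncomputable def opB (F : Frac3) : Frac3 := F + fracPartial 0 F - fracPartial 1 F

/-- The operator `1 + ∂_a - ∂_c`. -/
noncomputable def opC (F : Frac3) : Frac3 := F + fracPartial 0 F - fracPartial 2 F

end HexEq

/-- `H` has, modulo 2FF, the components `F`, `(1 + ∂_a - ∂_b)F`, `(1 + ∂_a - ∂_c)F` along `[ab]`,
`b[ab]`, `c[ab]`, where `a = -b-c` in the components. -/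
def HasHexComponents (H : ChordHat 3) (F : Frac3) : Prop :=
  ∃ P Q S : MvPowerSeries (Fin 2) ℚ,
    RestrictsTo F P ∧ RestrictsTo (HexEq.opB F) Q ∧ RestrictsTo (HexEq.opC F) S ∧
      EqMod2FF H (Three.ofComponents P Q S)

/-! ## Evaluation of power series at nilpotent elements -/

section NilEval

variable {σ τ : Type*} [Finite σ] {E : Type*} [CommRing E]

/-! Since 2FF is closed, everything can be checked in the quotients `Level n N` by 2FF and by the
elements of degree at least `N` (`eqMod2FF_iff_hatLevel`). Let `A` be such a quotient and `I` its
ideal of elements of positive degree. The elements `z` of `I ^ 2` with `I ^ 2 * z = 0` form a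
two-sided ideal `comIdeal I` of square zero, which contains all commutators of elements of `I`. On
it the right multiplications `r x` commute with each other and with the left multiplications `l x`,
and `l x * l y = 0`. So all these operators lie in one commutative algebra, in which they are
nilpotent, and power series can be evaluated there. Put `D x = r x - l x`, the operator `z ↦ [z,
x]`.

Taylor's formula in the direction of the `l x` stops after the first order. Hence the three terms of
`Φ - 1` are just `λ(D a, D b)[ab]` (`IsMulOps.truncPhi_eq`), and the element with components `P`, `P
- ∂_b P`, `P - ∂_c P` is `(1 + l b + l c) P(D b, D c)[ab]` (`IsMulOps.components_eq`). As `a + b +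
c` is central, `D a + D b + D c = 0` and `[ab] = [bc] = [ca]`; this is where the plane `a + b + c =
0` comes from. The derivatives `∂_a - ∂_b` and `∂_a - ∂_c` are tangent to that plane, and in the
coordinates `b`, `c` they are `-∂_b` and `-∂_c`.

Right side of the hexagon: products with two factors from `comIdeal I` vanish, `e^x z = (1 + l x) z`
on that ideal, and `exp (r x) = exp (D x) (1 + l x)`. So the right side minus `e^b e^c` is `(1 + l b
+ l c) Hex^r(D b, D c)[ab]` (`IsMulOps.hexagon_right`). Left side: the restriction of `Hex^l` to the
plane is minus the second divided difference of `exp` at `0`, `c`, `b + c`, hence a power series,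
`hexSer`. All factors after the first two act on `I ^ 2` by commuting right multiplications, and
comparing the coefficients of `bb`, `bc`, `cb`, `cc` leaves four identities for `hexSer`
(`exp_add_sub_exp_mul_exp`). The 1FF equation therefore gives the positive hexagon. The negative one
follows by exchanging `a` and `c` on the plane, which for symmetric `λ` corresponds on `Hex^l` to
`(b, c) ↦ (-b, -c)`.

The pentagon needs only the symmetry of `λ`. Square zero turns it into a linear identity. Its
contribution from the monomial `x^i y^j` is antisymmetric in `i`, `j` (`pentagonDefect_add_swap`):
after one formal vector `y` is adjoined, the four brackets involved behave like `y`, `-y`, `y`,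
`-y`, and the five terms telescope to `t12^i t23^j y - t23^i t12^j y`.

Uniqueness comes from triangular 3 by 3 representations that kill 2FF and separate `[ab]`, `b[ab]`,
`c[ab]` (`planeRep`). -/

theorem hasSubst_C_of_isNilpotent {v : σ → E} (hv : ∀ s, IsNilpotent (v s)) :
    MvPowerSeries.HasSubst (fun s => (MvPowerSeries.C (v s) : MvPowerSeries (Fin 0) E)) :=
  MvPowerSeries.hasSubst_of_constantCoeff_nilpotent fun s => by simpa using hv s

/-- Power series in no variables are scalars; this is what allows substitution into `MvPowerSeries
(Fin 0) E` to serve as evaluation in `E`. -/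
theorem C_constantCoeff_fin_zero (x : MvPowerSeries (Fin 0) E) :
    MvPowerSeries.C (MvPowerSeries.constantCoeff x) = x := by
  ext n
  rw [Subsingleton.elim n 0]
  simp

theorem forall_fin_two_isNilpotent {x y : E} (hx : IsNilpotent x) (hy : IsNilpotent y) :
    ∀ s, IsNilpotent ((![x, y] : Fin 2 → E) s) := by
  intro s
  fin_cases s
  · exact hx
  · exact hy

theorem add_pow_of_sq_eq_zero {x ξ : E} (h : ξ * ξ = 0) (n : ℕ) :
    (x + ξ) ^ n = x ^ n + n * (ξ * x ^ (n - 1)) := by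
  induction n with
  | zero => simp
  | succ k ih =>
    rw [pow_succ, ih]
    rcases k with _ | k
    · simp
    · simp only [Nat.add_sub_cancel, Nat.cast_add, Nat.cast_one, pow_succ]
      linear_combination ((k : E) + 1) * x ^ k * h

variable [Algebra ℚ E]

/-- The value of a power series at a family of nilpotent elements of a commutative algebra. -/
noncomputable def nilEval {σ : Type*} {E : Type*} [CommRing E] [Algebra ℚ E] (v : σ → E)
    (f : MvPowerSeries σ ℚ) : E :=
  MvPowerSeries.constantCoeff
    (MvPowerSeries.subst (fun s => (MvPowerSeries.C (v s) : MvPowerSeries (Fin 0) E)) f)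

/-- `nilEval` as a homomorphism of rings. -/
noncomputable def nilEvalHom (v : σ → E) (hv : ∀ s, IsNilpotent (v s)) :
    MvPowerSeries σ ℚ →+* E :=
  (MvPowerSeries.constantCoeff (σ := Fin 0) (R := E)).comp
    (MvPowerSeries.substAlgHom (hasSubst_C_of_isNilpotent hv)).toRingHom

theorem nilEvalHom_apply (v : σ → E) (hv : ∀ s, IsNilpotent (v s)) (f : MvPowerSeries σ ℚ) :
    nilEvalHom v hv f = nilEval v f := by
  simp [nilEvalHom, nilEval, MvPowerSeries.coe_substAlgHom]

theorem nilEval_X {v : σ → E} (hv : ∀ s, IsNilpotent (v s)) (s : σ) :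
    nilEval v (MvPowerSeries.X s) = v s := by
  rw [nilEval, MvPowerSeries.subst_X (hasSubst_C_of_isNilpotent hv), MvPowerSeries.constantCoeff_C]

theorem nilEval_eq_finsum {v : σ → E} (hv : ∀ s, IsNilpotent (v s)) (f : MvPowerSeries σ ℚ) :
    nilEval v f = ∑ᶠ d : σ →₀ ℕ, MvPowerSeries.coeff d f • d.prod fun s e => v s ^ e := by
  rw [nilEval, MvPowerSeries.constantCoeff_subst (hasSubst_C_of_isNilpotent hv)]
  refine finsum_congr fun d => ?_
  simp [map_finsuppProd]

/-- Transitivity of substitution. It transports identities between power series in `b`, `c`, proved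
once and for all, to the operators. -/
theorem nilEval_subst [Finite τ] {v : σ → E} (hv : ∀ s, IsNilpotent (v s))
    {a : τ → MvPowerSeries σ ℚ} (ha : ∀ t, MvPowerSeries.constantCoeff (a t) = 0)
    (f : MvPowerSeries τ ℚ) :
    nilEval v (MvPowerSeries.subst a f) = nilEval (fun t => nilEval v (a t)) f := by
  rw [nilEval, MvPowerSeries.subst_comp_subst_apply
    (MvPowerSeries.hasSubst_of_constantCoeff_zero ha) (hasSubst_C_of_isNilpotent hv), nilEval]
  congr 2
  funext t
  rw [nilEval, C_constantCoeff_fin_zero]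

theorem isNilpotent_nilEval {v : σ → E} (hv : ∀ s, IsNilpotent (v s)) {f : MvPowerSeries σ ℚ}
    (hf : MvPowerSeries.constantCoeff f = 0) : IsNilpotent (nilEval v f) :=
  MvPowerSeries.IsNilpotent_subst (hasSubst_C_of_isNilpotent hv) (f := f)
    (by rw [hf]; exact IsNilpotent.zero)

theorem nilEval_unit {x : E} {n : ℕ} (hn : x ^ n = 0) (g : PowerSeries ℚ) :
    nilEval (fun _ : Unit => x) g = ∑ i ∈ range n, PowerSeries.coeff i g • x ^ i := by
  have h1 : ∀ i, (Finsupp.uniqueEquiv (M := ℕ) ()).symm i = Finsupp.single () i := by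
    intro i
    ext
    simp
  rw [nilEval_eq_finsum (fun _ => ⟨n, hn⟩),
    ← finsum_comp_equiv (Finsupp.uniqueEquiv (M := ℕ) ()).symm,
    finsum_eq_sum_of_support_subset (s := range n)]
  · refine Finset.sum_congr rfl fun i _ => ?_
    rw [h1, Finsupp.prod_single_index (by simp)]
    rfl
  · intro i hi
    by_contra h
    apply hi
    beta_reduce
    rw [h1, Finsupp.prod_single_index (by simp)]
    rw [pow_eq_zero_of_le (by simpa using h) hn, smul_zero]

theorem nilEval_powerSeries_subst {v : σ → E} (hv : ∀ s, IsNilpotent (v s))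
    {f : MvPowerSeries σ ℚ} (hf : MvPowerSeries.constantCoeff f = 0) {n : ℕ}
    (hn : nilEval v f ^ n = 0) (g : PowerSeries ℚ) :
    nilEval v (g.subst f) = ∑ i ∈ range n, PowerSeries.coeff i g • nilEval v f ^ i := by
  rw [← nilEval_unit hn, PowerSeries.subst_def, nilEval_subst hv (fun _ => hf)]

theorem nilEval_exp_subst {v : σ → E} (hv : ∀ s, IsNilpotent (v s)) {f : MvPowerSeries σ ℚ}
    (hf : MvPowerSeries.constantCoeff f = 0) :
    nilEval v ((PowerSeries.exp ℚ).subst f) = IsNilpotent.exp (nilEval v f) := by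
  obtain ⟨n, hn⟩ := isNilpotent_nilEval hv hf
  rw [nilEval_powerSeries_subst hv hf hn, IsNilpotent.exp_eq_sum hn]
  simp [PowerSeries.coeff_exp]

theorem nilEval_eq_sum {x y : E} (hx : IsNilpotent x) (hy : IsNilpotent y)
    (f : MvPowerSeries (Fin 2) ℚ) (s : Finset (ℕ × ℕ))
    (hs : ∀ p, p ∉ s → x ^ p.1 * y ^ p.2 = 0) :
    nilEval ![x, y] f = ∑ p ∈ s,
      MvPowerSeries.coeff (Finsupp.single 0 p.1 + Finsupp.single 1 p.2) f •
        (x ^ p.1 * y ^ p.2) := by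
  have key : ∀ p : ℕ × ℕ, (finTwoArrowEquiv' ℕ).symm p =
      Finsupp.single 0 p.1 + Finsupp.single 1 p.2 := by
    intro p
    ext i
    fin_cases i <;> simp [finTwoArrowEquiv']
  have key2 : ∀ p : ℕ × ℕ, ((finTwoArrowEquiv' ℕ).symm p).prod
      (fun s e => (![x, y] : Fin 2 → E) s ^ e) = x ^ p.1 * y ^ p.2 := by
    intro p
    rw [Finsupp.prod_fintype _ _ (by simp), Fin.prod_univ_two, key]
    simp
  rw [nilEval_eq_finsum (forall_fin_two_isNilpotent hx hy),
    ← finsum_comp_equiv (finTwoArrowEquiv' ℕ).symm, finsum_eq_sum_of_support_subset (s := s)]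
  · refine Finset.sum_congr rfl fun p _ => ?_
    rw [key2, key]
  · intro p hp
    by_contra h
    apply hp
    beta_reduce
    rw [key2, hs p (by simpa using h), smul_zero]

theorem nilEval_eq_sum_range {x y : E} (f : MvPowerSeries (Fin 2) ℚ) {m n : ℕ}
    (hx : x ^ m = 0) (hy : y ^ n = 0) :
    nilEval ![x, y] f = ∑ i ∈ range m, ∑ j ∈ range n,
      MvPowerSeries.coeff (Finsupp.single 0 i + Finsupp.single 1 j) f • (x ^ i * y ^ j) := by
  rw [nilEval_eq_sum ⟨m, hx⟩ ⟨n, hy⟩ f (range m ×ˢ range n), Finset.sum_product]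
  intro p hp
  rw [Finset.mem_product, Finset.mem_range, Finset.mem_range, not_and_or, not_lt, not_lt] at hp
  rcases hp with hp | hp
  · rw [pow_eq_zero_of_le hp hx, zero_mul]
  · rw [pow_eq_zero_of_le hp hy, mul_zero]

theorem nilEval_eq_sum_antidiagonal {x y : E} (hx : IsNilpotent x) (hy : IsNilpotent y)
    (f : MvPowerSeries (Fin 2) ℚ) {n : ℕ} (h : ∀ i j, n ≤ i + j → x ^ i * y ^ j = 0) :
    nilEval ![x, y] f = ∑ d ∈ range n, ∑ p ∈ antidiagonal d,
      MvPowerSeries.coeff (Finsupp.single 0 p.1 + Finsupp.single 1 p.2) f •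
        (x ^ p.1 * y ^ p.2) := by
  rw [nilEval_eq_sum hx hy f ((range n).biUnion antidiagonal), Finset.sum_biUnion]
  · intro i _ j _ hij
    rw [Function.onFun, Finset.disjoint_left]
    intro p hp hq
    exact hij ((mem_antidiagonal.1 hp).symm.trans (mem_antidiagonal.1 hq))
  · intro p hp
    apply h
    by_contra hlt
    exact hp (Finset.mem_biUnion.2 ⟨p.1 + p.2, by simpa using hlt, by simp⟩)

/-- An index shift: the factor `i` removes the term `i = 0`, where the truncated exponent `i - 1`
would be wrong. -/
theorem sum_coeff_pderiv_zero {x z : E} (f : MvPowerSeries (Fin 2) ℚ) (m j : ℕ) :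
    ∑ i ∈ range (m + 1), MvPowerSeries.coeff (Finsupp.single 0 i + Finsupp.single 1 j) f •
        ((i : E) * x ^ (i - 1) * z) =
      ∑ i ∈ range m, MvPowerSeries.coeff (Finsupp.single 0 i + Finsupp.single 1 j)
        (MvPowerSeries.pderiv ℚ 0 f) • (x ^ i * z) := by
  rw [Finset.sum_range_succ']
  simp only [Nat.cast_zero, zero_mul, smul_zero, add_zero]
  refine Finset.sum_congr rfl fun i _ => ?_
  rw [MvPowerSeries.coeff_pderiv, add_right_comm, ← Finsupp.single_add, Nat.add_sub_cancel]
  simp only [Finsupp.add_apply, Finsupp.single_eq_same, Algebra.smul_def, map_mul, map_add,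
    map_natCast, map_one, Nat.cast_add, Nat.cast_one]
  simp
  ring

theorem sum_coeff_pderiv_one {y z : E} (f : MvPowerSeries (Fin 2) ℚ) (n i : ℕ) :
    ∑ j ∈ range (n + 1), MvPowerSeries.coeff (Finsupp.single 0 i + Finsupp.single 1 j) f •
        (z * ((j : E) * y ^ (j - 1))) =
      ∑ j ∈ range n, MvPowerSeries.coeff (Finsupp.single 0 i + Finsupp.single 1 j)
        (MvPowerSeries.pderiv ℚ 1 f) • (z * y ^ j) := by
  rw [Finset.sum_range_succ']
  simp only [Nat.cast_zero, zero_mul, mul_zero, smul_zero, add_zero]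
  refine Finset.sum_congr rfl fun i _ => ?_
  rw [MvPowerSeries.coeff_pderiv, add_assoc, ← Finsupp.single_add, Nat.add_sub_cancel]
  simp only [Finsupp.add_apply, Finsupp.single_eq_same, Algebra.smul_def, map_mul, map_add,
    map_natCast, map_one, Nat.cast_add, Nat.cast_one]
  simp
  ring

/-- The Taylor expansion to first order. -/
theorem nilEval_add_of_sq_eq_zero {x y ξ η : E} (hx : IsNilpotent x) (hy : IsNilpotent y)
    (hξ : ξ * ξ = 0) (hη : η * η = 0) (hξη : ξ * η = 0) (f : MvPowerSeries (Fin 2) ℚ) :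
    nilEval ![x + ξ, y + η] f = nilEval ![x, y] f
      + ξ * nilEval ![x, y] (MvPowerSeries.pderiv ℚ 0 f)
      + η * nilEval ![x, y] (MvPowerSeries.pderiv ℚ 1 f) := by
  obtain ⟨m, hm⟩ := hx
  obtain ⟨n, hn⟩ := hy
  -- The perturbation costs one power: `(x + ξ) ^ (m + 1)` still contains `ξ * x ^ m`. The same
  -- shift by one is needed for the derivatives, whose sums end at `m` and `n`.
  have hm1 : x ^ (m + 1) = 0 := by rw [pow_succ, hm, zero_mul]
  have hn1 : y ^ (n + 1) = 0 := by rw [pow_succ, hn, zero_mul]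
  have hm2 : (x + ξ) ^ (m + 1) = 0 := by
    rw [add_pow_of_sq_eq_zero hξ, hm1, Nat.add_sub_cancel, hm]; simp
  have hn2 : (y + η) ^ (n + 1) = 0 := by
    rw [add_pow_of_sq_eq_zero hη, hn1, Nat.add_sub_cancel, hn]; simp
  rw [nilEval_eq_sum_range f hm2 hn2, nilEval_eq_sum_range f hm1 hn1,
    nilEval_eq_sum_range (MvPowerSeries.pderiv ℚ 0 f) hm hn1,
    nilEval_eq_sum_range (MvPowerSeries.pderiv ℚ 1 f) hm1 hn]
  conv_rhs => enter [1, 2]; rw [Finset.sum_comm]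
  simp only [← sum_coeff_pderiv_zero, ← sum_coeff_pderiv_one]
  conv_rhs => enter [1, 2]; rw [Finset.sum_comm]
  simp only [Finset.mul_sum, ← Finset.sum_add_distrib]
  refine Finset.sum_congr rfl fun i _ => Finset.sum_congr rfl fun j _ => ?_
  rw [add_pow_of_sq_eq_zero hξ, add_pow_of_sq_eq_zero hη]
  simp only [mul_smul_comm, ← smul_add]
  congr 1
  linear_combination (i : E) * j * x ^ (i - 1) * y ^ (j - 1) * hξη

end NilEval

/-! ## The chain rule and the exponential series -/

section ChainRule

variable {σ τ : Type*}

theorem pderiv_subst_coe [Fintype σ] {a : σ → MvPowerSeries τ ℚ}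
    (ha : ∀ s, MvPowerSeries.constantCoeff (a s) = 0) (p : MvPolynomial σ ℚ) (i : τ) :
    MvPowerSeries.pderiv ℚ i (MvPowerSeries.subst a (p : MvPowerSeries σ ℚ)) =
      ∑ s, MvPowerSeries.subst a (MvPowerSeries.pderiv ℚ s (p : MvPowerSeries σ ℚ)) *
        MvPowerSeries.pderiv ℚ i (a s) := by
  have hs := MvPowerSeries.hasSubst_of_constantCoeff_zero ha
  simp only [MvPowerSeries.pderiv_coe, MvPowerSeries.subst_coe]
  induction p using MvPolynomial.induction_on with
  | C r => simp [← MvPowerSeries.c_eq_algebraMap]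
  | add p q hp hq => simp only [map_add, hp, hq, add_mul, Finset.sum_add_distrib]
  | mul_X p t hp =>
    classical
    simp only [map_mul, Derivation.leibniz, MvPolynomial.aeval_X, smul_eq_mul, hp, map_add,
      MvPolynomial.pderiv_X, add_mul, Finset.sum_add_distrib, Finset.mul_sum]
    congr 1
    · rw [Finset.sum_eq_single t]
      · simp
      · intro s _ hst
        simp [hst]
      · simp
    · exact Finset.sum_congr rfl fun s _ => by ring

theorem coeff_subst_eq_zero_of_lt_order [Finite σ] {a : σ → MvPowerSeries τ ℚ}
    (ha : ∀ s, MvPowerSeries.constantCoeff (a s) = 0) {f : MvPowerSeries σ ℚ} {n : ℕ}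
    (hf : (n : ℕ∞) ≤ f.order) {e : τ →₀ ℕ} (he : e.degree < n) :
    MvPowerSeries.coeff e (MvPowerSeries.subst a f) = 0 := by
  apply MvPowerSeries.coeff_of_lt_order
  refine lt_of_lt_of_le ?_ (MvPowerSeries.le_order_subst
    (MvPowerSeries.hasSubst_of_constantCoeff_zero ha) f)
  refine lt_of_lt_of_le (Nat.cast_lt.2 he) (hf.trans ?_)
  have : (1 : ℕ∞) ≤ ⨅ i, (a i).order :=
    le_iInf fun i => MvPowerSeries.one_le_order_iff_constCoeff_eq_zero.2 (ha i)
  calc f.order = 1 * f.order := (one_mul _).symm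
    _ ≤ _ := mul_le_mul_left this _

theorem le_order_pderiv {f : MvPowerSeries σ ℚ} {n : ℕ} (hf : ((n + 1 : ℕ) : ℕ∞) ≤ f.order)
    (s : σ) : (n : ℕ∞) ≤ (MvPowerSeries.pderiv ℚ s f).order := by
  refine MvPowerSeries.nat_le_order fun d hd => ?_
  rw [MvPowerSeries.coeff_pderiv, MvPowerSeries.coeff_of_lt_order, zero_mul]
  refine lt_of_lt_of_le (Nat.cast_lt.2 ?_) hf
  rw [map_add, Finsupp.degree_single]
  omega

/-- For polynomials the chain rule is an induction. A fixed coefficient sees only a truncation of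
`f`, since substitution of series without constant term does not lower the order. -/
theorem pderiv_subst [Fintype σ] {a : σ → MvPowerSeries τ ℚ}
    (ha : ∀ s, MvPowerSeries.constantCoeff (a s) = 0) (f : MvPowerSeries σ ℚ) (i : τ) :
    MvPowerSeries.pderiv ℚ i (MvPowerSeries.subst a f) =
      ∑ s, MvPowerSeries.subst a (MvPowerSeries.pderiv ℚ s f) *
        MvPowerSeries.pderiv ℚ i (a s) := by
  have hs := MvPowerSeries.hasSubst_of_constantCoeff_zero ha
  ext e
  -- One more than the degree bound `e.degree + 1`, because differentiation lowers the order by one.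
  set n := e.degree + 2
  set p := MvPowerSeries.truncTotal n f
  obtain ⟨g, hg⟩ : ∃ g, f = (p : MvPowerSeries σ ℚ) + g := ⟨f - p, by ring⟩
  have hgo : (n : ℕ∞) ≤ g.order := by
    refine MvPowerSeries.nat_le_order fun d hd => ?_
    have := congrArg (MvPowerSeries.coeff d) hg
    rw [map_add, MvPolynomial.coeff_coe, MvPowerSeries.coeff_truncTotal f hd] at this
    simpa using this
  have hadd : ∀ g h : MvPowerSeries σ ℚ, MvPowerSeries.subst a (g + h) =
      MvPowerSeries.subst a g + MvPowerSeries.subst a h := MvPowerSeries.subst_add hs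
  rw [hg]
  simp only [hadd, map_add, add_mul, Finset.sum_add_distrib,
    pderiv_subst_coe ha]
  congr 1
  rw [MvPowerSeries.coeff_pderiv, coeff_subst_eq_zero_of_lt_order ha hgo, zero_mul, map_sum]
  · symm
    refine Finset.sum_eq_zero fun s _ => ?_
    classical
    rw [MvPowerSeries.coeff_mul]
    refine Finset.sum_eq_zero fun q hq => ?_
    rw [coeff_subst_eq_zero_of_lt_order ha (le_order_pderiv hgo s), zero_mul]
    have : q.1.degree + q.2.degree = e.degree := by
      rw [← map_add, mem_antidiagonal.1 hq]
    omega
  · rw [map_add, Finsupp.degree_single]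
    omega

/-- The exponential series of a power series without constant term. -/
noncomputable def serExp {σ : Type*} (f : MvPowerSeries σ ℚ) : MvPowerSeries σ ℚ :=
  (PowerSeries.exp ℚ).subst f

theorem pderiv_serExp {f : MvPowerSeries τ ℚ} (hf : MvPowerSeries.constantCoeff f = 0) (i : τ) :
    MvPowerSeries.pderiv ℚ i (serExp f) = serExp f * MvPowerSeries.pderiv ℚ i f := by
  rw [serExp, PowerSeries.subst_def, pderiv_subst (fun _ => hf)]
  have : MvPowerSeries.pderiv ℚ () (PowerSeries.exp ℚ) = PowerSeries.exp ℚ :=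
    PowerSeries.derivative_exp ℚ
  simp [this]

theorem subst_serExp [Fintype σ] {a : σ → MvPowerSeries τ ℚ}
    (ha : ∀ s, MvPowerSeries.constantCoeff (a s) = 0) {f : MvPowerSeries σ ℚ}
    (hf : MvPowerSeries.constantCoeff f = 0) :
    MvPowerSeries.subst a (serExp f) = serExp (MvPowerSeries.subst a f) := by
  rw [serExp, serExp, PowerSeries.subst_def, PowerSeries.subst_def]
  exact MvPowerSeries.subst_comp_subst_apply
    (MvPowerSeries.hasSubst_of_constantCoeff_zero (fun _ => hf))
    (MvPowerSeries.hasSubst_of_constantCoeff_zero ha) _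

theorem constantCoeff_fin_two {f g : MvPowerSeries σ ℚ} (hf : MvPowerSeries.constantCoeff f = 0)
    (hg : MvPowerSeries.constantCoeff g = 0) :
    ∀ s, MvPowerSeries.constantCoeff ((![f, g] : Fin 2 → MvPowerSeries σ ℚ) s) = 0 := by
  intro s
  fin_cases s
  · exact hf
  · exact hg

theorem constantCoeff_fin_three {f g h : MvPowerSeries σ ℚ}
    (hf : MvPowerSeries.constantCoeff f = 0) (hg : MvPowerSeries.constantCoeff g = 0)
    (hh : MvPowerSeries.constantCoeff h = 0) :
    ∀ s, MvPowerSeries.constantCoeff ((![f, g, h] : Fin 3 → MvPowerSeries σ ℚ) s) = 0 := by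
  intro s
  fin_cases s
  · exact hf
  · exact hg
  · exact hh

theorem serExp_X_add_X : serExp (MvPowerSeries.X 0 + MvPowerSeries.X 1 : MvPowerSeries (Fin 2) ℚ)
    = serExp (MvPowerSeries.X 0) * serExp (MvPowerSeries.X 1) := by
  ext e
  rw [serExp, serExp, serExp, PowerSeries.coeff_subst_X_zero_add_X_one,
    PowerSeries.coeff_subst_X_zero_subst_mul_X_one]
  simp only [PowerSeries.coeff_exp, Algebra.algebraMap_self, RingHom.id_apply]
  have h : (((e 0 + e 1).choose (e 0) * (e 0).factorial * (e 1).factorial : ℕ) : ℚ) =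
      ((e 0 + e 1).factorial : ℕ) := by
    rw [← Nat.choose_mul_factorial_mul_factorial (Nat.le_add_right (e 0) (e 1)),
      Nat.add_sub_cancel_left]
  push_cast at h
  field_simp
  linear_combination h

/-- The universal case of two variables is a binomial identity of coefficients; substitution gives
the rest. -/
theorem serExp_add {f g : MvPowerSeries τ ℚ} (hf : MvPowerSeries.constantCoeff f = 0)
    (hg : MvPowerSeries.constantCoeff g = 0) : serExp (f + g) = serExp f * serExp g := by
  have ha := constantCoeff_fin_two hf hg
  have hs := MvPowerSeries.hasSubst_of_constantCoeff_zero ha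
  have h := congrArg (MvPowerSeries.subst ![f, g]) serExp_X_add_X
  rw [MvPowerSeries.subst_mul hs, subst_serExp ha (by simp), subst_serExp ha (by simp),
    subst_serExp ha (by simp), MvPowerSeries.subst_add hs, MvPowerSeries.subst_X hs,
    MvPowerSeries.subst_X hs] at h
  simpa using h

end ChainRule

/-! ### Series in two variables: divided differences of the exponential function. -/

section SerTwo

theorem coeff_X_zero_mul_zero (f : MvPowerSeries (Fin 2) ℚ) (j : ℕ) :
    MvPowerSeries.coeff (Finsupp.single 0 0 + Finsupp.single 1 j) (MvPowerSeries.X 0 * f) = 0 := by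
  rw [MvPowerSeries.X, MvPowerSeries.coeff_monomial_mul, if_neg]
  intro h
  simpa using h 0

theorem coeff_X_zero_mul_succ (f : MvPowerSeries (Fin 2) ℚ) (i j : ℕ) :
    MvPowerSeries.coeff (Finsupp.single 0 (i + 1) + Finsupp.single 1 j) (MvPowerSeries.X 0 * f) =
      MvPowerSeries.coeff (Finsupp.single 0 i + Finsupp.single 1 j) f := by
  rw [MvPowerSeries.X, add_comm i 1, Finsupp.single_add, add_assoc,
    MvPowerSeries.coeff_add_monomial_mul, one_mul]

theorem coeff_X_one_mul_zero (f : MvPowerSeries (Fin 2) ℚ) (i : ℕ) :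
    MvPowerSeries.coeff (Finsupp.single 0 i + Finsupp.single 1 0) (MvPowerSeries.X 1 * f) = 0 := by
  rw [MvPowerSeries.X, MvPowerSeries.coeff_monomial_mul, if_neg]
  intro h
  simpa using h 1

theorem coeff_X_one_mul_succ (f : MvPowerSeries (Fin 2) ℚ) (i j : ℕ) :
    MvPowerSeries.coeff (Finsupp.single 0 i + Finsupp.single 1 (j + 1)) (MvPowerSeries.X 1 * f) =
      MvPowerSeries.coeff (Finsupp.single 0 i + Finsupp.single 1 j) f := by
  rw [MvPowerSeries.X, add_comm j 1, Finsupp.single_add, add_left_comm,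
    MvPowerSeries.coeff_add_monomial_mul, one_mul]

theorem coeff_serExp_X_zero (i j : ℕ) :
    MvPowerSeries.coeff (Finsupp.single 0 i + Finsupp.single 1 j)
      (serExp (MvPowerSeries.X 0 : MvPowerSeries (Fin 2) ℚ)) =
      if j = 0 then (i.factorial : ℚ)⁻¹ else 0 := by
  rw [serExp, PowerSeries.coeff_subst_single]
  simp [PowerSeries.coeff_exp]

theorem coeff_serExp_X_one (i j : ℕ) :
    MvPowerSeries.coeff (Finsupp.single 0 i + Finsupp.single 1 j)
      (serExp (MvPowerSeries.X 1 : MvPowerSeries (Fin 2) ℚ)) =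
      if i = 0 then (j.factorial : ℚ)⁻¹ else 0 := by
  rw [serExp, PowerSeries.coeff_subst_single]
  simp [PowerSeries.coeff_exp]

/-- The second divided difference of the exponential function at `0`, `x`, `y`. -/
noncomputable def expDivDiff : MvPowerSeries (Fin 2) ℚ :=
  fun m => ((m 0 + m 1 + 2).factorial : ℚ)⁻¹

theorem coeff_expDivDiff (i j : ℕ) :
    MvPowerSeries.coeff (Finsupp.single 0 i + Finsupp.single 1 j) expDivDiff =
      ((i + j + 2).factorial : ℚ)⁻¹ := by
  simp [MvPowerSeries.coeff_apply, expDivDiff]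

theorem exists_eq_single_add_single (e : Fin 2 →₀ ℕ) :
    ∃ i j, e = Finsupp.single 0 i + Finsupp.single 1 j :=
  ⟨e 0, e 1, by ext k; fin_cases k <;> simp⟩

/-- The formula `1/(xy) + e^x/(x(x-y)) + e^y/(y(y-x))` for the divided difference at `0`, `x`, `y`,
with the denominators cleared. The products are nested and factors `* 1` are kept so that every term
is a chain of multiplications by a variable, on which the coefficient lemmas act. -/
theorem mul_expDivDiff :
    MvPowerSeries.X 0 * (MvPowerSeries.X 1 * (MvPowerSeries.X 1 * expDivDiff))
      - MvPowerSeries.X 0 * (MvPowerSeries.X 0 * (MvPowerSeries.X 1 * expDivDiff)) =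
    MvPowerSeries.X 1 * 1 - MvPowerSeries.X 0 * 1
      - MvPowerSeries.X 1 * serExp (MvPowerSeries.X 0)
      + MvPowerSeries.X 0 * serExp (MvPowerSeries.X 1) := by
  ext e
  obtain ⟨i, j, rfl⟩ := exists_eq_single_add_single e
  have h1 : ∀ i j : ℕ, MvPowerSeries.coeff (Finsupp.single 0 i + Finsupp.single 1 j)
      (1 : MvPowerSeries (Fin 2) ℚ) = if i = 0 ∧ j = 0 then 1 else 0 := by
    intro i j
    rw [MvPowerSeries.coeff_one]
    congr 1
    simp
  simp only [map_add, map_sub]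
  rcases i with _ | _ | i <;> rcases j with _ | _ | j <;>
    simp only [coeff_X_zero_mul_zero, coeff_X_zero_mul_succ, coeff_X_one_mul_zero,
      coeff_X_one_mul_succ, coeff_expDivDiff, coeff_serExp_X_zero, coeff_serExp_X_one, h1] <;>
    simp [add_assoc, add_left_comm, add_comm]

/-- The remainder `(exp f - 1) / f`. -/
noncomputable def serExpOne {σ : Type*} (f : MvPowerSeries σ ℚ) : MvPowerSeries σ ℚ :=
  (PowerSeries.mk fun n => ((n + 1).factorial : ℚ)⁻¹).subst f

/-- The remainder `(exp f - 1 - f) / f ^ 2`. -/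
noncomputable def serExpTwo {σ : Type*} (f : MvPowerSeries σ ℚ) : MvPowerSeries σ ℚ :=
  (PowerSeries.mk fun n => ((n + 2).factorial : ℚ)⁻¹).subst f

theorem mul_serExpOne {σ : Type*} {f : MvPowerSeries σ ℚ}
    (hf : MvPowerSeries.constantCoeff f = 0) : f * serExpOne f = serExp f - 1 := by
  have h : PowerSeries.exp ℚ = 1 + PowerSeries.X * PowerSeries.mk
      fun n => ((n + 1).factorial : ℚ)⁻¹ := by
    ext n
    rcases n with _ | n
    · simp
    · simp [PowerSeries.coeff_succ_X_mul, PowerSeries.coeff_one, PowerSeries.coeff_exp]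
  have hs := PowerSeries.HasSubst.of_constantCoeff_zero hf
  rw [serExp, h, ← PowerSeries.coe_substAlgHom hs, map_add, map_mul, map_one,
    PowerSeries.substAlgHom_X, PowerSeries.coe_substAlgHom hs, serExpOne]
  ring

theorem mul_serExpTwo {σ : Type*} {f : MvPowerSeries σ ℚ}
    (hf : MvPowerSeries.constantCoeff f = 0) : f * (f * serExpTwo f) = serExp f - 1 - f := by
  have h : PowerSeries.exp ℚ = 1 + PowerSeries.X + PowerSeries.X * (PowerSeries.X * PowerSeries.mk
      fun n => ((n + 2).factorial : ℚ)⁻¹) := by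
    ext n
    rcases n with _ | _ | n
    · simp
    · simp [PowerSeries.coeff_succ_X_mul, PowerSeries.coeff_one, PowerSeries.coeff_exp]
    · simp [PowerSeries.coeff_succ_X_mul, PowerSeries.coeff_one, PowerSeries.coeff_exp,
        PowerSeries.coeff_X]
  have hs := PowerSeries.HasSubst.of_constantCoeff_zero hf
  rw [serExp, h, ← PowerSeries.coe_substAlgHom hs, map_add, map_add, map_mul, map_mul, map_one,
    PowerSeries.substAlgHom_X, PowerSeries.coe_substAlgHom hs, serExpTwo]
  ring

local notation "x" => (MvPowerSeries.X 0 : MvPowerSeries (Fin 2) ℚ)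
local notation "y" => (MvPowerSeries.X 1 : MvPowerSeries (Fin 2) ℚ)

/-- The restriction to the plane `a + b + c = 0` of `e^{b+c}/(ab) + e^c/(bc) + 1/(ac)`. -/
noncomputable def hexSer : MvPowerSeries (Fin 2) ℚ :=
  -MvPowerSeries.subst ![y, x + y] expDivDiff

theorem mul_hexSer : x * y * (x + y) * hexSer = (x + y) * serExp y - y * serExp (x + y) - x := by
  have ha : ∀ s, MvPowerSeries.constantCoeff ((![y, x + y] : Fin 2 → MvPowerSeries (Fin 2) ℚ) s)
      = 0 := constantCoeff_fin_two (by simp) (by simp)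
  have hs := MvPowerSeries.hasSubst_of_constantCoeff_zero ha
  have h := congrArg (MvPowerSeries.substAlgHom hs (R := ℚ)) mul_expDivDiff
  simp only [map_add, map_sub, map_mul, map_one, MvPowerSeries.substAlgHom_X] at h
  simp only [MvPowerSeries.coe_substAlgHom] at h
  rw [subst_serExp ha (by simp), subst_serExp ha (by simp), MvPowerSeries.subst_X hs,
    MvPowerSeries.subst_X hs] at h
  simp only [Matrix.cons_val_zero, Matrix.cons_val_one, mul_one] at h
  rw [hexSer]
  linear_combination -h

theorem pderiv_zero_mul_hexSer :
    (y * (x + y) + x * y) * hexSer + x * y * (x + y) * MvPowerSeries.pderiv ℚ 0 hexSer =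
      serExp y - y * serExp (x + y) - 1 := by
  have h := congrArg (MvPowerSeries.pderiv ℚ 0) mul_hexSer
  simp only [Derivation.leibniz, map_add, map_sub, smul_eq_mul, MvPowerSeries.pderiv_X_self,
    pderiv_serExp (show MvPowerSeries.constantCoeff y = 0 by simp),
    pderiv_serExp (show MvPowerSeries.constantCoeff (x + y) = 0 by simp),
    MvPowerSeries.pderiv_X_of_ne (show (1 : Fin 2) ≠ 0 by decide)] at h
  linear_combination h

theorem pderiv_one_mul_hexSer :
    (x * (x + y) + x * y) * hexSer + x * y * (x + y) * MvPowerSeries.pderiv ℚ 1 hexSer =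
      serExp y + (x + y) * serExp y - serExp (x + y) - y * serExp (x + y) := by
  have h := congrArg (MvPowerSeries.pderiv ℚ 1) mul_hexSer
  simp only [Derivation.leibniz, map_add, map_sub, smul_eq_mul, MvPowerSeries.pderiv_X_self,
    pderiv_serExp (show MvPowerSeries.constantCoeff y = 0 by simp),
    pderiv_serExp (show MvPowerSeries.constantCoeff (x + y) = 0 by simp),
    MvPowerSeries.pderiv_X_of_ne (show (0 : Fin 2) ≠ 1 by decide)] at h
  linear_combination h

theorem X_add_X_ne_zero : x + y ≠ 0 := by
  intro h
  have := congrArg (MvPowerSeries.pderiv ℚ 0) h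
  simp [MvPowerSeries.pderiv_X_self,
    MvPowerSeries.pderiv_X_of_ne (show (1 : Fin 2) ≠ 0 by decide)] at this

theorem X_fin_two_ne_zero (i : Fin 2) : (MvPowerSeries.X i : MvPowerSeries (Fin 2) ℚ) ≠ 0 := by
  intro h
  have := congrArg (MvPowerSeries.pderiv ℚ i) h
  simp [MvPowerSeries.pderiv_X_self] at this

/-- This and the next three identities are the coefficients of `xx`, `yy`, `yx`, `xy` in `e^{x+y} -
e^x e^y` modulo 2FF. In each, a monomial multiple clears the denominators, and `mul_hexSer` together
with its derivatives decides the equation in the domain of power series. -/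
theorem X_one_mul_hexSer_sub_pderiv :
    y * (hexSer - MvPowerSeries.pderiv ℚ 0 hexSer) =
      serExpTwo (x + y) - serExpTwo x * serExp y := by
  have hx := mul_serExpTwo (show MvPowerSeries.constantCoeff x = 0 by simp)
  have hs := mul_serExpTwo (show MvPowerSeries.constantCoeff (x + y) = 0 by simp)
  have he := serExp_add (show MvPowerSeries.constantCoeff x = 0 by simp)
    (show MvPowerSeries.constantCoeff y = 0 by simp)
  refine mul_left_cancel₀ (mul_ne_zero (pow_ne_zero 2 (X_fin_two_ne_zero 0))
    (pow_ne_zero 2 X_add_X_ne_zero)) ?_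
  linear_combination (x * (x + y) + (x + y) + x) * mul_hexSer
    - x * (x + y) * pderiv_zero_mul_hexSer - x ^ 2 * hs + (x + y) ^ 2 * serExp y * hx
    - (x + y) ^ 2 * he

theorem X_zero_mul_hexSer_sub_pderiv :
    x * (hexSer - MvPowerSeries.pderiv ℚ 1 hexSer) = serExpTwo y - serExpTwo (x + y) := by
  have hy := mul_serExpTwo (show MvPowerSeries.constantCoeff y = 0 by simp)
  have hs := mul_serExpTwo (show MvPowerSeries.constantCoeff (x + y) = 0 by simp)
  refine mul_left_cancel₀ (mul_ne_zero (pow_ne_zero 2 (X_fin_two_ne_zero 1))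
    (pow_ne_zero 2 X_add_X_ne_zero)) ?_
  linear_combination (y * (x + y) + (x + y) + y) * mul_hexSer
    - y * (x + y) * pderiv_one_mul_hexSer - (x + y) ^ 2 * hy + y ^ 2 * hs

theorem X_one_mul_hexSer_sub_pderiv_one :
    y * (hexSer - MvPowerSeries.pderiv ℚ 1 hexSer) = hexSer + serExpTwo (x + y) := by
  have hs := mul_serExpTwo (show MvPowerSeries.constantCoeff (x + y) = 0 by simp)
  refine mul_left_cancel₀ (mul_ne_zero (X_fin_two_ne_zero 0)
    (pow_ne_zero 2 X_add_X_ne_zero)) ?_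
  linear_combination (x + y + 1) * mul_hexSer - (x + y) * pderiv_one_mul_hexSer - x * hs

theorem X_zero_mul_hexSer_sub_pderiv_zero :
    x * (hexSer - MvPowerSeries.pderiv ℚ 0 hexSer) =
      hexSer - serExpTwo (x + y) + serExpOne y := by
  have hy := mul_serExpOne (show MvPowerSeries.constantCoeff y = 0 by simp)
  have hs := mul_serExpTwo (show MvPowerSeries.constantCoeff (x + y) = 0 by simp)
  refine mul_left_cancel₀ (mul_ne_zero (X_fin_two_ne_zero 1)
    (pow_ne_zero 2 X_add_X_ne_zero)) ?_
  linear_combination (x + y + 1) * mul_hexSer - (x + y) * pderiv_zero_mul_hexSer + y * hs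
    - (x + y) ^ 2 * hy

end SerTwo

/-! ## Restriction to the plane `a + b + c = 0` -/

section Plane

theorem constantCoeff_plane : ∀ s, MvPowerSeries.constantCoeff
    ((![-MvPowerSeries.X 0 - MvPowerSeries.X 1, MvPowerSeries.X 0, MvPowerSeries.X 1] :
      Fin 3 → MvPowerSeries (Fin 2) ℚ) s) = 0 :=
  constantCoeff_fin_three (by simp) (by simp) (by simp)

/-- Restriction to the plane as a homomorphism of rings. -/
noncomputable def planeHom : Ser3 →+* MvPowerSeries (Fin 2) ℚ :=
  (MvPowerSeries.substAlgHom (R := ℚ)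
    (MvPowerSeries.hasSubst_of_constantCoeff_zero constantCoeff_plane)).toRingHom

theorem planeHom_apply (F : Ser3) : planeHom F = planeSubst F := by
  simp [planeHom, planeSubst]

theorem planeHom_a : planeHom HexEq.a = -MvPowerSeries.X 0 - MvPowerSeries.X 1 := by
  rw [planeHom_apply, planeSubst, HexEq.a, MvPowerSeries.subst_X
    (MvPowerSeries.hasSubst_of_constantCoeff_zero constantCoeff_plane)]
  rfl

theorem planeHom_b : planeHom HexEq.b = MvPowerSeries.X 0 := by
  rw [planeHom_apply, planeSubst, HexEq.b, MvPowerSeries.subst_X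
    (MvPowerSeries.hasSubst_of_constantCoeff_zero constantCoeff_plane)]
  rfl

theorem planeHom_c : planeHom HexEq.c = MvPowerSeries.X 1 := by
  rw [planeHom_apply, planeSubst, HexEq.c, MvPowerSeries.subst_X
    (MvPowerSeries.hasSubst_of_constantCoeff_zero constantCoeff_plane)]
  rfl

theorem planeHom_exp {F : Ser3} (hF : MvPowerSeries.constantCoeff F = 0) :
    planeHom (HexEq.exp F) = serExp (planeHom F) := by
  rw [planeHom_apply, planeHom_apply]
  exact subst_serExp constantCoeff_plane hF

theorem planeHom_at2 (l : MvPowerSeries (Fin 2) ℚ) {F G : Ser3}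
    (hF : MvPowerSeries.constantCoeff F = 0) (hG : MvPowerSeries.constantCoeff G = 0) :
    planeHom (HexEq.at2 l F G) = MvPowerSeries.subst ![planeHom F, planeHom G] l := by
  rw [planeHom_apply, planeHom_apply, planeHom_apply]
  unfold planeSubst HexEq.at2
  rw [MvPowerSeries.subst_comp_subst_apply (MvPowerSeries.hasSubst_of_constantCoeff_zero
    (constantCoeff_fin_two hF hG)) (MvPowerSeries.hasSubst_of_constantCoeff_zero
    constantCoeff_plane)]
  congr 1
  funext s
  fin_cases s <;> rfl

/-- Chain rule along `a = -b-c`: moving `b` on the plane moves `a` by the opposite amount. -/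
theorem pderiv_zero_planeHom (F : Ser3) :
    MvPowerSeries.pderiv ℚ 0 (planeHom F) =
      planeHom (MvPowerSeries.pderiv ℚ 1 F) - planeHom (MvPowerSeries.pderiv ℚ 0 F) := by
  simp only [planeHom_apply]
  unfold planeSubst
  rw [pderiv_subst constantCoeff_plane, Fin.sum_univ_three]
  simp [MvPowerSeries.pderiv_X_self,
    MvPowerSeries.pderiv_X_of_ne (show (1 : Fin 2) ≠ 0 by decide)]
  ring

theorem pderiv_one_planeHom (F : Ser3) :
    MvPowerSeries.pderiv ℚ 1 (planeHom F) =
      planeHom (MvPowerSeries.pderiv ℚ 2 F) - planeHom (MvPowerSeries.pderiv ℚ 0 F) := by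
  simp only [planeHom_apply]
  unfold planeSubst
  rw [pderiv_subst constantCoeff_plane, Fin.sum_univ_three]
  simp [MvPowerSeries.pderiv_X_self,
    MvPowerSeries.pderiv_X_of_ne (show (0 : Fin 2) ≠ 1 by decide)]
  ring

theorem ne_zero_of_planeHom_ne_zero {D : Ser3} (hD : planeHom D ≠ 0) : D ≠ 0 :=
  fun h => hD (by rw [h, map_zero])

theorem algebraMap_ser3_ne_zero {D : Ser3} (hD : D ≠ 0) : algebraMap Ser3 Frac3 D ≠ 0 := by
  simpa using hD

theorem restrictsTo_div {N D : Ser3} {P : MvPowerSeries (Fin 2) ℚ} (hD : planeHom D ≠ 0)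
    (h : planeHom N = P * planeHom D) :
    RestrictsTo (algebraMap Ser3 Frac3 N / algebraMap Ser3 Frac3 D) P :=
  ⟨N, D, by rwa [planeHom_apply] at hD, rfl, by simpa only [planeHom_apply] using h⟩

theorem restrictsTo_algebraMap (N : Ser3) : RestrictsTo (algebraMap Ser3 Frac3 N) (planeHom N) := by
  have h := restrictsTo_div (N := N) (D := 1) (P := planeHom N) (by simp) (by simp)
  simpa using h

/-- Cross multiplication before restriction; the denominators are nonzero on the plane and can be
cancelled there. -/
theorem RestrictsTo.unique {F : Frac3} {P P' : MvPowerSeries (Fin 2) ℚ} (h : RestrictsTo F P)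
    (h' : RestrictsTo F P') : P = P' := by
  obtain ⟨N, D, hD, hF, hP⟩ := h
  obtain ⟨N', D', hD', hF', hP'⟩ := h'
  simp only [← planeHom_apply] at *
  rw [hF, div_eq_div_iff (algebraMap_ser3_ne_zero (ne_zero_of_planeHom_ne_zero hD))
    (algebraMap_ser3_ne_zero (ne_zero_of_planeHom_ne_zero hD')), ← map_mul, ← map_mul] at hF'
  have h := congrArg planeHom (IsFractionRing.injective Ser3 Frac3 hF')
  rw [map_mul, map_mul, hP, hP'] at h
  refine mul_right_cancel₀ (mul_ne_zero hD hD') ?_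
  linear_combination h

/-- On the plane, a derivative along a tangent vector `∂_a - ∂_i` only depends on the restriction
to the plane. -/
theorem RestrictsTo.tangent {F : Frac3} {P : MvPowerSeries (Fin 2) ℚ} (h : RestrictsTo F P)
    (i : Fin 3) (j : Fin 2) (hij : ∀ G : Ser3, MvPowerSeries.pderiv ℚ j (planeHom G) =
      planeHom (MvPowerSeries.pderiv ℚ i G) - planeHom (MvPowerSeries.pderiv ℚ 0 G)) :
    RestrictsTo (F + fracPartial 0 F - fracPartial i F) (P - MvPowerSeries.pderiv ℚ j P) := by
  obtain ⟨N, D, hD, hF, hP⟩ := h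
  simp only [← planeHom_apply] at *
  have hD0 := ne_zero_of_planeHom_ne_zero hD
  have hD1 := algebraMap_ser3_ne_zero hD0
  have key := restrictsTo_div (D := D ^ 2) (P := P - MvPowerSeries.pderiv ℚ j P)
    (N := N * D + (MvPowerSeries.pderiv ℚ 0 N * D - N * MvPowerSeries.pderiv ℚ 0 D)
      - (MvPowerSeries.pderiv ℚ i N * D - N * MvPowerSeries.pderiv ℚ i D))
    (by rw [map_pow]; exact pow_ne_zero 2 hD) (by
      have h1 := congrArg (MvPowerSeries.pderiv ℚ j) hP
      rw [Derivation.leibniz, hij, hij] at h1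
      simp only [smul_eq_mul] at h1
      simp only [map_add, map_sub, map_mul, map_pow]
      linear_combination (planeHom D + planeHom (MvPowerSeries.pderiv ℚ i D)
        - planeHom (MvPowerSeries.pderiv ℚ 0 D)) * hP - planeHom D * h1)
  convert key using 1
  rw [hF, fracPartial_div 0 N D hD0, fracPartial_div i N D hD0]
  simp only [map_add, map_sub, map_mul, map_pow]
  field_simp

theorem RestrictsTo.opB {F : Frac3} {P : MvPowerSeries (Fin 2) ℚ} (h : RestrictsTo F P) :
    RestrictsTo (HexEq.opB F) (P - MvPowerSeries.pderiv ℚ 0 P) :=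
  h.tangent 1 0 pderiv_zero_planeHom

theorem RestrictsTo.opC {F : Frac3} {P : MvPowerSeries (Fin 2) ℚ} (h : RestrictsTo F P) :
    RestrictsTo (HexEq.opC F) (P - MvPowerSeries.pderiv ℚ 1 P) :=
  h.tangent 2 1 pderiv_one_planeHom

theorem hasHexComponents_of_restrictsTo {H : ChordHat 3} {F : Frac3}
    {P : MvPowerSeries (Fin 2) ℚ} (h : RestrictsTo F P)
    (hH : EqMod2FF H (Three.ofComponents P (P - MvPowerSeries.pderiv ℚ 0 P)
      (P - MvPowerSeries.pderiv ℚ 1 P))) : HasHexComponents H F :=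
  ⟨P, _, _, h, h.opB, h.opC, hH⟩

theorem restrictsTo_lhs : RestrictsTo HexEq.lhs hexSer := by
  -- Over the common denominator `abc`, the condition on the plane is `mul_hexSer` up to sign.
  have key := restrictsTo_div (P := hexSer) (D := HexEq.a * HexEq.b * HexEq.c)
    (N := HexEq.c * HexEq.exp (HexEq.b + HexEq.c) + HexEq.a * HexEq.exp HexEq.c + HexEq.b)
    (by
      simp only [map_mul, planeHom_a, planeHom_b, planeHom_c]
      refine mul_ne_zero (mul_ne_zero ?_ (X_fin_two_ne_zero 0)) (X_fin_two_ne_zero 1)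
      rw [← neg_add', neg_ne_zero]
      exact X_add_X_ne_zero)
    (by
      simp only [map_mul, map_add, planeHom_a, planeHom_b, planeHom_c]
      rw [planeHom_exp (by simp [HexEq.b, HexEq.c]), planeHom_exp (by simp [HexEq.c]), map_add,
        planeHom_b, planeHom_c]
      linear_combination mul_hexSer)
  convert key using 1
  have ha : algebraMap Ser3 Frac3 HexEq.a ≠ 0 := algebraMap_ser3_ne_zero
    (ne_zero_of_planeHom_ne_zero (by
      rw [planeHom_a, ← neg_add', neg_ne_zero]; exact X_add_X_ne_zero))
  have hb : algebraMap Ser3 Frac3 HexEq.b ≠ 0 := algebraMap_ser3_ne_zero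
    (ne_zero_of_planeHom_ne_zero (by rw [planeHom_b]; exact X_fin_two_ne_zero 0))
  have hc : algebraMap Ser3 Frac3 HexEq.c ≠ 0 := algebraMap_ser3_ne_zero
    (ne_zero_of_planeHom_ne_zero (by rw [planeHom_c]; exact X_fin_two_ne_zero 1))
  rw [HexEq.lhs]
  simp only [map_add, map_mul]
  field_simp

/-- The series `l(a,b)e^{s(b+c)} + l(c,b)e^{sc} + l(c,a)` on the plane `a = -b-c`. -/
noncomputable def hexSerRight (s : ℚ) (l : MvPowerSeries (Fin 2) ℚ) : MvPowerSeries (Fin 2) ℚ :=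
  MvPowerSeries.subst ![-MvPowerSeries.X 0 - MvPowerSeries.X 1, MvPowerSeries.X 0] l
      * serExp (s • (MvPowerSeries.X 0 + MvPowerSeries.X 1))
    + MvPowerSeries.subst ![MvPowerSeries.X 1, MvPowerSeries.X 0] l
      * serExp (s • MvPowerSeries.X 1)
    + MvPowerSeries.subst ![MvPowerSeries.X 1, -MvPowerSeries.X 0 - MvPowerSeries.X 1] l

theorem restrictsTo_rhs (l : MvPowerSeries (Fin 2) ℚ) :
    RestrictsTo (HexEq.rhs l) (hexSerRight 1 l) := by
  have h := restrictsTo_algebraMap (HexEq.at2 l HexEq.a HexEq.b * HexEq.exp (HexEq.b + HexEq.c)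
    + HexEq.at2 l HexEq.c HexEq.b * HexEq.exp HexEq.c + HexEq.at2 l HexEq.c HexEq.a)
  convert h using 1
  · rfl
  have ha : MvPowerSeries.constantCoeff HexEq.a = 0 := by simp [HexEq.a]
  have hb : MvPowerSeries.constantCoeff HexEq.b = 0 := by simp [HexEq.b]
  have hc : MvPowerSeries.constantCoeff HexEq.c = 0 := by simp [HexEq.c]
  rw [map_add, map_add, map_mul, map_mul, planeHom_at2 l ha hb, planeHom_at2 l hc hb,
    planeHom_at2 l hc ha, planeHom_exp (by rw [map_add, hb, hc, add_zero]), planeHom_exp hc,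
    map_add, planeHom_a, planeHom_b, planeHom_c, hexSerRight, one_smul, one_smul]

theorem hexSerRight_one_of_holds {l : MvPowerSeries (Fin 2) ℚ} (h : HexEq.Holds l) :
    hexSerRight 1 l = hexSer := by
  obtain ⟨P, h1, h2⟩ := h
  rw [(restrictsTo_rhs l).unique h2, restrictsTo_lhs.unique h1]

theorem subst_fin_two_comm {l : MvPowerSeries (Fin 2) ℚ}
    (hsymm : MvPowerSeries.subst
      (![MvPowerSeries.X 1, MvPowerSeries.X 0] : Fin 2 → MvPowerSeries (Fin 2) ℚ) l = l)
    {F G : MvPowerSeries (Fin 2) ℚ} (hF : MvPowerSeries.constantCoeff F = 0)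
    (hG : MvPowerSeries.constantCoeff G = 0) :
    MvPowerSeries.subst ![F, G] l = MvPowerSeries.subst ![G, F] l := by
  have hFG := MvPowerSeries.hasSubst_of_constantCoeff_zero (constantCoeff_fin_two hF hG)
  conv_lhs => rw [← hsymm]
  rw [MvPowerSeries.subst_comp_subst_apply (MvPowerSeries.hasSubst_of_constantCoeff_zero
    (constantCoeff_fin_two (by simp) (by simp))) hFG]
  congr 1
  funext s
  fin_cases s <;> simp [MvPowerSeries.subst_X hFG]

/-- The exchange of `a` and `c` on the plane takes the right side of the positive hexagon to that
of the negative one. -/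
theorem subst_hexSerRight_one {l : MvPowerSeries (Fin 2) ℚ}
    (hsymm : MvPowerSeries.subst
      (![MvPowerSeries.X 1, MvPowerSeries.X 0] : Fin 2 → MvPowerSeries (Fin 2) ℚ) l = l)
    (hb : ∀ s, MvPowerSeries.constantCoeff ((![MvPowerSeries.X 0,
      -MvPowerSeries.X 0 - MvPowerSeries.X 1] : Fin 2 → MvPowerSeries (Fin 2) ℚ) s) = 0) :
    MvPowerSeries.substAlgHom (R := ℚ) (MvPowerSeries.hasSubst_of_constantCoeff_zero hb)
      (hexSerRight 1 l) = hexSerRight (-1) l := by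
  set ht := MvPowerSeries.hasSubst_of_constantCoeff_zero hb
  have hx : MvPowerSeries.substAlgHom (R := ℚ) ht (MvPowerSeries.X 0) = MvPowerSeries.X 0 := by
    rw [MvPowerSeries.substAlgHom_X]; rfl
  have hy : MvPowerSeries.substAlgHom (R := ℚ) ht (MvPowerSeries.X 1) =
      -MvPowerSeries.X 0 - MvPowerSeries.X 1 := by
    rw [MvPowerSeries.substAlgHom_X]; rfl
  have hsub : ∀ F G : MvPowerSeries (Fin 2) ℚ, MvPowerSeries.constantCoeff F = 0 →
      MvPowerSeries.constantCoeff G = 0 →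
      MvPowerSeries.substAlgHom (R := ℚ) ht (MvPowerSeries.subst ![F, G] l) =
        MvPowerSeries.subst ![MvPowerSeries.substAlgHom ht F,
          MvPowerSeries.substAlgHom ht G] l := by
    intro F G hF hG
    rw [MvPowerSeries.coe_substAlgHom, MvPowerSeries.subst_comp_subst_apply
      (MvPowerSeries.hasSubst_of_constantCoeff_zero (constantCoeff_fin_two hF hG)) ht]
    congr 1
    funext s
    fin_cases s <;> rfl
  have hexp : ∀ F : MvPowerSeries (Fin 2) ℚ, MvPowerSeries.constantCoeff F = 0 →
      MvPowerSeries.substAlgHom (R := ℚ) ht (serExp F) =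
        serExp (MvPowerSeries.substAlgHom (R := ℚ) ht F) := by
    intro F hF
    rw [MvPowerSeries.coe_substAlgHom, subst_serExp hb hF]
  rw [hexSerRight, one_smul, one_smul, map_add, map_add, map_mul, map_mul,
    hsub _ _ (by simp) (by simp), hsub _ _ (by simp) (by simp), hsub _ _ (by simp) (by simp),
    hexp _ (by simp), hexp _ (by simp), map_sub, map_neg, map_add, hx, hy, hexSerRight,
    subst_fin_two_comm hsymm (F := MvPowerSeries.X 1)
      (G := -MvPowerSeries.X 0 - MvPowerSeries.X 1) (by simp) (by simp)]
  simp only [neg_smul, one_smul]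
  rw [show (-MvPowerSeries.X 0 - (-MvPowerSeries.X 0 - MvPowerSeries.X 1) :
      MvPowerSeries (Fin 2) ℚ) = MvPowerSeries.X 1 by ring,
    show (MvPowerSeries.X 0 + (-MvPowerSeries.X 0 - MvPowerSeries.X 1) :
      MvPowerSeries (Fin 2) ℚ) = -MvPowerSeries.X 1 by ring, neg_add']
  ring

/-- The 1FF equation is carried by the exchange of `a` and `c`, that is by `(b, c) ↦ (b, -b-c)`. On
`hexSer` this exchange agrees with `(b, c) ↦ (-b, -c)`: both images satisfy the same linear
equation, derived from `mul_hexSer`, and `xy(x+y)` cancels. -/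
theorem hexSerRight_neg_one_of_holds {l : MvPowerSeries (Fin 2) ℚ}
    (hsymm : MvPowerSeries.subst
      (![MvPowerSeries.X 1, MvPowerSeries.X 0] : Fin 2 → MvPowerSeries (Fin 2) ℚ) l = l)
    (h : HexEq.Holds l) :
    hexSerRight (-1) l = MvPowerSeries.subst
      (![-MvPowerSeries.X 0, -MvPowerSeries.X 1] : Fin 2 → MvPowerSeries (Fin 2) ℚ) hexSer := by
  have ha : ∀ s, MvPowerSeries.constantCoeff
      ((![-MvPowerSeries.X 0, -MvPowerSeries.X 1] : Fin 2 → MvPowerSeries (Fin 2) ℚ) s) = 0 :=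
    constantCoeff_fin_two (by simp) (by simp)
  have hb : ∀ s, MvPowerSeries.constantCoeff ((![MvPowerSeries.X 0,
      -MvPowerSeries.X 0 - MvPowerSeries.X 1] : Fin 2 → MvPowerSeries (Fin 2) ℚ) s) = 0 :=
    constantCoeff_fin_two (by simp) (by simp)
  have h1 := mul_hexSer
  rw [← hexSerRight_one_of_holds h] at h1
  have h2 := congrArg (MvPowerSeries.substAlgHom
    (MvPowerSeries.hasSubst_of_constantCoeff_zero hb) (R := ℚ)) h1
  have h3 := congrArg (MvPowerSeries.substAlgHom
    (MvPowerSeries.hasSubst_of_constantCoeff_zero ha) (R := ℚ)) mul_hexSer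
  simp only [map_sub, map_mul, subst_hexSerRight_one hsymm hb] at h2
  simp only [map_sub, map_mul] at h3
  rw [MvPowerSeries.coe_substAlgHom, subst_serExp hb (by simp), subst_serExp hb (by simp),
    ← MvPowerSeries.coe_substAlgHom (MvPowerSeries.hasSubst_of_constantCoeff_zero hb)] at h2
  rw [MvPowerSeries.coe_substAlgHom, subst_serExp ha (by simp), subst_serExp ha (by simp),
    ← MvPowerSeries.coe_substAlgHom (MvPowerSeries.hasSubst_of_constantCoeff_zero ha)] at h3
  simp only [map_add, MvPowerSeries.substAlgHom_X, Matrix.cons_val_zero, Matrix.cons_val_one]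
    at h2 h3
  rw [MvPowerSeries.coe_substAlgHom] at h3
  rw [show (MvPowerSeries.X 0 + (-MvPowerSeries.X 0 - MvPowerSeries.X 1) :
      MvPowerSeries (Fin 2) ℚ) = -MvPowerSeries.X 1 by ring] at h2
  rw [← sub_eq_add_neg] at h3
  refine mul_left_cancel₀ (mul_ne_zero (mul_ne_zero (X_fin_two_ne_zero 0) (X_fin_two_ne_zero 1))
    X_add_X_ne_zero) ?_
  linear_combination h2 + h3

end Plane

/-! ## Commuting operators -/

universe u

/-- The subalgebra generated by commuting operators is commutative and acts faithfully. Power series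
can thus be applied to operators, while equations between operators are checked on vectors. -/
theorem exists_commRing_of_commute {V : Type u} [AddCommGroup V] [Module ℚ V]
    (s : Set (Module.End ℚ V)) (hs : ∀ f ∈ s, ∀ g ∈ s, f * g = g * f) :
    ∃ (E : Type u) (_ : CommRing E) (_ : Algebra ℚ E) (_ : Module E V) (_ : IsScalarTower ℚ E V)
      (_ : FaithfulSMul E V), ∀ f ∈ s, ∃ e : E, ∀ v : V, e • v = f v := by
  let : CommRing (Algebra.adjoin ℚ s) :=
    { (inferInstance : Ring (Algebra.adjoin ℚ s)) with
      mul_comm := (Algebra.isMulCommutative_adjoin ℚ hs).is_comm.comm }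
  refine ⟨Algebra.adjoin ℚ s, inferInstance, inferInstance, inferInstance, inferInstance,
    inferInstance, fun f hf => ⟨⟨f, Algebra.subset_adjoin hf⟩, fun v => rfl⟩⟩

/-! ### Rings with two frozen feet and their ideal of square zero. -/

section TwoFrozenFeet

variable {A : Type*} [Ring A] [Algebra ℚ A]

/-- In the ring `A`, filtered by the powers of `I`, all factors after those of total degree two
commute, and the elements of degree at least `N` vanish. -/
structure FrozenFeet (I : Ideal A) (N : ℕ) : Prop where
  mul_comm : ∀ u ∈ I ^ 2, ∀ x y : A, u * (x * y) = u * (y * x)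
  pow_eq_zero : ∀ u ∈ I ^ N, u = 0

/-- The ideal of elements of degree at least two that are killed from the left by all elements of
degree at least two. -/
def comIdeal (I : Ideal A) [I.IsTwoSided] : Submodule ℚ A where
  carrier := {c | c ∈ I ^ 2 ∧ ∀ u ∈ I ^ 2, u * c = 0}
  add_mem' hc hd := ⟨add_mem hc.1 hd.1, fun u hu => by rw [mul_add, hc.2 u hu, hd.2 u hu, add_zero]⟩
  zero_mem' := ⟨zero_mem _, fun u _ => mul_zero u⟩
  smul_mem' q c hc := ⟨Submodule.smul_of_tower_mem _ q hc.1, fun u hu => by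
    rw [mul_smul_comm, hc.2 u hu, smul_zero]⟩

/-- The elements of degree at least two. -/
def sqIdeal (I : Ideal A) : Submodule ℚ A := (I ^ 2).restrictScalars ℚ

variable {I : Ideal A} [I.IsTwoSided] {N : ℕ}

theorem mul_mem_sq {x y : A} (hx : x ∈ I) (hy : y ∈ I) : x * y ∈ I ^ 2 := by
  rw [Submodule.pow_succ, Submodule.pow_one]
  exact Ideal.mul_mem_mul hx hy

theorem comIdeal_mul_right {c : A} (hc : c ∈ comIdeal I) (x : A) : c * x ∈ comIdeal I :=
  ⟨Ideal.mul_mem_right _ _ hc.1, fun u hu => by rw [← mul_assoc, hc.2 u hu, zero_mul]⟩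

theorem comIdeal_mul_left {c : A} (hc : c ∈ comIdeal I) (x : A) : x * c ∈ comIdeal I :=
  ⟨Ideal.mul_mem_left _ _ hc.1, fun u hu => by
    rw [← mul_assoc, hc.2 _ (Ideal.mul_mem_right _ _ hu)]⟩

theorem comIdeal_mul_self {c d : A} (hc : c ∈ comIdeal I) (hd : d ∈ comIdeal I) : c * d = 0 :=
  hd.2 c hc.1

theorem commutator_mem (h : FrozenFeet I N) {x y : A} (hx : x ∈ I) (hy : y ∈ I) :
    x * y - y * x ∈ comIdeal I :=
  ⟨sub_mem (mul_mem_sq hx hy) (mul_mem_sq hy hx), fun u hu => by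
    rw [mul_sub, h.mul_comm u hu, sub_self]⟩

/-- The commutator of two elements of positive degree. -/
def com (h : FrozenFeet I N) (x y : I) : comIdeal I :=
  ⟨(x : A) * y - y * x, commutator_mem h x.2 y.2⟩

theorem pow_mul_pow_eq_zero (h : FrozenFeet I N) (x y : I) {i j : ℕ} (hij : N ≤ i + j) :
    (x : A) ^ i * (y : A) ^ j = 0 := by
  apply h.pow_eq_zero
  refine Ideal.pow_le_pow_right hij ?_
  rw [Ideal.IsTwoSided.pow_add]
  exact Ideal.mul_mem_mul (Ideal.pow_mem_pow x.2 _) (Ideal.pow_mem_pow y.2 _)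

theorem pow_eq_zero_of_frozenFeet (h : FrozenFeet I N) (x : I) : (x : A) ^ N = 0 := by
  simpa using pow_mul_pow_eq_zero h x x (i := N) (j := 0) le_rfl

/-- The truncation of `∑ f i j * x ^ i * y ^ j` below the degree `N`. -/
noncomputable def truncEval (N : ℕ) (f : MvPowerSeries (Fin 2) ℚ) (x y : A) : A :=
  ∑ d ∈ range N, ∑ p ∈ antidiagonal d,
    MvPowerSeries.coeff (Finsupp.single 0 p.1 + Finsupp.single 1 p.2) f • (x ^ p.1 * y ^ p.2)

section RightOps

variable {V : Submodule ℚ A} {E : Type*} [CommRing E] [Algebra ℚ E] [Module E V]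
  [IsScalarTower ℚ E V]

theorem coe_pow_smul {x : A} {e : E} (he : ∀ v : V, ((e • v : V) : A) = v * x) (v : V) (i : ℕ) :
    ((e ^ i • v : V) : A) = v * x ^ i := by
  induction i with
  | zero => simp
  | succ k ih => rw [pow_succ', mul_smul, he, ih, pow_succ, mul_assoc]

theorem coe_pow_mul_pow_smul {x y : A} {e f : E} (he : ∀ v : V, ((e • v : V) : A) = v * x)
    (hf : ∀ v : V, ((f • v : V) : A) = v * y) (v : V) (i j : ℕ) :
    (((e ^ i * f ^ j) • v : V) : A) = v * (x ^ i * y ^ j) := by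
  rw [mul_comm, mul_smul, coe_pow_smul hf, coe_pow_smul he, mul_assoc]

theorem coe_sum_smul {ι : Type*} (s : Finset ι) (g : ι → E) (v : V) :
    (((∑ i ∈ s, g i) • v : V) : A) = ∑ i ∈ s, ((g i • v : V) : A) := by
  rw [Finset.sum_smul]
  exact map_sum V.subtype _ _

variable [FaithfulSMul E V]

theorem op_pow_mul_pow_eq_zero (h : FrozenFeet I N) {x y : I} {e f : E}
    (he : ∀ v : V, ((e • v : V) : A) = v * x) (hf : ∀ v : V, ((f • v : V) : A) = v * y)
    {i j : ℕ} (hij : N ≤ i + j) : e ^ i * f ^ j = 0 := by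
  refine FaithfulSMul.eq_of_smul_eq_smul (α := V) fun v => Subtype.ext ?_
  rw [coe_pow_mul_pow_smul he hf, pow_mul_pow_eq_zero h x y hij, mul_zero, zero_smul]
  rfl

theorem op_pow_eq_zero (h : FrozenFeet I N) {x : I} {e : E}
    (he : ∀ v : V, ((e • v : V) : A) = v * x) : e ^ N = 0 := by
  simpa using op_pow_mul_pow_eq_zero h he he (i := N) (j := 0) le_rfl

theorem isNilpotent_op (h : FrozenFeet I N) {x : I} {e : E}
    (he : ∀ v : V, ((e • v : V) : A) = v * x) : IsNilpotent e :=
  ⟨N, op_pow_eq_zero h he⟩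

theorem coe_mul_truncEval (h : FrozenFeet I N) {x y : I} {e f : E}
    (he : ∀ v : V, ((e • v : V) : A) = v * x) (hf : ∀ v : V, ((f • v : V) : A) = v * y)
    (g : MvPowerSeries (Fin 2) ℚ) (v : V) :
    (v : A) * truncEval N g (x : A) y = ((nilEval ![e, f] g • v : V) : A) := by
  rw [nilEval_eq_sum_antidiagonal (isNilpotent_op h he) (isNilpotent_op h hf) g
    (n := N) (fun i j hij => op_pow_mul_pow_eq_zero h he hf hij), coe_sum_smul, truncEval,
    Finset.mul_sum]
  refine Finset.sum_congr rfl fun d _ => ?_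
  rw [coe_sum_smul, Finset.mul_sum]
  refine Finset.sum_congr rfl fun p _ => ?_
  rw [smul_assoc, Submodule.coe_smul, coe_pow_mul_pow_smul he hf, mul_smul_comm]

theorem coe_mul_exp (h : FrozenFeet I N) {x : I} {e : E}
    (he : ∀ v : V, ((e • v : V) : A) = v * x) (v : V) :
    (v : A) * IsNilpotent.exp (x : A) = ((IsNilpotent.exp e • v : V) : A) := by
  rw [IsNilpotent.exp_eq_sum (pow_eq_zero_of_frozenFeet h x),
    IsNilpotent.exp_eq_sum (op_pow_eq_zero h he), coe_sum_smul, Finset.mul_sum]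
  refine Finset.sum_congr rfl fun d _ => ?_
  rw [smul_assoc, Submodule.coe_smul, coe_pow_smul he, mul_smul_comm]

end RightOps

/-- From the quadratic term on, the exponential series has degree at least two and kills `c`. -/
theorem exp_mul_of_mem_comIdeal (h : FrozenFeet I N) (x : I) {c : A} (hc : c ∈ comIdeal I) :
    IsNilpotent.exp (x : A) * c = c + x * c := by
  -- The exponent `N + 2` lets the terms of degree zero and one be split off for every `N`.
  have hx : (x : A) ^ (N + 2) = 0 := by
    rw [pow_add, pow_eq_zero_of_frozenFeet h x, zero_mul]
  rw [IsNilpotent.exp_eq_sum hx, Finset.sum_range_succ', Finset.sum_range_succ', add_mul, add_mul,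
    Finset.sum_mul, Finset.sum_eq_zero]
  · simp [add_comm]
  · intro i _
    rw [smul_mul_assoc, hc.2, smul_zero]
    rw [pow_succ, pow_succ, mul_assoc]
    exact Ideal.mul_mem_left _ _ (mul_mem_sq x.2 x.2)

end TwoFrozenFeet

/-! ### Left and right multiplications as commuting operators. -/

section Hexagon

variable {A : Type u} [Ring A] [Algebra ℚ A] {I : Ideal A} [I.IsTwoSided] {N : ℕ}

/-- The operators `r x` and `l x` on `comIdeal I` are the multiplications by `x` from the right
and from the left. -/
structure IsMulOps {E : Type u} [CommRing E] [Module E (comIdeal I)] (r l : I → E) : Prop where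
  r_smul : ∀ (x : I) (c : comIdeal I), ((r x • c : comIdeal I) : A) = c * x
  l_smul : ∀ (x : I) (c : comIdeal I), ((l x • c : comIdeal I) : A) = x * c

theorem exists_isMulOps (h : FrozenFeet I N) :
    ∃ (E : Type u) (_ : CommRing E) (_ : Algebra ℚ E) (_ : Module E (comIdeal I))
      (_ : IsScalarTower ℚ E (comIdeal I)) (_ : FaithfulSMul E (comIdeal I)) (r l : I → E),
      IsMulOps r l := by
  let R : I → Module.End ℚ (comIdeal I) := fun x =>
    { toFun := fun c => ⟨c * x, comIdeal_mul_right c.2 x⟩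
      map_add' := fun c d => Subtype.ext (add_mul _ _ _)
      map_smul' := fun q c => Subtype.ext (smul_mul_assoc _ _ _) }
  let L : I → Module.End ℚ (comIdeal I) := fun x =>
    { toFun := fun c => ⟨x * c, comIdeal_mul_left c.2 x⟩
      map_add' := fun c d => Subtype.ext (mul_add _ _ _)
      map_smul' := fun q c => Subtype.ext (mul_smul_comm _ _ _) }
  have hRR : ∀ x y, R x * R y = R y * R x := fun x y => by
    ext c
    change (c : A) * y * x = c * x * y
    rw [mul_assoc, mul_assoc, h.mul_comm _ c.2.1]
  have hLR : ∀ x y, L x * R y = R y * L x := fun x y => by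
    ext c
    exact (mul_assoc _ _ _).symm
  have hLL : ∀ x y, L x * L y = 0 := fun x y => by
    ext c
    change (x : A) * (y * c) = 0
    rw [← mul_assoc, c.2.2 _ (mul_mem_sq x.2 y.2)]
  obtain ⟨E, i1, i2, i3, i4, i5, hE⟩ := exists_commRing_of_commute
    (Set.range R ∪ Set.range L) (by
      rintro _ (⟨x, rfl⟩ | ⟨x, rfl⟩) _ (⟨y, rfl⟩ | ⟨y, rfl⟩)
      · exact hRR x y
      · exact (hLR y x).symm
      · exact hLR x y
      · rw [hLL, hLL])
  choose r hr using fun x => hE (R x) (Or.inl ⟨x, rfl⟩)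
  choose l hl using fun x => hE (L x) (Or.inr ⟨x, rfl⟩)
  exact ⟨E, i1, i2, i3, i4, i5, r, l, fun x c => congrArg Subtype.val (hr x c),
    fun x c => congrArg Subtype.val (hl x c)⟩

/-- The left side of the hexagon is expanded in products `x * y`, which lie in `I ^ 2` but need not
lie in `comIdeal I`. Right multiplications still commute on all of `I ^ 2`. -/
theorem exists_rightOps (h : FrozenFeet I N) :
    ∃ (E : Type u) (_ : CommRing E) (_ : Algebra ℚ E) (_ : Module E (sqIdeal I))
      (_ : IsScalarTower ℚ E (sqIdeal I)) (_ : FaithfulSMul E (sqIdeal I)) (r : I → E),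
      ∀ (x : I) (c : sqIdeal I), ((r x • c : sqIdeal I) : A) = c * x := by
  let R : I → Module.End ℚ (sqIdeal I) := fun x =>
    { toFun := fun c => ⟨c * x, Ideal.mul_mem_right (x : A) (I ^ 2) c.2⟩
      map_add' := fun c d => Subtype.ext (add_mul _ _ _)
      map_smul' := fun q c => Subtype.ext (smul_mul_assoc _ _ _) }
  have hRR : ∀ x y, R x * R y = R y * R x := fun x y => by
    ext c
    change (c : A) * y * x = c * x * y
    rw [mul_assoc, mul_assoc, h.mul_comm _ c.2]
  obtain ⟨E, i1, i2, i3, i4, i5, hE⟩ := exists_commRing_of_commute (Set.range R) (by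
      rintro _ ⟨x, rfl⟩ _ ⟨y, rfl⟩
      exact hRR x y)
  choose r hr using fun x => hE (R x) ⟨x, rfl⟩
  exact ⟨E, i1, i2, i3, i4, i5, r, fun x c => congrArg Subtype.val (hr x c)⟩

variable {E : Type u} [CommRing E] [Algebra ℚ E] [Module E (comIdeal I)]
  [IsScalarTower ℚ E (comIdeal I)] [FaithfulSMul E (comIdeal I)] {r l : I → E}

theorem IsMulOps.r_add (H : IsMulOps r l) (x y : I) : r (x + y) = r x + r y := by
  refine FaithfulSMul.eq_of_smul_eq_smul (α := comIdeal I) fun v => Subtype.ext ?_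
  simp [add_smul, H.r_smul, mul_add]

theorem IsMulOps.l_add (H : IsMulOps r l) (x y : I) : l (x + y) = l x + l y := by
  refine FaithfulSMul.eq_of_smul_eq_smul (α := comIdeal I) fun v => Subtype.ext ?_
  simp [add_smul, H.l_smul, add_mul]

theorem IsMulOps.r_rat_smul (H : IsMulOps r l) (q : ℚ) (x : I) : r (q • x) = q • r x := by
  refine FaithfulSMul.eq_of_smul_eq_smul (α := comIdeal I) fun v => Subtype.ext ?_
  rw [smul_assoc, Submodule.coe_smul, H.r_smul, H.r_smul]
  exact mul_smul_comm _ _ _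

theorem IsMulOps.l_rat_smul (H : IsMulOps r l) (q : ℚ) (x : I) : l (q • x) = q • l x := by
  refine FaithfulSMul.eq_of_smul_eq_smul (α := comIdeal I) fun v => Subtype.ext ?_
  rw [smul_assoc, Submodule.coe_smul, H.l_smul, H.l_smul]
  exact smul_mul_assoc _ _ _

theorem IsMulOps.l_mul_l (H : IsMulOps r l) (x y : I) : l x * l y = 0 := by
  refine FaithfulSMul.eq_of_smul_eq_smul (α := comIdeal I) fun v => Subtype.ext ?_
  rw [mul_smul, H.l_smul, H.l_smul, ← mul_assoc, v.2.2 _ (mul_mem_sq x.2 y.2), zero_smul]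
  rfl

theorem IsMulOps.isNilpotent_l (H : IsMulOps r l) (x : I) : IsNilpotent (l x) :=
  ⟨2, by rw [pow_two, H.l_mul_l]⟩

theorem IsMulOps.isNilpotent_r (H : IsMulOps r l) (h : FrozenFeet I N) (x : I) :
    IsNilpotent (r x) :=
  isNilpotent_op h (H.r_smul x)

theorem IsMulOps.isNilpotent_sub (H : IsMulOps r l) (h : FrozenFeet I N) (x : I) :
    IsNilpotent (r x - l x) :=
  (Commute.all _ _).isNilpotent_sub (H.isNilpotent_r h x) (H.isNilpotent_l x)

theorem IsMulOps.exp_r (H : IsMulOps r l) (h : FrozenFeet I N) (x : I) :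
    IsNilpotent.exp (r x) = IsNilpotent.exp (r x - l x) * (1 + l x) := by
  have h1 : IsNilpotent.exp (l x) = 1 + l x := by
    rw [IsNilpotent.exp_eq_sum (k := 2) (by rw [pow_two, H.l_mul_l])]
    simp [Finset.sum_range_succ]
  rw [← h1, ← IsNilpotent.exp_add_of_commute (Commute.all _ _) (H.isNilpotent_sub h x)
    (H.isNilpotent_l x), sub_add_cancel]

/-- Taylor's formula is exact to first order because all products of two left multiplications
vanish. -/
theorem IsMulOps.nilEval_sub (H : IsMulOps r l) (h : FrozenFeet I N) (x y : I)
    (f : MvPowerSeries (Fin 2) ℚ) :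
    nilEval ![r x - l x, r y - l y] f = nilEval ![r x, r y] f
      - l x * nilEval ![r x, r y] (MvPowerSeries.pderiv ℚ 0 f)
      - l y * nilEval ![r x, r y] (MvPowerSeries.pderiv ℚ 1 f) := by
  rw [sub_eq_add_neg, sub_eq_add_neg, nilEval_add_of_sq_eq_zero (H.isNilpotent_r h x)
    (H.isNilpotent_r h y) (by rw [neg_mul_neg, H.l_mul_l]) (by rw [neg_mul_neg, H.l_mul_l])
    (by rw [neg_mul_neg, H.l_mul_l])]
  ring

/-- The truncation of `1 + [x,y]f(x,y) - x[x,y]∂₁f(x,y) - y[x,y]∂₂f(x,y)`. -/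
noncomputable def truncPhi (N : ℕ) (f : MvPowerSeries (Fin 2) ℚ) (x y : A) : A :=
  1 + (x * y - y * x) * truncEval N f x y
    - x * (x * y - y * x) * truncEval N (MvPowerSeries.pderiv ℚ 0 f) x y
    - y * (x * y - y * x) * truncEval N (MvPowerSeries.pderiv ℚ 1 f) x y

/-- The reason for the shape of `Φ`: its derivative terms are the first-order Taylor terms which
turn the right multiplications into the commutator operators `r x - l x`. -/
theorem IsMulOps.truncPhi_eq (H : IsMulOps r l) (h : FrozenFeet I N) (x y : I)
    (f : MvPowerSeries (Fin 2) ℚ) :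
    truncPhi N f (x : A) y =
      1 + ((nilEval ![r x - l x, r y - l y] f • com h x y : comIdeal I) : A) := by
  have h1 := coe_mul_truncEval h (H.r_smul x) (H.r_smul y) f (com h x y)
  have h2 := coe_mul_truncEval h (H.r_smul x) (H.r_smul y) (MvPowerSeries.pderiv ℚ 0 f)
    (l x • com h x y)
  have h3 := coe_mul_truncEval h (H.r_smul x) (H.r_smul y) (MvPowerSeries.pderiv ℚ 1 f)
    (l y • com h x y)
  rw [H.l_smul] at h2 h3
  rw [truncPhi, H.nilEval_sub h]
  simp only [com] at h1 h2 h3 ⊢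
  rw [h1, h2, h3, sub_smul, sub_smul]
  simp only [AddSubgroupClass.coe_sub, smul_smul, mul_comm]
  abel

/-- Expanding `(1 + l x + l y)` times the Taylor formula, the quadratic terms in `l` drop out and
the coefficients of `l x`, `l y` become `f - ∂₀f`, `f - ∂₁f`. -/
theorem IsMulOps.components_eq (H : IsMulOps r l) (h : FrozenFeet I N) (x y : I)
    (f : MvPowerSeries (Fin 2) ℚ) (z : comIdeal I) :
    (z : A) * truncEval N f (x : A) y
      + x * z * truncEval N (f - MvPowerSeries.pderiv ℚ 0 f) (x : A) y
      + y * z * truncEval N (f - MvPowerSeries.pderiv ℚ 1 f) (x : A) y =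
    (((1 + l x + l y) * nilEval ![r x - l x, r y - l y] f) • z : comIdeal I) := by
  have h1 := coe_mul_truncEval h (H.r_smul x) (H.r_smul y) f z
  have h2 := coe_mul_truncEval h (H.r_smul x) (H.r_smul y) (f - MvPowerSeries.pderiv ℚ 0 f)
    (l x • z)
  have h3 := coe_mul_truncEval h (H.r_smul x) (H.r_smul y) (f - MvPowerSeries.pderiv ℚ 1 f)
    (l y • z)
  rw [H.l_smul] at h2 h3
  have hnil := forall_fin_two_isNilpotent (H.isNilpotent_r h x) (H.isNilpotent_r h y)
  rw [h1, h2, h3, H.nilEval_sub h, ← Submodule.coe_add, ← Submodule.coe_add, smul_smul, smul_smul,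
    ← add_smul, ← add_smul]
  congr 2
  simp only [← nilEvalHom_apply _ hnil, map_sub]
  linear_combination (nilEvalHom _ hnil (MvPowerSeries.pderiv ℚ 0 f)) * H.l_mul_l x x
    + (nilEvalHom _ hnil (MvPowerSeries.pderiv ℚ 1 f)) * H.l_mul_l x y
    + (nilEvalHom _ hnil (MvPowerSeries.pderiv ℚ 0 f)) * H.l_mul_l y x
    + (nilEvalHom _ hnil (MvPowerSeries.pderiv ℚ 1 f)) * H.l_mul_l y y

theorem IsMulOps.exp_product (H : IsMulOps r l) (h : FrozenFeet I N) (x y : I)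
    (p q s : comIdeal I) :
    (1 + (p : A)) * IsNilpotent.exp (x : A) * (1 - q) * IsNilpotent.exp (y : A) * (1 + s)
      - IsNilpotent.exp (x : A) * IsNilpotent.exp (y : A) =
    (((1 + l x + l y) • (IsNilpotent.exp (r x - l x + (r y - l y)) • p
      - IsNilpotent.exp (r y - l y) • q + s) : comIdeal I) : A) := by
  set ex := IsNilpotent.exp (x : A) with hex
  set ey := IsNilpotent.exp (y : A) with hey
  have hp : (p : A) * ex ∈ comIdeal I := comIdeal_mul_right p.2 _
  have hq : ex * q ∈ comIdeal I := comIdeal_mul_left q.2 _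
  -- Only the terms linear in `p`, `q`, `s` survive, since `comIdeal I` has square zero.
  have e1 : (p : A) * ex * q = 0 := comIdeal_mul_self hp q.2
  have e2 : (p * ex - ex * q) * ey * s = 0 :=
    comIdeal_mul_self (comIdeal_mul_right (sub_mem hp hq) _) s.2
  have e3 : (1 + (p : A)) * ex * (1 - q) * ey * (1 + s) - ex * ey =
      p * ex * ey - ex * q * ey + ex * (ey * s) := by
    have : (1 + (p : A)) * ex * (1 - q) * ey * (1 + s) - ex * ey =
        p * ex * ey - ex * q * ey + ex * (ey * s) + (p * ex - ex * q) * ey * s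
          - p * ex * q * (ey + ey * s) := by noncomm_ring
    rw [this, e1, e2, zero_mul, add_zero, sub_zero]
  have e4 : (p : A) * ex * ey = ((IsNilpotent.exp (r y) • IsNilpotent.exp (r x) • p :
      comIdeal I) : A) := by
    rw [coe_mul_exp h (H.r_smul x), coe_mul_exp h (H.r_smul y)]
  have e5 : ex * q * ey = ((IsNilpotent.exp (r y) • (1 + l x) • q : comIdeal I) : A) := by
    rw [← coe_mul_exp h (H.r_smul y), add_smul, one_smul, Submodule.coe_add, H.l_smul,
      exp_mul_of_mem_comIdeal h x q.2]
  have e6 : ex * (ey * s) = (((1 + l x) • (1 + l y) • s : comIdeal I) : A) := by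
    rw [exp_mul_of_mem_comIdeal h y s.2, ← H.l_smul, ← Submodule.coe_add,
      exp_mul_of_mem_comIdeal h x (Subtype.property _), ← H.l_smul, ← Submodule.coe_add]
    simp only [add_smul, one_smul]
  rw [e3, e4, e5, e6, ← Submodule.coe_sub, ← Submodule.coe_add, H.exp_r h, H.exp_r h,
    IsNilpotent.exp_add_of_commute (Commute.all _ _) (H.isNilpotent_sub h x)
      (H.isNilpotent_sub h y)]
  congr 1
  -- Each of the three terms carries this common factor: from `exp (r x) * exp (r y)` for `p`, from
  -- `(1 + l x) * exp (r y)` for `q`, and directly for `s`.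
  have hxy : (1 + l x) * (1 + l y) = 1 + l x + l y := by
    linear_combination H.l_mul_l x y
  rw [← hxy]
  module

end Hexagon

/-! ### The two sides of the hexagon. -/

section HexagonSides

theorem nilEval_rat_smul {σ : Type*} [Finite σ] {E : Type*} [CommRing E] [Algebra ℚ E] {v : σ → E}
    (hv : ∀ s, IsNilpotent (v s)) (q : ℚ) (f : MvPowerSeries σ ℚ) :
    nilEval v (q • f) = q • nilEval v f := by
  rw [← nilEvalHom_apply v hv, ← nilEvalHom_apply v hv, map_rat_smul]

variable {A : Type u} [Ring A] [Algebra ℚ A] {I : Ideal A} [I.IsTwoSided] {N : ℕ}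

section

variable {E : Type u} [CommRing E] [Algebra ℚ E] [Module E (comIdeal I)]
  [IsScalarTower ℚ E (comIdeal I)] [FaithfulSMul E (comIdeal I)] {r l : I → E}

theorem IsMulOps.sub_add_sub_add_sub_eq_zero (H : IsMulOps r l) {a b c : I}
    (hθ : ∀ u : A, ((a : A) + b + c) * u = u * ((a : A) + b + c)) :
    r a - l a + (r b - l b) + (r c - l c) = 0 := by
  refine FaithfulSMul.eq_of_smul_eq_smul (α := comIdeal I) fun v => Subtype.ext ?_
  simp only [add_smul, sub_smul, AddSubgroupClass.coe_sub, Submodule.coe_add, H.r_smul, H.l_smul,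
    zero_smul, Submodule.coe_zero]
  linear_combination (norm := noncomm_ring) -hθ v

/-- Each equation is the commutator of the central element `a + b + c` with `a` or `b`. The sign in
the last one makes the three terms of `Hex^r` add up. -/
theorem com_eq_of_central (h : FrozenFeet I N) {a b c : I}
    (hθ : ∀ u : A, ((a : A) + b + c) * u = u * ((a : A) + b + c)) :
    com h b c = com h a b ∧ com h c a = com h a b ∧ com h c b = -com h a b := by
  refine ⟨Subtype.ext ?_, Subtype.ext ?_, Subtype.ext ?_⟩
  · simp only [com]
    linear_combination (norm := noncomm_ring) -hθ b
  · simp only [com]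
    linear_combination (norm := noncomm_ring) hθ a
  · simp only [com, NegMemClass.coe_neg]
    linear_combination (norm := noncomm_ring) hθ b

theorem IsMulOps.hexagon_right (H : IsMulOps r l) (h : FrozenFeet I N) {a b c : I}
    (hθ : ∀ u : A, ((a : A) + b + c) * u = u * ((a : A) + b + c)) (q : ℚ)
    (f : MvPowerSeries (Fin 2) ℚ) {w : A} (hw : truncPhi N f (c : A) b * w = 1) :
    truncPhi N f (a : A) b * IsNilpotent.exp ((q • b : I) : A) * w
        * IsNilpotent.exp ((q • c : I) : A) * truncPhi N f (c : A) a
      - IsNilpotent.exp ((q • b : I) : A) * IsNilpotent.exp ((q • c : I) : A) =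
    (((1 + l (q • b) + l (q • c)) * nilEval ![r b - l b, r c - l c] (hexSerRight q f)) •
      com h a b : comIdeal I) := by
  obtain ⟨-, h2, h3⟩ := com_eq_of_central h hθ
  have ha : r a - l a = -(r b - l b) - (r c - l c) := by
    linear_combination H.sub_add_sub_add_sub_eq_zero hθ
  have hv := forall_fin_two_isNilpotent (H.isNilpotent_sub h b) (H.isNilpotent_sub h c)
  have hX0 := nilEval_X hv 0
  have hX1 := nilEval_X hv 1
  have hXa : nilEval ![r b - l b, r c - l c] (-MvPowerSeries.X 0 - MvPowerSeries.X 1) =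
      r a - l a := by
    rw [ha, ← nilEvalHom_apply _ hv, map_sub, map_neg, nilEvalHom_apply, nilEvalHom_apply, hX0, hX1]
    rfl
  simp only [Matrix.cons_val_zero, Matrix.cons_val_one] at hX0 hX1
  have hsub : ∀ F G : MvPowerSeries (Fin 2) ℚ, MvPowerSeries.constantCoeff F = 0 →
      MvPowerSeries.constantCoeff G = 0 →
      nilEval ![r b - l b, r c - l c] (MvPowerSeries.subst ![F, G] f) =
        nilEval ![nilEval ![r b - l b, r c - l c] F, nilEval ![r b - l b, r c - l c] G] f := by
    intro F G hF hG
    rw [nilEval_subst hv (constantCoeff_fin_two hF hG)]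
    congr 1
    funext s
    fin_cases s <;> rfl
  -- The inverse of `1 + t` with `t * t = 0`. Only a right inverse `w` is given, and the computation
  -- determines it.
  have hw' : w = 1 - ((nilEval ![r c - l c, r b - l b] f • com h c b : comIdeal I) : A) := by
    rw [H.truncPhi_eq h] at hw
    have h0 := comIdeal_mul_self (nilEval ![r c - l c, r b - l b] f • com h c b).2
      (nilEval ![r c - l c, r b - l b] f • com h c b).2
    set t := ((nilEval ![r c - l c, r b - l b] f • com h c b : comIdeal I) : A)
    calc w = (1 - t) * ((1 + t) * w) + t * t * w := by noncomm_ring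
      _ = 1 - t := by rw [hw, h0, zero_mul, add_zero, mul_one]
  rw [hw', H.truncPhi_eq h, H.truncPhi_eq h, H.exp_product h, mul_smul, h2, h3]
  congr 2
  have e : nilEval ![r b - l b, r c - l c] (hexSerRight q f) =
      nilEval ![r a - l a, r b - l b] f * IsNilpotent.exp (q • (r b - l b + (r c - l c)))
      + nilEval ![r c - l c, r b - l b] f * IsNilpotent.exp (q • (r c - l c))
      + nilEval ![r c - l c, r a - l a] f := by
    rw [hexSerRight, ← nilEvalHom_apply _ hv]
    simp only [map_add, map_mul]
    simp only [nilEvalHom_apply]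
    rw [hsub _ _ (by simp) (by simp), hsub _ _ (by simp) (by simp), hsub _ _ (by simp) (by simp),
      hXa, hX0, hX1, serExp, serExp, nilEval_exp_subst hv (by simp),
      nilEval_exp_subst hv (by simp), nilEval_rat_smul hv, nilEval_rat_smul hv, hX1,
      ← nilEvalHom_apply _ hv, map_add, nilEvalHom_apply, nilEvalHom_apply, hX0, hX1]
  rw [e, H.r_rat_smul, H.r_rat_smul, H.l_rat_smul, H.l_rat_smul, ← smul_sub, ← smul_sub, ← smul_add]
  module

end

section LeftSide

variable {E : Type u} [CommRing E] [Algebra ℚ E] [Module E (sqIdeal I)]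
  [IsScalarTower ℚ E (sqIdeal I)] [FaithfulSMul E (sqIdeal I)]

/-- The factors of `x ^ k` after the first two are absorbed in the operator `e`, applied to `x * x`.
The operator is given as the value of a series `f`, so that identities between series apply. -/
theorem exp_eq_add_serExpTwo (h : FrozenFeet I N) {x : I} {e : E}
    (he : ∀ v : sqIdeal I, ((e • v : sqIdeal I) : A) = v * x)
    (w : sqIdeal I) (hw : (w : A) = x * x) {σ : Type*} [Finite σ] {v : σ → E}
    (hv : ∀ s, IsNilpotent (v s)) {f : MvPowerSeries σ ℚ}
    (hf : MvPowerSeries.constantCoeff f = 0) (hfe : nilEval v f = e) :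
    IsNilpotent.exp (x : A) = 1 + x + ((nilEval v (serExpTwo f) • w : sqIdeal I) : A) := by
  have hx : (x : A) ^ (N + 2) = 0 := by
    rw [pow_add, pow_eq_zero_of_frozenFeet h x, zero_mul]
  rw [IsNilpotent.exp_eq_sum hx, Finset.sum_range_succ', Finset.sum_range_succ', serExpTwo,
    nilEval_powerSeries_subst hv hf (n := N) (by rw [hfe, op_pow_eq_zero h he]), coe_sum_smul,
    add_assoc, add_comm]
  congr 1
  · simp [add_comm]
  · refine Finset.sum_congr rfl fun k _ => ?_
    rw [smul_assoc, Submodule.coe_smul, hfe, coe_pow_smul he, hw, PowerSeries.coeff_mk,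
      ← pow_two, ← pow_add, add_comm 2 k]

theorem mul_exp_eq_add_serExpOne (h : FrozenFeet I N) {x y : I} {e : E}
    (he : ∀ v : sqIdeal I, ((e • v : sqIdeal I) : A) = v * y)
    (w : sqIdeal I) (hw : (w : A) = x * y) {σ : Type*} [Finite σ] {v : σ → E}
    (hv : ∀ s, IsNilpotent (v s)) {f : MvPowerSeries σ ℚ}
    (hf : MvPowerSeries.constantCoeff f = 0) (hfe : nilEval v f = e) :
    (x : A) * IsNilpotent.exp (y : A) =
      x + ((nilEval v (serExpOne f) • w : sqIdeal I) : A) := by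
  have hx : (y : A) ^ (N + 1) = 0 := by
    rw [pow_add, pow_eq_zero_of_frozenFeet h y, zero_mul]
  rw [IsNilpotent.exp_eq_sum hx, Finset.sum_range_succ', serExpOne,
    nilEval_powerSeries_subst hv hf (n := N) (by rw [hfe, op_pow_eq_zero h he]), coe_sum_smul,
    mul_add, add_comm, Finset.mul_sum]
  congr 1
  · simp
  · refine Finset.sum_congr rfl fun k _ => ?_
    rw [smul_assoc, Submodule.coe_smul, hfe, coe_pow_smul he, hw, PowerSeries.coeff_mk,
      mul_assoc, ← pow_succ', mul_smul_comm]

end LeftSide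

/-- Both sides are combinations of `xx`, `xy`, `yx`, `yy` with coefficients that are power series in
the right multiplications; these coefficients agree. No central element is needed here. -/
theorem exp_add_sub_exp_mul_exp (h : FrozenFeet I N) (x y : I) :
    IsNilpotent.exp ((x + y : I) : A) - IsNilpotent.exp (x : A) * IsNilpotent.exp (y : A) =
      (com h x y : A) * truncEval N hexSer (x : A) y
        + x * com h x y * truncEval N (hexSer - MvPowerSeries.pderiv ℚ 0 hexSer) (x : A) y
        + y * com h x y * truncEval N (hexSer - MvPowerSeries.pderiv ℚ 1 hexSer) (x : A) y := by
  obtain ⟨E, _, _, _, _, _, r, hr⟩ := exists_rightOps h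
  have r_add : r (x + y) = r x + r y := by
    refine FaithfulSMul.eq_of_smul_eq_smul (α := sqIdeal I) fun v => Subtype.ext ?_
    simp [add_smul, hr, mul_add]
  have hv := forall_fin_two_isNilpotent (isNilpotent_op h (hr x)) (isNilpotent_op h (hr y))
  have hX0 := nilEval_X hv 0
  have hX1 := nilEval_X hv 1
  simp only [Matrix.cons_val_zero, Matrix.cons_val_one] at hX0 hX1
  have hXs : nilEval ![r x, r y] (MvPowerSeries.X 0 + MvPowerSeries.X 1) = r (x + y) := by
    rw [r_add, ← nilEvalHom_apply _ hv, map_add, nilEvalHom_apply, nilEvalHom_apply, hX0, hX1]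
  let xx : sqIdeal I := ⟨x * x, mul_mem_sq x.2 x.2⟩
  let xy : sqIdeal I := ⟨x * y, mul_mem_sq x.2 y.2⟩
  let yx : sqIdeal I := ⟨y * x, mul_mem_sq y.2 x.2⟩
  let yy : sqIdeal I := ⟨y * y, mul_mem_sq y.2 y.2⟩
  have e1 := exp_eq_add_serExpTwo h (hr (x + y)) (xx + xy + (yx + yy))
    (by simp only [xx, xy, yx, yy, Submodule.coe_add]; noncomm_ring) hv (by simp) hXs
  have e2 := exp_eq_add_serExpTwo h (hr x) xx rfl hv (by simp) hX0
  have e3 := exp_eq_add_serExpTwo h (hr y) yy rfl hv (by simp) hX1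
  have e4 := mul_exp_eq_add_serExpOne h (hr y) xy rfl hv (by simp) hX1
  have e5 := coe_mul_exp h (hr y) (nilEval ![r x, r y] (serExpTwo (MvPowerSeries.X 0)) • xx)
  have f1 := coe_mul_truncEval h (hr x) (hr y) hexSer (xy - yx)
  have f2 := coe_mul_truncEval h (hr x) (hr y) (hexSer - MvPowerSeries.pderiv ℚ 0 hexSer)
    (r y • xx - r x • xy)
  have f3 := coe_mul_truncEval h (hr x) (hr y) (hexSer - MvPowerSeries.pderiv ℚ 1 hexSer)
    (r y • yx - r x • yy)
  -- This rewrites `x(xy - yx)` so that the last letter becomes an operator on a product of two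
  -- letters.
  have g2 : ((r y • xx - r x • xy : sqIdeal I) : A) = x * com h x y := by
    rw [AddSubgroupClass.coe_sub, hr, hr]
    simp only [xx, xy, com]
    noncomm_ring
  have g3 : ((r y • yx - r x • yy : sqIdeal I) : A) = y * com h x y := by
    rw [AddSubgroupClass.coe_sub, hr, hr]
    simp only [yx, yy, com]
    noncomm_ring
  rw [g2] at f2
  rw [g3] at f3
  have f1' : (com h x y : A) * truncEval N hexSer (x : A) y =
      ((nilEval ![r x, r y] hexSer • (xy - yx) : sqIdeal I) : A) := f1
  have e6 : IsNilpotent.exp (x : A) * IsNilpotent.exp (y : A) =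
      1 + y + x + ((nilEval ![r x, r y] (serExpTwo (MvPowerSeries.X 1)) • yy
        + nilEval ![r x, r y] (serExpOne (MvPowerSeries.X 1)) • xy
        + IsNilpotent.exp (r y) • nilEval ![r x, r y] (serExpTwo (MvPowerSeries.X 0)) • xx :
          sqIdeal I) : A) := by
    rw [e2, add_mul, add_mul, one_mul, e4, e5, e3]
    simp only [Submodule.coe_add]
    abel
  rw [f1', f2, f3, e6, e1, ← Submodule.coe_add, ← Submodule.coe_add, Submodule.coe_add (x := x)]
  have k : ∀ p q s : sqIdeal I, p = q + s →
      1 + ((x : A) + y) + (p : A) - (1 + y + x + q) = s := by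
    rintro p q s rfl
    rw [Submodule.coe_add]
    abel
  have i1 := congrArg (nilEvalHom _ hv) X_one_mul_hexSer_sub_pderiv
  have i2 := congrArg (nilEvalHom _ hv) X_zero_mul_hexSer_sub_pderiv
  have i3 := congrArg (nilEvalHom _ hv) X_one_mul_hexSer_sub_pderiv_one
  have i4 := congrArg (nilEvalHom _ hv) X_zero_mul_hexSer_sub_pderiv_zero
  have he : nilEvalHom _ hv (serExp (MvPowerSeries.X 1)) = IsNilpotent.exp (r y) := by
    rw [nilEvalHom_apply, serExp, nilEval_exp_subst hv (by simp), hX1]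
  have hX0' : nilEvalHom _ hv (MvPowerSeries.X 0) = r x := by rw [nilEvalHom_apply, hX0]
  have hX1' : nilEvalHom _ hv (MvPowerSeries.X 1) = r y := by rw [nilEvalHom_apply, hX1]
  refine k _ _ _ ?_
  simp only [← nilEvalHom_apply _ hv]
  simp only [map_mul, map_add, map_sub, he, hX0', hX1'] at i1 i2 i3 i4 ⊢
  linear_combination (norm := module) -i1 • xx + i4 • xy - i3 • yx + i2 • yy

/-! ## The hexagons in a truncation -/

theorem exp_add_sub_exp_mul_exp_eq_product (h : FrozenFeet I N) {a b c : I}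
    (hθ : ∀ u : A, ((a : A) + b + c) * u = u * ((a : A) + b + c))
    (f : MvPowerSeries (Fin 2) ℚ) {w : A} (hw : truncPhi N f (c : A) b * w = 1) (q : ℚ)
    (hq : q * q = 1)
    (hf : hexSerRight q f = MvPowerSeries.subst
      (![q • MvPowerSeries.X 0, q • MvPowerSeries.X 1] : Fin 2 → MvPowerSeries (Fin 2) ℚ)
        hexSer) :
    truncPhi N f (a : A) b * IsNilpotent.exp ((q • b : I) : A) * w
        * IsNilpotent.exp ((q • c : I) : A) * truncPhi N f (c : A) a =
      IsNilpotent.exp ((q • b + q • c : I) : A) := by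
  obtain ⟨E, _, _, _, _, _, r, l, H⟩ := exists_isMulOps h
  have h1 := H.hexagon_right h hθ q f hw
  have h2 := exp_add_sub_exp_mul_exp h (q • b) (q • c)
  rw [H.components_eq h] at h2
  have hv := forall_fin_two_isNilpotent (H.isNilpotent_sub h b) (H.isNilpotent_sub h c)
  have h3 : nilEval ![r b - l b, r c - l c] (hexSerRight q f) =
      nilEval ![r (q • b) - l (q • b), r (q • c) - l (q • c)] hexSer := by
    rw [hf, nilEval_subst hv (constantCoeff_fin_two (by simp) (by simp))]
    congr 1
    funext s
    rw [H.r_rat_smul, H.r_rat_smul, H.l_rat_smul, H.l_rat_smul]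
    fin_cases s
    · exact (nilEval_rat_smul hv _ _).trans (by rw [nilEval_X hv]; exact smul_sub _ _ _)
    · exact (nilEval_rat_smul hv _ _).trans (by rw [nilEval_X hv]; exact smul_sub _ _ _)
  -- The bracket is multiplied by `q * q = 1`, so one argument covers both signs of the hexagon.
  have h4 : com h (q • b) (q • c) = com h a b := by
    rw [← (com_eq_of_central h hθ).1]
    apply Subtype.ext
    change (q • (b : A)) * (q • (c : A)) - (q • (c : A)) * (q • (b : A)) = b * c - c * b
    simp only [smul_mul_smul_comm, hq, one_smul]
  rw [h3, ← h4, ← h2, sub_left_inj] at h1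
  exact h1

theorem hexagon_right_components (h : FrozenFeet I N) {a b c : I}
    (hθ : ∀ u : A, ((a : A) + b + c) * u = u * ((a : A) + b + c))
    (f : MvPowerSeries (Fin 2) ℚ) {w : A} (hw : truncPhi N f (c : A) b * w = 1) :
    truncPhi N f (a : A) b * IsNilpotent.exp (b : A) * w
        * IsNilpotent.exp (c : A) * truncPhi N f (c : A) a
      - IsNilpotent.exp (b : A) * IsNilpotent.exp (c : A) =
    (com h a b : A) * truncEval N (hexSerRight 1 f) (b : A) c
      + b * com h a b * truncEval N (hexSerRight 1 f
        - MvPowerSeries.pderiv ℚ 0 (hexSerRight 1 f)) (b : A) c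
      + c * com h a b * truncEval N (hexSerRight 1 f
        - MvPowerSeries.pderiv ℚ 1 (hexSerRight 1 f)) (b : A) c := by
  obtain ⟨E, _, _, _, _, _, r, l, H⟩ := exists_isMulOps h
  have h1 := H.hexagon_right h hθ 1 f hw
  simp only [one_smul] at h1
  rw [h1, H.components_eq h]

end HexagonSides

/-! ## The pentagon in a module over a commutative ring -/

section PentagonModule

variable {E V : Type*} [CommRing E] [AddCommGroup V] [Module E V]

theorem pow_smul_congr {x x' : E} {v : V} (h : x • v = x' • v) (i : ℕ) :
    x ^ i • v = x' ^ i • v := by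
  obtain ⟨k, hk⟩ := sub_dvd_pow_sub_pow x x' i
  rw [← sub_eq_zero, ← sub_smul, hk, mul_comm, mul_smul, sub_smul, h, sub_self, smul_zero]

theorem pow_mul_pow_smul_congr {x x' z z' : E} {v : V} (h : x • v = x' • v) (h' : z • v = z' • v)
    (i j : ℕ) : (x ^ i * z ^ j) • v = (x' ^ i * z' ^ j) • v := by
  rw [mul_smul, pow_smul_congr h', smul_comm, pow_smul_congr h, smul_comm, ← mul_smul]

/-- The difference of the two sides of the linearized pentagon for the monomial with exponents
`i`, `j`; the operators `p`, `q`, `u`, `v`, `w` stand for `t¹²`, `t¹³`, `t²³`, `t²⁴`, `t³⁴`. -/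
def pentagonDefect (p q u v w : E) (y₁ y₂ y₃ y₄ : V) (i j : ℕ) : V :=
  (p ^ i * u ^ j) • y₁ + ((p + q) ^ i * (v + w) ^ j) • (y₂ + y₃) + (u ^ i * w ^ j) • y₄
    - ((q + u) ^ i * w ^ j) • (y₃ + y₄) - (p ^ i * (u + v) ^ j) • (y₁ + y₂)

/-- The hypotheses say that `y₁ - y`, `y₂ + y`, `y₃ - y`, `y₄ + y` are killed by certain operators,
exactly those by which the two monomials acting on each of them differ. So the errors cancel; the
remaining multiples of `y` telescope, and `w • y = p • y` treats the last one. -/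
theorem pentagonDefect_eq {p q u v w : E} {y y₁ y₂ y₃ y₄ : V}
    (hw : w • y = p • y)
    (h1 : v • y₁ = v • y)
    (h2 : q • y₂ = -(q • y)) (h2' : u • y₂ = -(u • y)) (h2'' : w • y₂ = -(w • y))
    (h3 : p • y₃ = p • y) (h3' : u • y₃ = u • y) (h3'' : v • y₃ = v • y)
    (h4 : q • y₄ = -(q • y)) (i j : ℕ) :
    pentagonDefect p q u v w y₁ y₂ y₃ y₄ i j = (p ^ i * u ^ j) • y - (u ^ i * p ^ j) • y := by
  have k1 : v • (y₁ - y) = 0 := by rw [smul_sub, h1, sub_self]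
  have k2 : q • (y₂ + y) = 0 := by rw [smul_add, h2, neg_add_cancel]
  have k2' : u • (y₂ + y) = 0 := by rw [smul_add, h2', neg_add_cancel]
  have k2'' : w • (y₂ + y) = 0 := by rw [smul_add, h2'', neg_add_cancel]
  have k3 : p • (y₃ - y) = 0 := by rw [smul_sub, h3, sub_self]
  have k3' : u • (y₃ - y) = 0 := by rw [smul_sub, h3', sub_self]
  have k3'' : v • (y₃ - y) = 0 := by rw [smul_sub, h3'', sub_self]
  have k4 : q • (y₄ + y) = 0 := by rw [smul_add, h4, neg_add_cancel]
  have e1 := pow_mul_pow_smul_congr (v := y₁ - y) (x := p) rfl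
    (show (u + v) • (y₁ - y) = u • (y₁ - y) by rw [add_smul, k1, add_zero]) i j
  have e2 := pow_mul_pow_smul_congr (v := y₂ + y)
    (show (p + q) • (y₂ + y) = p • (y₂ + y) by rw [add_smul, k2, add_zero])
    (show (v + w) • (y₂ + y) = (u + v) • (y₂ + y) by
      rw [add_smul, add_smul, k2', k2'', add_zero, zero_add]) i j
  have e3 := pow_mul_pow_smul_congr (v := y₃ - y)
    (show (p + q) • (y₃ - y) = (q + u) • (y₃ - y) by
      rw [add_smul, add_smul, k3, k3', add_zero, zero_add])
    (show (v + w) • (y₃ - y) = w • (y₃ - y) by rw [add_smul, k3'', zero_add]) i j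
  have e4 := pow_mul_pow_smul_congr (v := y₄ + y)
    (show (q + u) • (y₄ + y) = u • (y₄ + y) by rw [add_smul, k4, zero_add])
    (z := w) rfl i j
  have f4 := pow_mul_pow_smul_congr (v := y) (x := u) rfl hw i j
  simp only [smul_sub, smul_add] at e1 e2 e3 e4
  rw [pentagonDefect]
  linear_combination (norm := module) -e1 + e2 + e3 - e4 - f4

end PentagonModule

/-! ### Adjoining a formal vector on which the operators still commute. -/

section PentagonExtension

variable {E V : Type u} [CommRing E] [Algebra ℚ E] [AddCommGroup V] [Module ℚ V] [Module E V]
  [IsScalarTower ℚ E V]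

/-- The action of `e` on the extension of `V` by one further basis vector, which is sent to `n`. -/
def extOp (e : E) (n : V) : Module.End ℚ (V × ℚ) where
  toFun m := (e • m.1 + m.2 • n, 0)
  map_add' m m' := by
    ext
    · simp only [Prod.fst_add, Prod.snd_add, smul_add, add_smul]
      abel
    · simp
  map_smul' t m := by
    ext
    · simp only [Prod.smul_fst, Prod.smul_snd, smul_add, RingHom.id_apply, smul_eq_mul, mul_smul]
      rw [← algebraMap_smul E t m.1, smul_comm, algebraMap_smul]
    · simp

/-- On `V` the operators commute already; the new basis vector gives the single integrability
condition `e • n' = e' • n`. -/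
theorem extOp_mul_comm {e e' : E} {n n' : V} (h : e • n' = e' • n) :
    extOp e n * extOp e' n' = extOp e' n' * extOp e n := by
  ext m
  · simp [extOp, smul_smul, mul_comm]
  · simp [extOp]
  · simp [extOp, h]
  · simp [extOp]

theorem pow_smul_prod_zero {E' : Type*} [CommRing E'] [Module E' (V × ℚ)] {x : E} {X : E'}
    (h : ∀ v : V, X • (v, (0 : ℚ)) = (x • v, 0)) (v : V) (i : ℕ) :
    X ^ i • (v, (0 : ℚ)) = (x ^ i • v, 0) := by
  induction i with
  | zero => simp
  | succ k ih => rw [pow_succ', mul_smul, ih, h, pow_succ', mul_smul]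

theorem pow_mul_pow_smul_prod_zero {E' : Type*} [CommRing E'] [Module E' (V × ℚ)] {x z : E}
    {X Z : E'} (h : ∀ v : V, X • (v, (0 : ℚ)) = (x • v, 0))
    (h' : ∀ v : V, Z • (v, (0 : ℚ)) = (z • v, 0)) (v : V) (i j : ℕ) :
    (X ^ i * Z ^ j) • (v, (0 : ℚ)) = ((x ^ i * z ^ j) • v, 0) := by
  rw [mul_smul, pow_smul_prod_zero h', pow_smul_prod_zero h, mul_smul]

/-- `V` need not contain a vector `y` as in `pentagonDefect_eq`, but its images under the operators
are prescribed: `w • y₁` under `p` and `w`, `v • y₁` under `q` and `v`, `s • y₁` under `u`. Such a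
vector is adjoined, and `p^i u^j y - u^i p^j y` is antisymmetric in `i`, `j`. -/
theorem pentagonDefect_add_swap {p q s u v w : E} {y₁ y₂ y₃ y₄ : V}
    (θ₁ : (p + q + u) • y₁ = 0) (θ₂ : (p + s + v) • y₂ = 0) (θ₃ : (q + s + w) • y₃ = 0)
    (a₂ : w • y₂ = -(w • y₁)) (a₃ : p • y₃ = w • y₁) (a₄ : p • y₄ = -(w • y₁))
    (b₂ : u • y₂ = -(s • y₁)) (b₃ : u • y₃ = s • y₁)
    (c₂ : q • y₂ = -(v • y₁)) (c₃ : v • y₃ = v • y₁) (c₄ : q • y₄ = -(v • y₁)) (i j : ℕ) :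
    pentagonDefect p q u v w y₁ y₂ y₃ y₄ i j + pentagonDefect p q u v w y₁ y₂ y₃ y₄ j i = 0 := by
  -- The ten integrability conditions, one for each pair among `p`, `q`, `u`, `v`, `w`.
  have pu : p • s • y₁ = u • w • y₁ := by rw [← b₃, smul_comm, a₃]
  have pv : p • v • y₁ = v • w • y₁ := by rw [← c₃, smul_comm, a₃]
  have uv : u • v • y₁ = v • s • y₁ := by rw [← c₃, smul_comm, b₃]
  have qu : q • s • y₁ = u • v • y₁ := by
    linear_combination (norm := module) q • b₂ - u • c₂
  have qw : q • w • y₁ = w • v • y₁ := by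
    linear_combination (norm := module) q • a₂ - w • c₂
  have uw : u • w • y₁ = w • s • y₁ := by
    linear_combination (norm := module) u • a₂ - w • b₂
  have pq : p • v • y₁ = q • w • y₁ := by
    linear_combination (norm := module) p • c₄ - q • a₄
  have pw : p • w • y₁ = w • w • y₁ := by
    linear_combination (norm := module) w • θ₁ - p • θ₃ + (q + s + w) • a₃ - uw
  have qv : q • v • y₁ = v • v • y₁ := by
    linear_combination (norm := module) v • θ₁ - (p + s + v) • c₂ + q • θ₂ - uv
  have vw : v • w • y₁ = w • v • y₁ := smul_comm _ _ _
  let na := w • y₁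
  let nb := s • y₁
  let nc := v • y₁
  obtain ⟨E', _, _, _, _, _, hE⟩ := exists_commRing_of_commute (V := V × ℚ)
    {extOp p na, extOp q nc, extOp u nb, extOp v nc, extOp w na} (by
      rintro _ (rfl | rfl | rfl | rfl | rfl) _ (rfl | rfl | rfl | rfl | rfl) <;>
      first
        | rfl
        | exact extOp_mul_comm (by assumption)
        | exact (extOp_mul_comm (by assumption)).symm)
  obtain ⟨P, hP⟩ := hE (extOp p na) (by simp)
  obtain ⟨Q, hQ⟩ := hE (extOp q nc) (by simp)
  obtain ⟨U, hU⟩ := hE (extOp u nb) (by simp)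
  obtain ⟨W, hW⟩ := hE (extOp w na) (by simp)
  obtain ⟨X, hX⟩ := hE (extOp v nc) (by simp)
  have hP0 : ∀ m : V, P • (m, (0 : ℚ)) = (p • m, 0) := fun m => by simp [hP, extOp]
  have hQ0 : ∀ m : V, Q • (m, (0 : ℚ)) = (q • m, 0) := fun m => by simp [hQ, extOp]
  have hU0 : ∀ m : V, U • (m, (0 : ℚ)) = (u • m, 0) := fun m => by simp [hU, extOp]
  have hW0 : ∀ m : V, W • (m, (0 : ℚ)) = (w • m, 0) := fun m => by simp [hW, extOp]
  have hX0 : ∀ m : V, X • (m, (0 : ℚ)) = (v • m, 0) := fun m => by simp [hX, extOp]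
  have hadd : ∀ (Z Z' : E') (z z' : E), (∀ m : V, Z • (m, (0 : ℚ)) = (z • m, 0)) →
      (∀ m : V, Z' • (m, (0 : ℚ)) = (z' • m, 0)) →
      ∀ m : V, (Z + Z') • (m, (0 : ℚ)) = ((z + z') • m, 0) := fun Z Z' z z' h h' m => by
    rw [add_smul, h, h', add_smul, Prod.mk_add_mk, add_zero]
  have key : ∀ i j, pentagonDefect P Q U X W (y₁, (0 : ℚ)) (y₂, 0) (y₃, 0) (y₄, 0) i j =
      (pentagonDefect p q u v w y₁ y₂ y₃ y₄ i j, 0) := fun i j => by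
    simp only [pentagonDefect, Prod.mk_add_mk, add_zero,
      pow_mul_pow_smul_prod_zero hP0 hU0, pow_mul_pow_smul_prod_zero hU0 hW0,
      pow_mul_pow_smul_prod_zero (hadd _ _ _ _ hP0 hQ0) (hadd _ _ _ _ hX0 hW0),
      pow_mul_pow_smul_prod_zero (hadd _ _ _ _ hQ0 hU0) hW0,
      pow_mul_pow_smul_prod_zero hP0 (hadd _ _ _ _ hU0 hX0), Prod.mk_sub_mk, sub_zero]
  -- The adjoined vector is `(0, 1)`. The defect itself only involves vectors of `V`, so the result
  -- descends by `key`.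
  have main := fun i j => pentagonDefect_eq (p := P) (q := Q) (u := U) (v := X) (w := W)
    (y := ((0 : V), (1 : ℚ))) (y₁ := (y₁, 0)) (y₂ := (y₂, 0)) (y₃ := (y₃, 0)) (y₄ := (y₄, 0))
    (by simp [hP, hW, extOp]) (by simp [hX, extOp, nc])
    (by simp [hQ, extOp, nc, c₂]) (by simp [hU, extOp, nb, b₂]) (by simp [hW, extOp, na, a₂])
    (by simp [hP, extOp, na, a₃]) (by simp [hU, extOp, nb, b₃]) (by simp [hX, extOp, nc, c₃])
    (by simp [hQ, extOp, nc, c₄]) i j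
  have h := congrArg Prod.fst (congrArg₂ (· + ·) (main i j) (main j i))
  rw [key, key, mul_comm (P ^ j), mul_comm (U ^ j), sub_add_sub_cancel, sub_self] at h
  exact h

end PentagonExtension

/-! ### The pentagon in a ring with two frozen feet. -/

section PentagonRing

theorem coeff_swap_of_symm {f : MvPowerSeries (Fin 2) ℚ}
    (hsymm : MvPowerSeries.subst
      (![MvPowerSeries.X 1, MvPowerSeries.X 0] : Fin 2 → MvPowerSeries (Fin 2) ℚ) f = f)
    (i j : ℕ) :
    MvPowerSeries.coeff (Finsupp.single 0 i + Finsupp.single 1 j) f =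
      MvPowerSeries.coeff (Finsupp.single 0 j + Finsupp.single 1 i) f := by
  have hs : MvPowerSeries.HasSubst
      (![MvPowerSeries.X 1, MvPowerSeries.X 0] : Fin 2 → MvPowerSeries (Fin 2) ℚ) :=
    MvPowerSeries.HasSubst.X_X
  conv_lhs => rw [← hsymm]
  rw [MvPowerSeries.coeff_subst hs, finsum_eq_single _ (Finsupp.single 0 j + Finsupp.single 1 i)]
  · rw [Finsupp.prod_fintype _ _ (by simp), Fin.prod_univ_two]
    simp [MvPowerSeries.X_pow_eq, MvPowerSeries.monomial_mul_monomial, add_comm]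
  · intro d hd
    rw [Finsupp.prod_fintype _ _ (by simp), Fin.prod_univ_two]
    simp only [Matrix.cons_val_zero, Matrix.cons_val_one, MvPowerSeries.X_pow_eq,
      MvPowerSeries.monomial_mul_monomial, MvPowerSeries.coeff_monomial]
    rw [if_neg, smul_zero]
    intro h
    apply hd
    have h0 := DFunLike.congr_fun h 0
    have h1 := DFunLike.congr_fun h 1
    simp at h0 h1
    ext k
    fin_cases k <;> simp [h0, h1]

/-- Exchanging the indices shows that the sum is its own negative. This is where the symmetry of `λ`
enters the pentagon. -/
theorem sum_smul_eq_zero_of_symm {V : Type*} [AddCommGroup V] [Module ℚ V] (n : ℕ)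
    (c : ℕ → ℕ → ℚ) (g : ℕ → ℕ → V) (hc : ∀ i j, c i j = c j i) (hg : ∀ i j, g i j + g j i = 0) :
    ∑ i ∈ range n, ∑ j ∈ range n, c i j • g i j = 0 := by
  have h1 : ∑ i ∈ range n, ∑ j ∈ range n, c i j • g i j =
      -∑ i ∈ range n, ∑ j ∈ range n, c i j • g i j := by
    conv_lhs => rw [Finset.sum_comm]
    rw [← Finset.sum_neg_distrib]
    refine Finset.sum_congr rfl fun i _ => ?_
    rw [← Finset.sum_neg_distrib]
    refine Finset.sum_congr rfl fun j _ => ?_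
    rw [hc j i, ← smul_neg, eq_neg_of_add_eq_zero_left (hg j i)]
  have h2 : (2 : ℚ) • ∑ i ∈ range n, ∑ j ∈ range n, c i j • g i j = 0 := by
    rw [two_smul]
    nth_rewrite 1 [h1]
    exact neg_add_cancel _
  exact (smul_eq_zero.1 h2).resolve_left two_ne_zero

variable {A : Type u} [Ring A] [Algebra ℚ A] {I : Ideal A} [I.IsTwoSided] {N : ℕ}

section

variable {E : Type u} [CommRing E] [Algebra ℚ E] [Module E (comIdeal I)]
  [IsScalarTower ℚ E (comIdeal I)] [FaithfulSMul E (comIdeal I)] {r l : I → E}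

theorem IsMulOps.coe_sub_smul (H : IsMulOps r l) (x : I) (z : comIdeal I) :
    (((r x - l x) • z : comIdeal I) : A) = z * x - x * z := by
  rw [sub_smul, AddSubgroupClass.coe_sub, H.r_smul, H.l_smul]

theorem IsMulOps.sub_pow_eq_zero (H : IsMulOps r l) (h : FrozenFeet I N) (x : I) :
    (r x - l x) ^ (N + 1) = 0 := by
  rw [sub_eq_add_neg, add_pow_of_sq_eq_zero (by rw [neg_mul_neg, H.l_mul_l]), pow_succ,
    Nat.add_sub_cancel, op_pow_eq_zero h (H.r_smul x)]
  simp

theorem IsMulOps.nilEval_smul_eq_sum (H : IsMulOps r l) (h : FrozenFeet I N) (x y : I)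
    (f : MvPowerSeries (Fin 2) ℚ) (z : comIdeal I) :
    nilEval ![r x - l x, r y - l y] f • z = ∑ i ∈ range (N + 1), ∑ j ∈ range (N + 1),
      MvPowerSeries.coeff (Finsupp.single 0 i + Finsupp.single 1 j) f •
        (((r x - l x) ^ i * (r y - l y) ^ j) • z) := by
  rw [nilEval_eq_sum_range f (H.sub_pow_eq_zero h x) (H.sub_pow_eq_zero h y), Finset.sum_smul]
  refine Finset.sum_congr rfl fun i _ => ?_
  rw [Finset.sum_smul]
  exact Finset.sum_congr rfl fun j _ => smul_assoc _ _ _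

end

/-- The letters `p`, `q`, `s`, `u`, `v`, `w` stand for `t¹²`, `t¹³`, `t¹⁴`, `t²³`, `t²⁴`, `t³⁴`. The
chord `s` is absent from the equation but occurs in the four-term relations that link the triple
brackets. -/
theorem pentagon_truncPhi (h : FrozenFeet I N) {f : MvPowerSeries (Fin 2) ℚ}
    (hsymm : MvPowerSeries.subst
      (![MvPowerSeries.X 1, MvPowerSeries.X 0] : Fin 2 → MvPowerSeries (Fin 2) ℚ) f = f)
    {p q s u v w : I} (hpw : Commute (p : A) w) (hqv : Commute (q : A) v)
    (hsu : Commute (s : A) u)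
    (p₁ : Commute (p : A) (q + u)) (p₂ : Commute (p : A) (s + v))
    (q₁ : Commute (q : A) (p + u)) (q₂ : Commute (q : A) (s + w))
    (s₁ : Commute (s : A) (p + v)) (s₂ : Commute (s : A) (q + w))
    (u₁ : Commute (u : A) (p + q)) (u₂ : Commute (u : A) (v + w))
    (v₁ : Commute (v : A) (p + s)) (v₂ : Commute (v : A) (u + w))
    (w₁ : Commute (w : A) (q + s)) (w₂ : Commute (w : A) (u + v)) :
    truncPhi N f (p : A) u * truncPhi N f ((p + q : I) : A) ((v + w : I) : A)
        * truncPhi N f (u : A) w =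
      truncPhi N f ((q + u : I) : A) w * truncPhi N f (p : A) ((u + v : I) : A) := by
  obtain ⟨E, _, _, _, _, _, r, l, H⟩ := exists_isMulOps h
  have hadd : ∀ x y : I, r (x + y) - l (x + y) = (r x - l x) + (r y - l y) := fun x y => by
    rw [H.r_add, H.l_add]
    ring
  replace hpw := hpw.eq
  replace hqv := hqv.eq
  replace hsu := hsu.eq
  replace p₁ := p₁.eq
  replace p₂ := p₂.eq
  replace q₁ := q₁.eq
  replace q₂ := q₂.eq
  replace s₁ := s₁.eq
  replace s₂ := s₂.eq
  replace u₁ := u₁.eq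
  replace u₂ := u₂.eq
  replace v₁ := v₁.eq
  replace v₂ := v₂.eq
  replace w₁ := w₁.eq
  replace w₂ := w₂.eq
  have z1 : com h (p + q) (v + w) = com h p v + com h q w := by
    apply Subtype.ext
    simp only [com, Submodule.coe_add]
    linear_combination (norm := noncomm_ring) hpw + hqv
  have z2 : com h (q + u) w = com h q w + com h u w := by
    apply Subtype.ext
    simp only [com, Submodule.coe_add]
    noncomm_ring
  have z3 : com h p (u + v) = com h p u + com h p v := by
    apply Subtype.ext
    simp only [com, Submodule.coe_add]
    noncomm_ring
  have defect : ∀ i j, pentagonDefect (r p - l p) (r q - l q) (r u - l u) (r v - l v) (r w - l w)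
        (com h p u) (com h p v) (com h q w) (com h u w) i j
      + pentagonDefect (r p - l p) (r q - l q) (r u - l u) (r v - l v) (r w - l w)
        (com h p u) (com h p v) (com h q w) (com h u w) j i = 0 := by
    refine pentagonDefect_add_swap (s := r s - l s) ?_ ?_ ?_ ?_ ?_ ?_ ?_ ?_ ?_ ?_ ?_
    all_goals
      apply Subtype.ext
      simp only [add_smul, Submodule.coe_add, NegMemClass.coe_neg, H.coe_sub_smul, com,
        Submodule.coe_zero]
    -- The conditions are identities between triple brackets. Each is a combination of commutators
    -- of the relations with a further chord, the Jacobi identity being built into `noncomm_ring`.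
    · linear_combination (norm := noncomm_ring)
        (p₁ * (u : A) - (u : A) * p₁) + ((p : A) * u₁ - u₁ * (p : A))
    · linear_combination (norm := noncomm_ring)
        (p₂ * (v : A) - (v : A) * p₂) + ((p : A) * v₁ - v₁ * (p : A))
    · linear_combination (norm := noncomm_ring)
        (q₂ * (w : A) - (w : A) * q₂) + ((q : A) * w₁ - w₁ * (q : A))
    · linear_combination (norm := noncomm_ring)
        (hpw * (u + v : A) - (u + v : A) * hpw) - ((p : A) * w₂ - w₂ * (p : A))
    · linear_combination (norm := noncomm_ring)
        -(p₁ * (w : A) - (w : A) * p₁) - ((q + u : A) * hpw - hpw * (q + u : A))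
        - (hpw * (u : A) - (u : A) * hpw)
    · linear_combination (norm := noncomm_ring) (hpw * (u : A) - (u : A) * hpw)
    · linear_combination (norm := noncomm_ring)
        (p₂ * (u : A) - (u : A) * p₂) - ((p : A) * hsu - hsu * (p : A))
    · linear_combination (norm := noncomm_ring)
        (q₂ * (u : A) - (u : A) * q₂) - ((q : A) * hsu - hsu * (q : A))
        + (u₁ * (s : A) - (s : A) * u₁)
    · linear_combination (norm := noncomm_ring)
        (p₁ * (v : A) - (v : A) * p₁) - ((p : A) * hqv - hqv * (p : A))
    · linear_combination (norm := noncomm_ring)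
        (hqv * (w : A) - (w : A) * hqv) + ((q : A) * w₂ - w₂ * (q : A))
        - (u₂ * (q : A) - (q : A) * u₂) + (u₁ * (v : A) - (v : A) * u₁)
        - ((u : A) * hqv - hqv * (u : A))
    · linear_combination (norm := noncomm_ring)
        (u₂ * (q : A) - (q : A) * u₂) - (u₁ * (v : A) - (v : A) * u₁)
        + ((u : A) * hqv - hqv * (u : A))
  have hsum := sum_smul_eq_zero_of_symm (N + 1) _ _ (coeff_swap_of_symm hsymm) defect
  have ev : ∀ (x y : I) (z : comIdeal I) {X Y : E}, r x - l x = X → r y - l y = Y →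
      nilEval ![r x - l x, r y - l y] f • z = ∑ i ∈ range (N + 1), ∑ j ∈ range (N + 1),
        MvPowerSeries.coeff (Finsupp.single 0 i + Finsupp.single 1 j) f •
          ((X ^ i * Y ^ j) • z) := by
    rintro x y z _ _ rfl rfl
    exact H.nilEval_smul_eq_sum h x y f z
  have lin : nilEval ![r p - l p, r u - l u] f • com h p u
      + nilEval ![r (p + q) - l (p + q), r (v + w) - l (v + w)] f • com h (p + q) (v + w)
      + nilEval ![r u - l u, r w - l w] f • com h u w =
      nilEval ![r (q + u) - l (q + u), r w - l w] f • com h (q + u) w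
      + nilEval ![r p - l p, r (u + v) - l (u + v)] f • com h p (u + v) := by
    rw [ev p u _ rfl rfl, ev (p + q) (v + w) _ (hadd p q) (hadd v w), ev u w _ rfl rfl,
      ev (q + u) w _ (hadd q u) rfl, ev p (u + v) _ rfl (hadd u v), ← sub_eq_zero, ← sub_sub,
      ← hsum, z1, z2, z3]
    simp only [← Finset.sum_add_distrib, ← Finset.sum_sub_distrib, ← smul_add, ← smul_sub,
      pentagonDefect]
  have lin' := congrArg Subtype.val lin
  simp only [Submodule.coe_add] at lin'
  rw [H.truncPhi_eq h, H.truncPhi_eq h, H.truncPhi_eq h, H.truncPhi_eq h, H.truncPhi_eq h]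
  have m : ∀ x y : comIdeal I, (x : A) * y = 0 := fun x y => comIdeal_mul_self x.2 y.2
  simp only [mul_add, add_mul, one_mul, mul_one, m, add_zero]
  linear_combination (norm := abel) lin'

end PentagonRing

/-! ## Uniqueness of the components -/

section Uniqueness

/-- The value of a chord in the representation `liftThree`. -/
def liftThreeFun {S : Type*} [Ring S] (x y : S) : Fin 3 → Fin 3 → S :=
  ![![0, -x - y, y], ![-x - y, 0, x], ![y, x, 0]]

/-- The three chords sum to zero, so each four-term relation says that a chord commutes with its own
negative; `x` and `y` can be arbitrary. -/
theorem liftThreeFun_add {S : Type*} [Ring S] (x y : S) :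
    ∀ i j k : Fin 3, i ≠ j → i ≠ k → j ≠ k →
      liftThreeFun x y i k + liftThreeFun x y j k = -liftThreeFun x y i j := by
  simp only [Fin.forall_fin_succ, liftThreeFun]
  simp
  exact ⟨by abel, by abel, by abel⟩

/-- The representation of the chords on three strands in which `b` and `c` act by given elements
and `a` acts by `-b-c`. -/
noncomputable def liftThree {S : Type*} [Ring S] [Algebra ℚ S] (x y : S) : ChordAlg 3 →ₐ[ℚ] S :=
  RingQuot.liftAlgHom ℚ ⟨FreeAlgebra.lift ℚ (fun ij => liftThreeFun x y ij.1 ij.2), by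
    intro s t h
    cases h with
    | diag i =>
      rw [FreeAlgebra.lift_ι_apply, map_zero]
      fin_cases i <;> rfl
    | symm i j =>
      rw [FreeAlgebra.lift_ι_apply, FreeAlgebra.lift_ι_apply]
      fin_cases i <;> fin_cases j <;> rfl
    | fourT i j k hij hik hjk =>
      simp only [map_mul, map_add, FreeAlgebra.lift_ι_apply]
      rw [liftThreeFun_add x y i j k hij hik hjk, mul_neg, neg_mul]
    | local_space i j k l hij hik hil hjk hjl hkl =>
      -- Three strands do not contain four distinct ones, so locality is vacuous.
      have h := Finset.card_le_univ ({i, j, k, l} : Finset (Fin 3))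
      rw [Finset.card_insert_of_notMem (by simp [hij, hik, hil]),
        Finset.card_insert_of_notMem (by simp [hjk, hjl]),
        Finset.card_insert_of_notMem (by simp [hkl])] at h
      simp at h⟩

theorem liftThree_chordElt {S : Type*} [Ring S] [Algebra ℚ S] (x y : S) (i j : Fin 3) :
    liftThree x y (chordElt i j) = liftThreeFun x y i j := by
  simp [liftThree, chordElt]

theorem chordAlg_induction {n : ℕ} {p : ChordAlg n → Prop}
    (scalar : ∀ q : ℚ, p (algebraMap ℚ _ q)) (chord : ∀ i j, p (chordElt i j))
    (mul : ∀ x y, p x → p y → p (x * y)) (add : ∀ x y, p x → p y → p (x + y))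
    (x : ChordAlg n) : p x := by
  obtain ⟨f, rfl⟩ := RingQuot.mkAlgHom_surjective ℚ (ChordRel n) x
  induction f using FreeAlgebra.induction with
  | grade0 q => simpa using scalar q
  | grade1 ij => exact chord ij.1 ij.2
  | mul x y hx hy => rw [map_mul]; exact mul _ _ hx hy
  | add x y hx hy => rw [map_add]; exact add _ _ hx hy

/-- The character of the chords on three strands with values in the power series in `b`, `c`. -/
noncomputable def planeChar : ChordAlg 3 →ₐ[ℚ] MvPowerSeries (Fin 2) ℚ :=
  liftThree (MvPowerSeries.X 0) (MvPowerSeries.X 1)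

/-- A triangular representation which annihilates 2FF. -/
noncomputable def planeRep (β γ : ℚ) :
    ChordAlg 3 →ₐ[ℚ] Matrix (Fin 3) (Fin 3) (MvPowerSeries (Fin 2) ℚ) :=
  liftThree
    !![0, MvPowerSeries.C β * MvPowerSeries.X 0, 0; 0, 0, MvPowerSeries.X 0;
      0, 0, MvPowerSeries.X 0]
    !![0, MvPowerSeries.C γ * MvPowerSeries.X 1, 0; 0, 0, 0; 0, 0, MvPowerSeries.X 1]

/-- The matrix `M` is upper triangular with diagonal `t`, `t`, `s`, and its constant term is the
scalar `t`. -/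
def IsPlaneTriangular (M : Matrix (Fin 3) (Fin 3) (MvPowerSeries (Fin 2) ℚ))
    (s : MvPowerSeries (Fin 2) ℚ) (t : ℚ) : Prop :=
  M 0 0 = MvPowerSeries.C t ∧ M 1 1 = MvPowerSeries.C t ∧ M 2 2 = s ∧
    M 1 0 = 0 ∧ M 2 0 = 0 ∧ M 2 1 = 0 ∧
    ∀ i j, MvPowerSeries.constantCoeff (M i j) = if i = j then t else 0

theorem IsPlaneTriangular.mul {M M' : Matrix (Fin 3) (Fin 3) (MvPowerSeries (Fin 2) ℚ)}
    {s s' : MvPowerSeries (Fin 2) ℚ} {t t' : ℚ} (h : IsPlaneTriangular M s t)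
    (h' : IsPlaneTriangular M' s' t') : IsPlaneTriangular (M * M') (s * s') (t * t') := by
  obtain ⟨x1, x2, x3, x4, x5, x6, x7⟩ := h
  obtain ⟨y1, y2, y3, y4, y5, y6, y7⟩ := h'
  simp only [IsPlaneTriangular, Matrix.mul_apply, Fin.sum_univ_three, map_add, map_mul, x7, y7]
  simp only [x1, x2, x3, x4, x5, x6,
    y1, y2, y3, y4, y5, y6, mul_zero, zero_mul, add_zero, zero_add, true_and]
  intro i j
  fin_cases i <;> fin_cases j <;> simp

theorem IsPlaneTriangular.sub {M M' : Matrix (Fin 3) (Fin 3) (MvPowerSeries (Fin 2) ℚ)}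
    {s s' : MvPowerSeries (Fin 2) ℚ} {t t' : ℚ} (h : IsPlaneTriangular M s t)
    (h' : IsPlaneTriangular M' s' t') : IsPlaneTriangular (M - M') (s - s') (t - t') := by
  obtain ⟨x1, x2, x3, x4, x5, x6, x7⟩ := h
  obtain ⟨y1, y2, y3, y4, y5, y6, y7⟩ := h'
  simp only [IsPlaneTriangular, Matrix.sub_apply, map_sub, x7, y7]
  simp only [x1, x2, x3, x4, x5, x6, y1, y2, y3, y4, y5, y6, sub_zero, true_and]
  intro i j
  split_ifs <;> simp

theorem isPlaneTriangular_zero : IsPlaneTriangular 0 0 0 := by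
  simp [IsPlaneTriangular]

theorem IsPlaneTriangular.neg {M : Matrix (Fin 3) (Fin 3) (MvPowerSeries (Fin 2) ℚ)}
    {s : MvPowerSeries (Fin 2) ℚ} {t : ℚ} (h : IsPlaneTriangular M s t) :
    IsPlaneTriangular (-M) (-s) (-t) := by
  simpa using isPlaneTriangular_zero.sub h

theorem planeRep_triangular (β γ : ℚ) (x : ChordAlg 3) :
    IsPlaneTriangular (planeRep β γ x) (planeChar x) (chordCounit 3 x) := by
  induction x using chordAlg_induction with
  | scalar q =>
    rw [AlgHom.commutes, AlgHom.commutes, AlgHom.commutes]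
    simp only [IsPlaneTriangular, Matrix.algebraMap_matrix_apply, MvPowerSeries.algebraMap_apply]
    refine ⟨rfl, rfl, rfl, rfl, rfl, rfl, fun i j => ?_⟩
    split_ifs <;> simp
  | chord i j =>
    have hB : IsPlaneTriangular
        !![0, MvPowerSeries.C β * MvPowerSeries.X 0, 0; 0, 0, MvPowerSeries.X 0;
          0, 0, MvPowerSeries.X 0] (MvPowerSeries.X 0) 0 := by
      simp [IsPlaneTriangular, Fin.forall_fin_succ]
    have hC : IsPlaneTriangular
        !![0, MvPowerSeries.C γ * MvPowerSeries.X 1, 0; 0, 0, 0; 0, 0, MvPowerSeries.X 1]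
        (MvPowerSeries.X 1) 0 := by
      simp [IsPlaneTriangular, Fin.forall_fin_succ]
    have hA := hB.neg.sub hC
    rw [neg_zero, sub_zero] at hA
    rw [chordCounit_chordElt, planeRep, planeChar, liftThree_chordElt, liftThree_chordElt]
    fin_cases i <;> fin_cases j
    exacts [isPlaneTriangular_zero, hA, hC, hA, isPlaneTriangular_zero, hB, hC, hB,
      isPlaneTriangular_zero]
  | mul x y hx hy =>
    rw [map_mul (planeRep β γ), map_mul planeChar, map_mul (chordCounit 3)]
    exact hx.mul hy
  | add x y hx hy =>
    rw [map_add (planeRep β γ), map_add planeChar, map_add (chordCounit 3)]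
    simpa using hx.sub hy.neg

/-- In positive degree the upper left 2 by 2 block is strictly triangular, so a product of two such
matrices lives in the last column. There right multiplication is by the commutative character
`planeChar`, which explains why 2FF is killed. -/
theorem planeRep_sq (β γ : ℚ) {u : ChordAlg 3} (hu : u ∈ chordAug 3 ^ 2) (i : Fin 3) :
    planeRep β γ u i 0 = 0 ∧ planeRep β γ u i 1 = 0 := by
  rw [Submodule.pow_succ, Submodule.pow_one] at hu
  refine Submodule.mul_induction_on hu (fun x hx y hy => ?_) fun x y hx hy => ?_
  · obtain ⟨x1, x2, x3, x4, x5, x6, -⟩ := planeRep_triangular β γ x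
    obtain ⟨y1, y2, y3, y4, y5, y6, -⟩ := planeRep_triangular β γ y
    rw [RingHom.mem_ker] at hx hy
    change chordCounit 3 x = 0 at hx
    change chordCounit 3 y = 0 at hy
    rw [hx, map_zero] at x1 x2
    rw [hy, map_zero] at y1 y2
    rw [map_mul]
    fin_cases i <;>
      simp [Matrix.mul_apply, Fin.sum_univ_three, x1, x2, x4, x5, x6, y1, y2, y4, y5, y6]
  · simp [hx, hy]

theorem planeRep_mul_of_sq (β γ : ℚ) {u : ChordAlg 3} (hu : u ∈ chordAug 3 ^ 2) (x : ChordAlg 3)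
    (i : Fin 3) : planeRep β γ (u * x) i 2 = planeRep β γ u i 2 * planeChar x := by
  obtain ⟨h0, h1⟩ := planeRep_sq β γ hu i
  simp [Matrix.mul_apply, Fin.sum_univ_three, h0, h1, (planeRep_triangular β γ x).2.2.1]

theorem planeRep_twoFFIdeal (β γ : ℚ) {z : ChordAlg 3} (hz : z ∈ twoFFIdeal 3) :
    planeRep β γ z = 0 := by
  rw [← RingHom.mem_ker]
  revert z
  rw [← SetLike.le_def, twoFFIdeal, Ideal.span_le]
  rintro _ ⟨u, hu, x, y, v, rfl⟩
  rw [SetLike.mem_coe, RingHom.mem_ker, map_mul]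
  convert zero_mul _
  ext1 i j
  have h := planeRep_sq β γ hu i
  obtain ⟨x1, x2, x3, x4, x5, x6, -⟩ := planeRep_triangular β γ x
  obtain ⟨y1, y2, y3, y4, y5, y6, -⟩ := planeRep_triangular β γ y
  fin_cases j <;>
    simp [Matrix.mul_apply, Fin.sum_univ_three, h, x3, x5, x6, y3, y5, y6, mul_comm]

/-- Continuity of the representation: it makes statements about the completion testable on
truncations. -/
theorem le_order_planeRep (β γ : ℚ) {N : ℕ} {z : ChordAlg 3} (hz : z ∈ chordAug 3 ^ N)
    (i j : Fin 3) : (N : ℕ∞) ≤ (planeRep β γ z i j).order := by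
  induction N generalizing z i j with
  | zero => simp
  | succ N ih =>
    rw [Submodule.pow_succ] at hz
    refine Submodule.mul_induction_on hz (fun x hx y hy => ?_) fun x y hx hy => ?_
    · rw [map_mul, Matrix.mul_apply, Fin.sum_univ_three]
      have hk : ∀ k, ((N + 1 : ℕ) : ℕ∞) ≤
          (planeRep β γ x i k * planeRep β γ y k j).order := fun k => by
        refine le_trans ?_ MvPowerSeries.le_order_mul
        rw [Nat.cast_add, Nat.cast_one]
        refine add_le_add (ih hx i k) ?_
        rw [Order.one_le_iff_ne_zero, MvPowerSeries.order_ne_zero_iff_constCoeff_eq_zero,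
          (planeRep_triangular β γ y).2.2.2.2.2.2]
        rw [RingHom.mem_ker] at hy
        change chordCounit 3 y = 0 at hy
        rw [hy, ite_self]
      exact le_trans (le_min (le_trans (le_min (hk 0) (hk 1)) MvPowerSeries.min_order_le_add)
        (hk 2)) MvPowerSeries.min_order_le_add
    · rw [map_add, Matrix.add_apply]
      exact le_trans (le_min hx hy) MvPowerSeries.min_order_le_add

theorem eqMod2FF_iff {n : ℕ} {x y : ChordHat n} : EqMod2FF x y ↔
    ∀ N, ∃ w ∈ twoFFIdeal n, Ideal.Quotient.mk (chordAug n ^ N) w = x.1 N - y.1 N := by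
  rw [EqMod2FF, Ideal.Quotient.eq]
  rfl

theorem coeff_truncEval_X {N : ℕ} (f : MvPowerSeries (Fin 2) ℚ) {d : Fin 2 →₀ ℕ}
    (hd : d 0 + d 1 < N) :
    MvPowerSeries.coeff d (truncEval N f (MvPowerSeries.X 0) (MvPowerSeries.X 1)) =
      MvPowerSeries.coeff d f := by
  have hd' : d = Finsupp.single 0 (d 0) + Finsupp.single 1 (d 1) := by
    ext k
    fin_cases k <;> simp
  rw [truncEval, map_sum, Finset.sum_eq_single (d 0 + d 1), map_sum,
    Finset.sum_eq_single (d 0, d 1)]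
  · simp [MvPowerSeries.X_pow_eq, MvPowerSeries.monomial_mul_monomial, ← hd']
  · rintro ⟨i, j⟩ _ hij
    simp only [MvPowerSeries.X_pow_eq, MvPowerSeries.monomial_mul_monomial, map_smul,
      MvPowerSeries.coeff_monomial]
    rw [if_neg, smul_zero]
    rintro rfl
    simp at hij
  · simp
  · intro e _ he
    rw [map_sum]
    refine Finset.sum_eq_zero ?_
    rintro ⟨i, j⟩ hij
    rw [HasAntidiagonal.mem_antidiagonal] at hij
    simp only [MvPowerSeries.X_pow_eq, MvPowerSeries.monomial_mul_monomial, map_smul,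
      MvPowerSeries.coeff_monomial]
    rw [if_neg, smul_zero]
    rintro rfl
    simp at he hij
    exact he hij.symm
  · intro h
    exact absurd (mem_range.2 hd) h

theorem map_truncEval {A B : Type*} [Ring A] [Algebra ℚ A] [Ring B] [Algebra ℚ B] (φ : A →ₐ[ℚ] B)
    (N : ℕ) (f : MvPowerSeries (Fin 2) ℚ) (x y : A) :
    φ (truncEval N f x y) = truncEval N f (φ x) (φ y) := by
  simp [truncEval]

theorem eq_zero_of_le_order_mul {f m : MvPowerSeries (Fin 2) ℚ} (e : Fin 2 →₀ ℕ)
    (hm : m = MvPowerSeries.monomial e 1)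
    (h : ∀ N : ℕ, (N : ℕ∞) ≤
      (m * truncEval N f (MvPowerSeries.X 0) (MvPowerSeries.X 1)).order) : f = 0 := by
  ext d
  -- Large enough for the coefficient at `e + d` to vanish and for the truncation to keep the
  -- coefficient of `f` at `d`.
  have hN := h (e.degree + d.degree + 1)
  have := MvPowerSeries.coeff_of_lt_order (d := e + d) (lt_of_lt_of_le (by
    rw [map_add]
    exact_mod_cast Nat.lt_succ_self _) hN)
  rw [hm, MvPowerSeries.coeff_add_monomial_mul, one_mul, coeff_truncEval_X] at this
  · simpa using this
  · have : d.degree = d 0 + d 1 := by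
      rw [Finsupp.degree_eq_sum, Fin.sum_univ_two]
    omega

theorem ofComponents_eq_zero {P Q S : MvPowerSeries (Fin 2) ℚ}
    (h : EqMod2FF (Three.ofComponents P Q S) 0) : P = 0 ∧ Q = 0 ∧ S = 0 := by
  have hcomp : ∀ N, ∃ w ∈ twoFFIdeal 3,
      Three.ab * truncEval N P (Three.b : ChordAlg 3) Three.c
        + Three.b * Three.ab * truncEval N Q (Three.b : ChordAlg 3) Three.c
        + Three.c * Three.ab * truncEval N S (Three.b : ChordAlg 3) Three.c - w
          ∈ chordAug 3 ^ N := by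
    intro N
    obtain ⟨w, hw, h⟩ := eqMod2FF_iff.1 h N
    refine ⟨w, hw, Ideal.Quotient.eq.1 ?_⟩
    rw [h]
    exact (sub_zero _).symm
  have hb : planeChar (Three.b : ChordAlg 3) = MvPowerSeries.X 0 := by
    simp [planeChar, Three.b, chord, liftThree_chordElt, liftThreeFun]
  have hc : planeChar (Three.c : ChordAlg 3) = MvPowerSeries.X 1 := by
    simp [planeChar, Three.c, chord, liftThree_chordElt, liftThreeFun]
  have hab : Three.ab ∈ chordAug 3 ^ 2 :=
    sub_mem (mul_mem_sq Three.a.2 Three.b.2) (mul_mem_sq Three.b.2 Three.a.2)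
  have entry : ∀ (β γ : ℚ) (i : Fin 3) (N : ℕ), (N : ℕ∞) ≤
      (planeRep β γ Three.ab i 2 * truncEval N P (MvPowerSeries.X 0) (MvPowerSeries.X 1)
        + planeRep β γ (Three.b * Three.ab) i 2
          * truncEval N Q (MvPowerSeries.X 0) (MvPowerSeries.X 1)
        + planeRep β γ (Three.c * Three.ab) i 2
          * truncEval N S (MvPowerSeries.X 0) (MvPowerSeries.X 1)).order := by
    intro β γ i N
    obtain ⟨w, hw, h⟩ := hcomp N
    have := le_order_planeRep β γ h i 2
    rw [map_sub, planeRep_twoFFIdeal β γ hw, sub_zero, map_add, map_add, Matrix.add_apply,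
      Matrix.add_apply, planeRep_mul_of_sq β γ hab,
      planeRep_mul_of_sq β γ (Ideal.mul_mem_left _ _ hab),
      planeRep_mul_of_sq β γ (Ideal.mul_mem_left _ _ hab)] at this
    simpa only [map_truncEval, hb, hc] using this
  have rb : ∀ β γ, planeRep β γ (Three.b : ChordAlg 3) =
      !![0, MvPowerSeries.C β * MvPowerSeries.X 0, 0; 0, 0, MvPowerSeries.X 0;
        0, 0, MvPowerSeries.X 0] := fun β γ => by
    simp [planeRep, Three.b, chord, liftThree_chordElt, liftThreeFun]
  have rc : ∀ β γ, planeRep β γ (Three.c : ChordAlg 3) =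
      !![0, MvPowerSeries.C γ * MvPowerSeries.X 1, 0; 0, 0, 0; 0, 0, MvPowerSeries.X 1] :=
    fun β γ => by simp [planeRep, Three.c, chord, liftThree_chordElt, liftThreeFun]
  have rab : ∀ β γ, planeRep β γ Three.ab = planeRep β γ Three.b * planeRep β γ Three.c
      - planeRep β γ Three.c * planeRep β γ Three.b := fun β γ => by
    have : planeRep β γ (Three.a : ChordAlg 3) = -planeRep β γ Three.b - planeRep β γ Three.c := by
      rw [planeRep, Three.a, Three.b, Three.c, chord, chord, chord, liftThree_chordElt,
        liftThree_chordElt, liftThree_chordElt]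
      rfl
    rw [Three.ab, map_sub, map_mul, map_mul, this]
    noncomm_ring
  have a0 : ∀ β γ, planeRep β γ Three.ab 0 2 =
      -MvPowerSeries.C γ * (MvPowerSeries.X 0 * MvPowerSeries.X 1) := fun β γ => by
    rw [rab, rb, rc, Matrix.sub_apply, Matrix.mul_apply, Matrix.mul_apply]
    simp [Fin.sum_univ_three]
    ring
  have a1 : ∀ β γ, planeRep β γ Three.ab 1 2 = MvPowerSeries.X 0 * MvPowerSeries.X 1 :=
    fun β γ => by
      rw [rab, rb, rc, Matrix.sub_apply, Matrix.mul_apply, Matrix.mul_apply]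
      simp [Fin.sum_univ_three]
  have a2 : ∀ β γ, planeRep β γ Three.ab 2 2 = 0 := fun β γ => by
    rw [rab, rb, rc, Matrix.sub_apply, Matrix.mul_apply, Matrix.mul_apply]
    simp [Fin.sum_univ_three, mul_comm]
  have b0 : ∀ β γ, planeRep β γ (Three.b * Three.ab) 0 2 =
      MvPowerSeries.C β * (MvPowerSeries.X 0 * (MvPowerSeries.X 0 * MvPowerSeries.X 1)) :=
    fun β γ => by
      rw [map_mul, Matrix.mul_apply, Fin.sum_univ_three, a0, a1, a2, rb]
      simp [mul_assoc]
  have b1 : ∀ β γ, planeRep β γ (Three.b * Three.ab) 1 2 = 0 := fun β γ => by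
    rw [map_mul, Matrix.mul_apply, Fin.sum_univ_three, a0, a1, a2, rb]
    simp
  have c0 : ∀ β γ, planeRep β γ (Three.c * Three.ab) 0 2 =
      MvPowerSeries.C γ * (MvPowerSeries.X 1 * (MvPowerSeries.X 0 * MvPowerSeries.X 1)) :=
    fun β γ => by
      rw [map_mul, Matrix.mul_apply, Fin.sum_univ_three, a0, a1, a2, rc]
      simp [mul_assoc]
  have c1 : ∀ β γ, planeRep β γ (Three.c * Three.ab) 1 2 = 0 := fun β γ => by
    rw [map_mul, Matrix.mul_apply, Fin.sum_univ_three, a0, a1, a2, rc]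
    simp
  -- The entry in the middle row sees only `[ab]`, as `bc`. Once `P = 0`, the entry in the top row
  -- isolates `Q` for `(β, γ) = (1, 0)` and `S` for `(β, γ) = (0, 1)`.
  have hP : P = 0 := by
    refine eq_zero_of_le_order_mul (m := MvPowerSeries.X 0 * MvPowerSeries.X 1)
      (Finsupp.single 0 1 + Finsupp.single 1 1)
      (by simp [MvPowerSeries.X, MvPowerSeries.monomial_mul_monomial]) fun N => ?_
    simpa only [a1, b1, c1, zero_mul, add_zero] using entry 0 0 1 N
  subst hP
  have t0 : ∀ N, truncEval N 0 (MvPowerSeries.X 0 : MvPowerSeries (Fin 2) ℚ)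
    (MvPowerSeries.X 1) = 0 := fun N => by simp [truncEval]
  refine ⟨rfl, ?_, ?_⟩
  · refine eq_zero_of_le_order_mul
      (m := MvPowerSeries.X 0 * (MvPowerSeries.X 0 * MvPowerSeries.X 1))
      (Finsupp.single 0 1 + (Finsupp.single 0 1 + Finsupp.single 1 1))
      (by simp [MvPowerSeries.X, MvPowerSeries.monomial_mul_monomial]) fun N => ?_
    simpa only [a0, b0, c0, t0, map_zero, map_one, zero_mul, mul_zero, one_mul, add_zero, zero_add]
      using entry 1 0 0 N
  · refine eq_zero_of_le_order_mul
      (m := MvPowerSeries.X 1 * (MvPowerSeries.X 0 * MvPowerSeries.X 1))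
      (Finsupp.single 1 1 + (Finsupp.single 0 1 + Finsupp.single 1 1))
      (by simp [MvPowerSeries.X, MvPowerSeries.monomial_mul_monomial]) fun N => ?_
    simpa only [a0, b0, c0, t0, map_zero, map_one, zero_mul, mul_zero, one_mul, add_zero, zero_add]
      using entry 0 1 0 N

end Uniqueness

/-! ## The quotients by 2FF and by the elements of high degree -/

section Level

variable {n m : ℕ}

/-- The ideal generated by 2FF and the elements of degree at least `N`. -/
noncomputable def levelIdeal (n N : ℕ) : Ideal (ChordAlg n) := twoFFIdeal n ⊔ chordAug n ^ N

instance levelIdeal_isTwoSided (n N : ℕ) : (levelIdeal n N).IsTwoSided where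
  mul_mem_of_left {x} b hx := by
    obtain ⟨w, hw, v, hv, rfl⟩ := Submodule.mem_sup.1 hx
    rw [add_mul]
    exact Submodule.add_mem_sup (Ideal.mul_mem_right _ _ hw) (Ideal.mul_mem_right _ _ hv)

/-- The quotient of the chord algebra by 2FF and by the elements of degree at least `N`. -/
abbrev Level (n N : ℕ) : Type := ChordAlg n ⧸ levelIdeal n N

/-- The projection of the chord algebra to `Level n N`. -/
noncomputable def toLevel (n N : ℕ) : ChordAlg n →ₐ[ℚ] Level n N :=
  Ideal.Quotient.mkₐ ℚ (levelIdeal n N)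

theorem toLevel_surjective (n N : ℕ) : Function.Surjective (toLevel n N) :=
  Ideal.Quotient.mk_surjective

theorem toLevel_eq_zero {N : ℕ} {x : ChordAlg n} : toLevel n N x = 0 ↔ x ∈ levelIdeal n N :=
  Ideal.Quotient.eq_zero_iff_mem

/-- The elements of positive degree of `Level n N`. -/
noncomputable def levelAug (n N : ℕ) : Ideal (Level n N) where
  carrier := {y | ∃ x ∈ chordAug n, toLevel n N x = y}
  add_mem' := by
    rintro _ _ ⟨x, hx, rfl⟩ ⟨y, hy, rfl⟩
    exact ⟨x + y, add_mem hx hy, map_add _ _ _⟩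
  zero_mem' := ⟨0, zero_mem _, map_zero _⟩
  smul_mem' := by
    rintro c _ ⟨x, hx, rfl⟩
    obtain ⟨c, rfl⟩ := toLevel_surjective n N c
    exact ⟨c * x, Ideal.mul_mem_left _ _ hx, map_mul _ _ _⟩

instance levelAug_isTwoSided (n N : ℕ) : (levelAug n N).IsTwoSided where
  mul_mem_of_left := by
    rintro _ c ⟨x, hx, rfl⟩
    obtain ⟨c, rfl⟩ := toLevel_surjective n N c
    exact ⟨x * c, Ideal.mul_mem_right _ _ hx, map_mul _ _ _⟩

theorem exists_of_mem_levelAug_pow {N k : ℕ} {u : Level n N} (hu : u ∈ levelAug n N ^ k) :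
    ∃ x ∈ chordAug n ^ k, toLevel n N x = u := by
  induction k generalizing u with
  | zero =>
    obtain ⟨x, rfl⟩ := toLevel_surjective n N u
    exact ⟨x, by rw [Submodule.pow_zero, Ideal.one_eq_top]; exact Submodule.mem_top, rfl⟩
  | succ k ih =>
    rw [Submodule.pow_succ] at hu
    refine Submodule.mul_induction_on hu ?_ ?_
    · rintro v hv _ ⟨y, hy, rfl⟩
      obtain ⟨x, hx, rfl⟩ := ih hv
      exact ⟨x * y, by rw [Submodule.pow_succ]; exact Ideal.mul_mem_mul hx hy, map_mul _ _ _⟩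
    · rintro _ _ ⟨x, hx, rfl⟩ ⟨y, hy, rfl⟩
      exact ⟨x + y, add_mem hx hy, map_add _ _ _⟩

theorem frozenFeet_levelAug (n N : ℕ) : FrozenFeet (levelAug n N) N where
  mul_comm u hu x y := by
    obtain ⟨u, hu', rfl⟩ := exists_of_mem_levelAug_pow hu
    obtain ⟨x, rfl⟩ := toLevel_surjective n N x
    obtain ⟨y, rfl⟩ := toLevel_surjective n N y
    simp only [← map_mul]
    rw [← sub_eq_zero, ← map_sub, toLevel_eq_zero]
    exact Submodule.mem_sup_left (Ideal.subset_span ⟨u, hu', x, y, 1, by rw [mul_one, mul_sub]⟩)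
  pow_eq_zero u hu := by
    obtain ⟨u, hu', rfl⟩ := exists_of_mem_levelAug_pow hu
    exact toLevel_eq_zero.2 (Submodule.mem_sup_right hu')

/-- The image of an element of positive degree. -/
noncomputable def levelElt (N : ℕ) (x : chordAug n) : levelAug n N :=
  ⟨toLevel n N x, x, x.2, rfl⟩

theorem levelElt_add {N : ℕ} (x y : chordAug n) :
    levelElt N (x + y) = levelElt N x + levelElt N y :=
  Subtype.ext (map_add _ _ _)

/-- The projection of the completed chord algebra to `Level n N`. -/
noncomputable def hatLevel (n N : ℕ) : ChordHat n →+* Level n N :=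
  (Ideal.Quotient.factor (show chordAug n ^ N ≤ levelIdeal n N from le_sup_right)).comp
    ((Pi.evalRingHom (fun N => ChordAlg n ⧸ chordAug n ^ N) N).comp (ChordHat n).subtype)

theorem hatLevel_of_eq_mk {N : ℕ} {x : ChordHat n} {p : ChordAlg n}
    (h : x.1 N = Ideal.Quotient.mk (chordAug n ^ N) p) : hatLevel n N x = toLevel n N p := by
  change Ideal.Quotient.factor (show chordAug n ^ N ≤ levelIdeal n N from le_sup_right) (x.1 N) = _
  rw [h]
  rfl

theorem eqMod2FF_iff_hatLevel {x y : ChordHat n} :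
    EqMod2FF x y ↔ ∀ N, hatLevel n N x = hatLevel n N y := by
  rw [eqMod2FF_iff]
  refine forall_congr' fun N => ?_
  obtain ⟨p, hp⟩ := Ideal.Quotient.mk_surjective (x.1 N)
  obtain ⟨q, hq⟩ := Ideal.Quotient.mk_surjective (y.1 N)
  rw [hatLevel_of_eq_mk hp.symm, hatLevel_of_eq_mk hq.symm, ← hp, ← hq,
    ← sub_eq_zero (a := toLevel n N p), ← map_sub (toLevel n N), toLevel_eq_zero, levelIdeal,
    Submodule.mem_sup]
  refine exists_congr fun w => and_congr_right fun _ => ?_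
  rw [← map_sub, Ideal.Quotient.eq]
  constructor
  · intro h
    exact ⟨p - q - w, by rw [← neg_sub]; exact neg_mem h, by abel⟩
  · rintro ⟨v, hv, h⟩
    rw [← h]
    simpa using neg_mem hv

/-- The homomorphism is arbitrary so that the projection can be taken alone or after a cabling. -/
theorem toLevel_exp {N : ℕ} (φ : ChordAlg m →ₐ[ℚ] Level n N) (x : ChordAlg m)
    (hx : φ x ∈ levelAug n N) :
    φ (∑ d ∈ range N, ((d.factorial : ℚ)⁻¹) • x ^ d) = IsNilpotent.exp (φ x) := by
  rw [IsNilpotent.exp_eq_sum (pow_eq_zero_of_frozenFeet (frozenFeet_levelAug n N) ⟨_, hx⟩)]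
  simp only [map_sum, map_smul, map_pow]

theorem hatLevel_hatExp (N : ℕ) (x : chordAug n) :
    hatLevel n N (hatExp x) = IsNilpotent.exp (levelElt N x : Level n N) := by
  rw [hatLevel_of_eq_mk (p := ∑ d ∈ range N, ((d.factorial : ℚ)⁻¹) • (x : ChordAlg n) ^ d) rfl]
  exact toLevel_exp _ _ (levelElt N x).2

theorem map_truncPhi {A B : Type*} [Ring A] [Algebra ℚ A] [Ring B] [Algebra ℚ B] (φ : A →ₐ[ℚ] B)
    (N : ℕ) (f : MvPowerSeries (Fin 2) ℚ) (x y : A) :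
    φ (truncPhi N f x y) = truncPhi N f (φ x) (φ y) := by
  simp only [truncPhi, map_sub, map_add, map_mul, map_one, map_truncEval]

theorem phi_eq_mk (N : ℕ) (f : MvPowerSeries (Fin 2) ℚ) :
    (Three.phi f).1 N =
      Ideal.Quotient.mk (chordAug 3 ^ N) (truncPhi N f (Three.a : ChordAlg 3) Three.b) :=
  rfl

theorem hatLevel_phi (N : ℕ) (f : MvPowerSeries (Fin 2) ℚ) :
    hatLevel 3 N (Three.phi f) =
      truncPhi N f (levelElt N Three.a : Level 3 N) (levelElt N Three.b : Level 3 N) := by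
  rw [hatLevel_of_eq_mk (phi_eq_mk N f), map_truncPhi]
  rfl

theorem hatLevel_ofComponents (N : ℕ) (P Q S : MvPowerSeries (Fin 2) ℚ) :
    hatLevel 3 N (Three.ofComponents P Q S) =
      (com (frozenFeet_levelAug 3 N) (levelElt N Three.a) (levelElt N Three.b) : Level 3 N)
          * truncEval N P (levelElt N Three.b : Level 3 N) (levelElt N Three.c : Level 3 N)
        + (levelElt N Three.b : Level 3 N)
          * (com (frozenFeet_levelAug 3 N) (levelElt N Three.a) (levelElt N Three.b) : Level 3 N)
          * truncEval N Q (levelElt N Three.b : Level 3 N) (levelElt N Three.c : Level 3 N)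
        + (levelElt N Three.c : Level 3 N)
          * (com (frozenFeet_levelAug 3 N) (levelElt N Three.a) (levelElt N Three.b) : Level 3 N)
          * truncEval N S (levelElt N Three.b : Level 3 N) (levelElt N Three.c : Level 3 N) := by
  rw [hatLevel_of_eq_mk (p := Three.ab * truncEval N P (Three.b : ChordAlg 3) Three.c
    + (Three.b : ChordAlg 3) * Three.ab * truncEval N Q (Three.b : ChordAlg 3) Three.c
    + (Three.c : ChordAlg 3) * Three.ab * truncEval N S (Three.b : ChordAlg 3) Three.c) rfl]
  simp only [Three.ab, map_add, map_mul, map_sub, map_truncEval]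
  rfl

/-! ### Cabling -/

section

variable (S : Fin n → Finset (Fin m)) (hS : ∀ i j, i ≠ j → Disjoint (S i) (S j))

theorem cableAlg_chordElt {i j : Fin n} (hij : i ≠ j) :
    cableAlg S hS (chordElt i j) = ∑ p ∈ S i, ∑ q ∈ S j, chordElt p q := by
  rw [cableAlg, chordElt, RingQuot.liftAlgHom_mkAlgHom_apply, FreeAlgebra.lift_ι_apply, cableElt,
    if_neg hij]

theorem hatLevel_cable {N : ℕ} {x : ChordHat n} {p : ChordAlg n}
    (h : x.1 N = Ideal.Quotient.mk (chordAug n ^ N) p) :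
    hatLevel m N (cable S hS x) = toLevel m N (cableAlg S hS p) := by
  refine hatLevel_of_eq_mk ?_
  change Ideal.quotientMap _ _ _ (x.1 N) = _
  rw [h]
  rfl

theorem hatLevel_cable_hatExp (N : ℕ) (x : chordAug n) :
    hatLevel m N (cable S hS (hatExp x)) =
      IsNilpotent.exp (toLevel m N (cableAlg S hS (x : ChordAlg n))) := by
  rw [hatLevel_cable S hS
    (p := ∑ d ∈ range N, ((d.factorial : ℚ)⁻¹) • (x : ChordAlg n) ^ d) rfl]
  exact toLevel_exp ((toLevel m N).comp (cableAlg S hS)) _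
    ⟨_, chordAug_le_comap S hS x.2, rfl⟩

end

theorem hatLevel_cable_phi (S : Fin 3 → Finset (Fin m))
    (hS : ∀ i j, i ≠ j → Disjoint (S i) (S j)) (N : ℕ) (f : MvPowerSeries (Fin 2) ℚ) :
    hatLevel m N (cable S hS (Three.phi f)) =
      truncPhi N f (toLevel m N (∑ p ∈ S 0, ∑ q ∈ S 1, chordElt p q))
        (toLevel m N (∑ p ∈ S 1, ∑ q ∈ S 2, chordElt p q)) := by
  rw [hatLevel_cable S hS (phi_eq_mk N f), map_truncPhi, map_truncPhi, Three.a, Three.b, chord,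
    chord, cableAlg_chordElt S hS (by decide), cableAlg_chordElt S hS (by decide)]

/-! ### Units -/

/-- Every truncation is unipotent, hence invertible; uniqueness of inverses makes the family of
inverses compatible. -/
theorem isUnit_of_one {x : ChordHat n} (h : x.1 1 = 1) : IsUnit x := by
  have hu : ∀ N, IsUnit (x.1 N) := by
    intro N
    rcases Nat.eq_zero_or_pos N with rfl | hN
    -- For `N = 0` the quotient is the zero ring, and the condition at level one says nothing about
    -- it.
    · obtain ⟨p, hp⟩ := Ideal.Quotient.mk_surjective (x.1 0)
      have : x.1 0 = 1 := by
        rw [← hp, ← map_one (Ideal.Quotient.mk _), Ideal.Quotient.eq, Submodule.pow_zero,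
          Ideal.one_eq_top]
        exact Submodule.mem_top
      rw [this]
      exact isUnit_one
    · obtain ⟨p, hp⟩ := Ideal.Quotient.mk_surjective (x.1 N)
      have h1 := x.2 1 N hN
      rw [← hp, Ideal.Quotient.factor_mk, h, ← map_one (Ideal.Quotient.mk _), Ideal.Quotient.eq,
        Submodule.pow_one] at h1
      have hnil : IsNilpotent (x.1 N - 1) := ⟨N, by
        rw [← hp, ← map_one (Ideal.Quotient.mk _), ← map_sub, ← map_pow,
          Ideal.Quotient.eq_zero_iff_mem]
        exact Ideal.pow_mem_pow h1 N⟩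
      simpa using hnil.isUnit_one_add
  choose u hu using hu
  refine isUnit_iff_exists.2
    ⟨⟨fun N => ((u N)⁻¹ : Units _).1, fun M N hMN => ?_⟩, ?_, ?_⟩
  · refine left_inv_eq_right_inv (a := x.1 M) ?_ (by rw [← hu M, Units.mul_inv])
    rw [← x.2 M N hMN, ← hu N]
    exact (RingHom.map_mul _ _ _).symm.trans
      ((congrArg _ (Units.inv_mul (u N))).trans (RingHom.map_one _))
  · exact Subtype.ext (funext fun N => by
      change x.1 N * _ = 1
      rw [← hu N, Units.mul_inv])
  · exact Subtype.ext (funext fun N => by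
      change _ * x.1 N = 1
      rw [← hu N, Units.inv_mul])

theorem isUnit_hatExp (x : chordAug n) : IsUnit (hatExp x) := by
  refine isUnit_of_one ?_
  change Ideal.Quotient.mk _ (∑ d ∈ range 1, ((d.factorial : ℚ)⁻¹) • (x : ChordAlg n) ^ d) = 1
  simp

theorem isUnit_phi (f : MvPowerSeries (Fin 2) ℚ) : IsUnit (Three.phi f) := by
  refine isUnit_of_one ?_
  rw [phi_eq_mk, ← map_one (Ideal.Quotient.mk _), Ideal.Quotient.eq, Submodule.pow_one, truncPhi]
  have hab : (Three.a : ChordAlg 3) * Three.b - Three.b * Three.a ∈ chordAug 3 :=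
    sub_mem (Ideal.mul_mem_right _ _ Three.a.2) (Ideal.mul_mem_right _ _ Three.b.2)
  have h1 := Ideal.mul_mem_right (truncEval 1 f (Three.a : ChordAlg 3) Three.b) _ hab
  have h2 := Ideal.mul_mem_right
    (truncEval 1 (MvPowerSeries.pderiv ℚ 0 f) (Three.a : ChordAlg 3) Three.b) _
    (Ideal.mul_mem_left _ (Three.a : ChordAlg 3) hab)
  have h3 := Ideal.mul_mem_right
    (truncEval 1 (MvPowerSeries.pderiv ℚ 1 f) (Three.a : ChordAlg 3) Three.b) _
    (Ideal.mul_mem_left _ (Three.b : ChordAlg 3) hab)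
  convert sub_mem (sub_mem h1 h2) h3 using 1
  abel

end Level

theorem chord_sum_mul_comm (u : ChordAlg 3) :
    (chordElt 0 1 + chordElt 1 2 + chordElt 0 2) * u =
      u * (chordElt 0 1 + chordElt 1 2 + chordElt 0 2) := by
  have h01 : Commute (chordElt 0 1 + chordElt 1 2 + chordElt 0 2 : ChordAlg 3) (chordElt 0 1) := by
    have h := (chordElt_fourT (n := 3) (i := 0) (j := 1) (k := 2) (by decide) (by decide)
      (by decide)).symm.add_left (Commute.refl _)
    rw [add_assoc, add_comm, add_comm (chordElt 1 2)]
    exact h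
  have h12 : Commute (chordElt 0 1 + chordElt 1 2 + chordElt 0 2 : ChordAlg 3) (chordElt 1 2) := by
    have h := (chordElt_fourT (n := 3) (i := 1) (j := 2) (k := 0) (by decide) (by decide)
      (by decide)).symm.add_left (Commute.refl _)
    rw [chordElt_comm 1 0, chordElt_comm 2 0] at h
    rw [add_right_comm]
    exact h
  have h02 : Commute (chordElt 0 1 + chordElt 1 2 + chordElt 0 2 : ChordAlg 3) (chordElt 0 2) := by
    have h := (chordElt_fourT (n := 3) (i := 0) (j := 2) (k := 1) (by decide) (by decide)
      (by decide)).symm.add_left (Commute.refl _)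
    rw [chordElt_comm 2 1] at h
    exact h
  induction u using chordAlg_induction with
  | scalar q => exact (Algebra.commutes q _).symm
  | chord i j =>
    have key : ∀ i j : Fin 3, i = j ∨ (i = 0 ∧ j = 1 ∨ i = 1 ∧ j = 0) ∨ (i = 1 ∧ j = 2 ∨
        i = 2 ∧ j = 1) ∨ (i = 0 ∧ j = 2 ∨ i = 2 ∧ j = 0) := by decide
    rcases key i j with rfl | (⟨rfl, rfl⟩ | ⟨rfl, rfl⟩) | (⟨rfl, rfl⟩ | ⟨rfl, rfl⟩) |
      (⟨rfl, rfl⟩ | ⟨rfl, rfl⟩)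
    · rw [chordElt_self, mul_zero, zero_mul]
    · exact h01
    · rw [chordElt_comm 1 0]; exact h01
    · exact h12
    · rw [chordElt_comm 2 1]; exact h12
    · exact h02
    · rw [chordElt_comm 2 0]; exact h02
  | mul x y hx hy => exact (Commute.mul_right (show Commute _ x from hx) (show Commute _ y from hy))
  | add x y hx hy => exact (Commute.add_right (show Commute _ x from hx) (show Commute _ y from hy))

/-! ### Assembling the hexagons and the pentagon from the truncations. -/

section Conclusion

variable {N : ℕ}

theorem levelElt_sum_mul_comm (u : Level 3 N) :
    ((levelElt N Three.a : Level 3 N) + (levelElt N Three.b : Level 3 N)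
      + (levelElt N Three.c : Level 3 N)) * u =
    u * ((levelElt N Three.a : Level 3 N) + (levelElt N Three.b : Level 3 N)
      + (levelElt N Three.c : Level 3 N)) := by
  obtain ⟨u, rfl⟩ := toLevel_surjective 3 N u
  have h := congrArg (toLevel 3 N) (chord_sum_mul_comm u)
  rwa [map_mul, map_mul, map_add, map_add] at h

/-- The permutation `132` exchanges `a` with `c` and fixes `b`, so the inverse enters only as a
right inverse of `Φ(c, b)`. -/
theorem hatLevel_cable_phi_mul_inv (Φ : (ChordHat 3)ˣ) {f : MvPowerSeries (Fin 2) ℚ}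
    (hΦ : (Φ : ChordHat 3) = Three.phi f) :
    truncPhi N f (levelElt N Three.c : Level 3 N) (levelElt N Three.b : Level 3 N)
      * hatLevel 3 N (cable ![{0}, {2}, {1}] (by decide)
        ((Φ⁻¹ : (ChordHat 3)ˣ) : ChordHat 3)) = 1 := by
  have h : hatLevel 3 N (cable ![{0}, {2}, {1}] (by decide) (Φ : ChordHat 3)) =
      truncPhi N f (levelElt N Three.c : Level 3 N) (levelElt N Three.b : Level 3 N) := by
    rw [hΦ, hatLevel_cable_phi]
    simp only [Matrix.cons_val_zero, Matrix.cons_val_one, Matrix.cons_val, Finset.sum_singleton]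
    rw [chordElt_comm 2 1]
    rfl
  rw [← h, ← map_mul, ← map_mul, Units.mul_inv, map_one, map_one]

theorem hatLevel_cable_phi_rotate (f : MvPowerSeries (Fin 2) ℚ) :
    hatLevel 3 N (cable ![{2}, {0}, {1}] (by decide) (Three.phi f)) =
      truncPhi N f (levelElt N Three.c : Level 3 N) (levelElt N Three.a : Level 3 N) := by
  rw [hatLevel_cable_phi]
  simp only [Matrix.cons_val_zero, Matrix.cons_val_one, Matrix.cons_val, Finset.sum_singleton]
  rw [chordElt_comm 2 0]
  rfl

theorem cableAlg_chord_two {m : ℕ} (S : Fin 2 → Finset (Fin m))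
    (hS : ∀ i j, i ≠ j → Disjoint (S i) (S j)) :
    cableAlg S hS (chord 0 1 : chordAug 2) = ∑ p ∈ S 0, ∑ q ∈ S 1, chordElt p q :=
  cableAlg_chordElt S hS (by decide)

theorem cableAlg_chord_doubled :
    toLevel 3 N (cableAlg ![{0, 1}, {2}] (by decide) (chord 0 1 : chordAug 2)) =
      ((levelElt N Three.b + levelElt N Three.c : levelAug 3 N) : Level 3 N) := by
  rw [cableAlg_chord_two]
  simp only [Matrix.cons_val_zero, Matrix.cons_val_one, Finset.sum_singleton]
  rw [Finset.sum_pair (by decide), add_comm, map_add]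
  rfl

theorem cableAlg_chord_b :
    toLevel 3 N (cableAlg ![{1}, {2}] (by decide) (chord 0 1 : chordAug 2)) =
      (levelElt N Three.b : Level 3 N) := by
  rw [cableAlg_chord_two]
  simp only [Matrix.cons_val_zero, Matrix.cons_val_one, Finset.sum_singleton]
  rfl

theorem cableAlg_chord_c :
    toLevel 3 N (cableAlg ![{0}, {2}] (by decide) (chord 0 1 : chordAug 2)) =
      (levelElt N Three.c : Level 3 N) := by
  rw [cableAlg_chord_two]
  simp only [Matrix.cons_val_zero, Matrix.cons_val_one, Finset.sum_singleton]
  rfl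

theorem hatLevel_hexagon_right {q : ℚ} {f : MvPowerSeries (Fin 2) ℚ}
    {R : ChordHat 2} {Φ : (ChordHat 3)ˣ} (hΦ : (Φ : ChordHat 3) = Three.phi f)
    (hR : ∀ (S : Fin 2 → Finset (Fin 3)) (hS : ∀ i j, i ≠ j → Disjoint (S i) (S j)),
      hatLevel 3 N (cable S hS R) =
        IsNilpotent.exp (q • toLevel 3 N (cableAlg S hS (chord 0 1 : chordAug 2)))) :
    hatLevel 3 N ((Φ : ChordHat 3) * cable ![{1}, {2}] (by decide) R
        * cable ![{0}, {2}, {1}] (by decide) ((Φ⁻¹ : (ChordHat 3)ˣ) : ChordHat 3)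
        * cable ![{0}, {2}] (by decide) R
        * cable ![{2}, {0}, {1}] (by decide) (Φ : ChordHat 3)) =
      truncPhi N f (levelElt N Three.a : Level 3 N) (levelElt N Three.b : Level 3 N)
        * IsNilpotent.exp ((q • levelElt N Three.b : levelAug 3 N) : Level 3 N)
        * hatLevel 3 N (cable ![{0}, {2}, {1}] (by decide)
            ((Φ⁻¹ : (ChordHat 3)ˣ) : ChordHat 3))
        * IsNilpotent.exp ((q • levelElt N Three.c : levelAug 3 N) : Level 3 N)
        * truncPhi N f (levelElt N Three.c : Level 3 N) (levelElt N Three.a : Level 3 N) := by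
  have hb := hR ![{1}, {2}] (by decide)
  have hc := hR ![{0}, {2}] (by decide)
  rw [cableAlg_chord_b] at hb
  rw [cableAlg_chord_c] at hc
  rw [map_mul, map_mul, map_mul, map_mul]
  refine congrArg₂ (· * ·) (congrArg₂ (· * ·) (congrArg (· * _) (congrArg₂ (· * ·) ?_ hb)) hc) ?_
  · rw [hΦ, hatLevel_phi]
  · rw [hΦ, hatLevel_cable_phi_rotate]

theorem posHexagon_of_exp {q : ℚ} (hq : q * q = 1) {f : MvPowerSeries (Fin 2) ℚ}
    (hf : hexSerRight q f = MvPowerSeries.subst (![q • MvPowerSeries.X 0, q • MvPowerSeries.X 1] :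
      Fin 2 → MvPowerSeries (Fin 2) ℚ) hexSer)
    {R : (ChordHat 2)ˣ} {Φ : (ChordHat 3)ˣ} (hΦ : (Φ : ChordHat 3) = Three.phi f)
    (hR : ∀ (N : ℕ) (S : Fin 2 → Finset (Fin 3)) (hS : ∀ i j, i ≠ j → Disjoint (S i) (S j)),
      hatLevel 3 N (cable S hS (R : ChordHat 2)) =
        IsNilpotent.exp (q • toLevel 3 N (cableAlg S hS (chord 0 1 : chordAug 2)))) :
    PosHexagon R Φ := by
  refine eqMod2FF_iff_hatLevel.2 fun N => ?_
  rw [hatLevel_hexagon_right hΦ (hR N), exp_add_sub_exp_mul_exp_eq_product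
    (frozenFeet_levelAug 3 N) levelElt_sum_mul_comm f (hatLevel_cable_phi_mul_inv Φ hΦ) q hq hf,
    hR, cableAlg_chord_doubled, ← smul_add]
  rfl

theorem pentagon_phi {f : MvPowerSeries (Fin 2) ℚ}
    (hsymm : MvPowerSeries.subst
      (![MvPowerSeries.X 1, MvPowerSeries.X 0] : Fin 2 → MvPowerSeries (Fin 2) ℚ) f = f)
    {Φ : (ChordHat 3)ˣ} (hΦ : (Φ : ChordHat 3) = Three.phi f) : Pentagon Φ := by
  refine eqMod2FF_iff_hatLevel.2 fun N => ?_
  have four : ∀ i j k : Fin 4, i ≠ j → i ≠ k → j ≠ k →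
      Commute (levelElt N (chord i j) : Level 4 N)
        ((levelElt N (chord i k) : Level 4 N) + (levelElt N (chord j k) : Level 4 N)) :=
    fun i j k hij hik hjk => by
      have h := (chordElt_fourT hij hik hjk).map (toLevel 4 N)
      rwa [map_add] at h
  have loc : ∀ i j k l : Fin 4, i ≠ j → i ≠ k → i ≠ l → j ≠ k → j ≠ l → k ≠ l →
      Commute (levelElt N (chord i j) : Level 4 N) (levelElt N (chord k l) : Level 4 N) :=
    fun i j k l hij hik hil hjk hjl hkl =>
      (chordElt_local hij hik hil hjk hjl hkl).map (toLevel 4 N)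
  have symm : ∀ i j : Fin 4, levelElt N (chord i j) = levelElt N (chord j i) := fun i j =>
    congrArg (levelElt N) (Subtype.ext (chordElt_comm i j))
  have h := pentagon_truncPhi (frozenFeet_levelAug 4 N) hsymm
    (p := levelElt N (chord 0 1)) (q := levelElt N (chord 0 2)) (s := levelElt N (chord 0 3))
    (u := levelElt N (chord 1 2)) (v := levelElt N (chord 1 3)) (w := levelElt N (chord 2 3))
    (loc 0 1 2 3 (by decide) (by decide) (by decide) (by decide) (by decide) (by decide))
    (loc 0 2 1 3 (by decide) (by decide) (by decide) (by decide) (by decide) (by decide))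
    (loc 0 3 1 2 (by decide) (by decide) (by decide) (by decide) (by decide) (by decide))
    (four 0 1 2 (by decide) (by decide) (by decide))
    (four 0 1 3 (by decide) (by decide) (by decide))
    (symm 2 1 ▸ four 0 2 1 (by decide) (by decide) (by decide))
    (four 0 2 3 (by decide) (by decide) (by decide))
    (symm 3 1 ▸ four 0 3 1 (by decide) (by decide) (by decide))
    (symm 3 2 ▸ four 0 3 2 (by decide) (by decide) (by decide))
    (symm 1 0 ▸ symm 2 0 ▸ four 1 2 0 (by decide) (by decide) (by decide))
    (four 1 2 3 (by decide) (by decide) (by decide))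
    (symm 1 0 ▸ symm 3 0 ▸ four 1 3 0 (by decide) (by decide) (by decide))
    (symm 3 2 ▸ four 1 3 2 (by decide) (by decide) (by decide))
    (symm 2 0 ▸ symm 3 0 ▸ four 2 3 0 (by decide) (by decide) (by decide))
    (symm 2 1 ▸ symm 3 1 ▸ four 2 3 1 (by decide) (by decide) (by decide))
  rw [map_mul, map_mul, map_mul, hΦ]
  simp only [hatLevel_cable_phi, Matrix.cons_val_zero, Matrix.cons_val_one, Matrix.cons_val,
    Finset.sum_singleton]
  rw [Finset.sum_pair (by decide), Finset.sum_pair (by decide), Finset.sum_pair (by decide),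
    Finset.sum_pair (by decide)]
  simp only [map_add]
  exact h

end Conclusion

theorem mainTheorem3 (l : MvPowerSeries (Fin 2) ℚ)
    (hsymm : MvPowerSeries.subst
      (![MvPowerSeries.X 1, MvPowerSeries.X 0] : Fin 2 → MvPowerSeries (Fin 2) ℚ) l = l) :
    ∃ (R : (ChordHat 2)ˣ) (Φ : (ChordHat 3)ˣ),
      (R : ChordHat 2) = hatExp (chord 0 1) ∧
      (Φ : ChordHat 3) = Three.phi l ∧
      (HexEq.Holds l → PosHexagon R Φ ∧ NegHexagon R Φ ∧ Pentagon Φ) ∧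
      HasHexComponents
        (hatExp (Three.b + Three.c) - hatExp Three.b * hatExp Three.c) HexEq.lhs ∧
      HasHexComponents
        ((Φ : ChordHat 3)
            * cable ![{1}, {2}] (by decide) (R : ChordHat 2)
            * cable ![{0}, {2}, {1}] (by decide) ((Φ⁻¹ : (ChordHat 3)ˣ) : ChordHat 3)
            * cable ![{0}, {2}] (by decide) (R : ChordHat 2)
            * cable ![{2}, {0}, {1}] (by decide) (Φ : ChordHat 3)
          - hatExp Three.b * hatExp Three.c) (HexEq.rhs l) ∧
      (∀ P Q S : MvPowerSeries (Fin 2) ℚ, EqMod2FF (Three.ofComponents P Q S) 0 →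
        P = 0 ∧ Q = 0 ∧ S = 0) := by

  obtain ⟨R, hR⟩ := isUnit_hatExp (chord (0 : Fin 2) 1)
  obtain ⟨Φ, hΦ⟩ := isUnit_phi l
  have hexp : ∀ (N : ℕ) (S : Fin 2 → Finset (Fin 3)) (hS : ∀ i j, i ≠ j → Disjoint (S i) (S j)),
      hatLevel 3 N (cable S hS (R : ChordHat 2)) =
        IsNilpotent.exp (toLevel 3 N (cableAlg S hS (chord 0 1 : chordAug 2))) :=
    fun N S hS => by rw [hR, hatLevel_cable_hatExp]
  have hexp_inv : ∀ (N : ℕ) (S : Fin 2 → Finset (Fin 3))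
      (hS : ∀ i j, i ≠ j → Disjoint (S i) (S j)),
      hatLevel 3 N (cable S hS ((R⁻¹ : (ChordHat 2)ˣ) : ChordHat 2)) =
        IsNilpotent.exp (-toLevel 3 N (cableAlg S hS (chord 0 1 : chordAug 2))) := by
    intro N S hS
    have hx : toLevel 3 N (cableAlg S hS (chord 0 1 : chordAug 2)) ∈ levelAug 3 N :=
      ⟨_, chordAug_le_comap S hS (chord 0 1).2, rfl⟩
    refine left_inv_eq_right_inv (a := hatLevel 3 N (cable S hS (R : ChordHat 2))) ?_ ?_
    · rw [← map_mul, ← map_mul, Units.inv_mul, map_one, map_one]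
    · rw [hexp]
      exact IsNilpotent.exp_mul_exp_neg_self
        ⟨N, pow_eq_zero_of_frozenFeet (frozenFeet_levelAug 3 N) ⟨_, hx⟩⟩
  refine ⟨R, Φ, hR, hΦ, fun hl => ⟨?_, ?_, pentagon_phi hsymm hΦ⟩, ?_, ?_,
    fun P Q S h => ofComponents_eq_zero h⟩
  · refine posHexagon_of_exp (q := 1) (by norm_num) ?_ hΦ fun N S hS => by rw [hexp, one_smul]
    rw [hexSerRight_one_of_holds hl, one_smul, one_smul]
    conv_lhs => rw [← id_eq hexSer, ← MvPowerSeries.subst_self]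
    congr 1
    ext1 i
    fin_cases i <;> rfl
  -- The negative hexagon is the case `q = -1`, because `R⁻¹` is the exponential of `-t¹²`.
  · refine posHexagon_of_exp (q := -1) (by norm_num) ?_ hΦ
      fun N S hS => by rw [hexp_inv, neg_one_smul]
    rw [hexSerRight_neg_one_of_holds hsymm hl, neg_one_smul, neg_one_smul]
  · refine hasHexComponents_of_restrictsTo restrictsTo_lhs (eqMod2FF_iff_hatLevel.2 fun N => ?_)
    rw [map_sub, map_mul, hatLevel_hatExp, hatLevel_hatExp, hatLevel_hatExp, levelElt_add,
      exp_add_sub_exp_mul_exp (frozenFeet_levelAug 3 N), hatLevel_ofComponents,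
      (com_eq_of_central (frozenFeet_levelAug 3 N) levelElt_sum_mul_comm).1]
  · refine hasHexComponents_of_restrictsTo (restrictsTo_rhs l)
      (eqMod2FF_iff_hatLevel.2 fun N => ?_)
    have hmul := hatLevel_cable_phi_mul_inv (N := N) Φ hΦ
    have h := hexagon_right_components (frozenFeet_levelAug 3 N) levelElt_sum_mul_comm l hmul
    have hprod := hatLevel_hexagon_right (N := N) (q := 1) hΦ fun S hS => by rw [hexp, one_smul]
    rw [one_smul, one_smul] at hprod
    rw [map_sub, hprod, map_mul, hatLevel_hatExp, hatLevel_hatExp, h, hatLevel_ofComponents]
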